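/- Let $L>0$ and $X_0\in\mathbb R$. Consider curves $Z:[-\frac L2,\frac L2]\to\mathbb C$ that are real analytic with $|\partial_sZ|=1$ on the open interval and differentiable at the two end points, with energy $\mathcal E[Z]=\frac12\int_{-L/2}^{L/2}k^2\,ds\in[0,\infty]$, where $\partial_s^2Z=\sqrt{-1}\,k\,\partial_sZ$. For $W>0$ a minimizer at width $W$ is a minimizer of $\mathcal E$ among all such curves satisfying the bending-test boundary condition $$Z(\pm\tfrac L2)=X_0\pm\tfrac W2\sqrt{-1},\qquad \partial_sZ(\pm\tfrac L2)=\sqrt{-1}.$$ Call $Z$ down-concave if $\mathrm{Re}\,Z(s)\ge X_0$ for all $s$. Put $w(t)=(1-t)L$. For $0\le T<1$, a compression orbit on $[0,T]$ is a family $(Z_t)_{t\in[0,T]}$, continuous in $t$ for uniform convergence on $[-\frac L2,\frac L2]$, such that each $Z_t$ is a down-concave minimizer at width $w(t)$. For $a\in(-4,0]$ let $e_1=-\frac a6$, $e_2=\frac a{12}+\frac{\sqrt{-1}}4\sqrt{16-a^2}$, $e_3=\frac a{12}-\frac{\sqrt{-1}}4\sqrt{16-a^2}$, and for $\{e,f,g\}=\{e_1,e_2,e_3\}$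 let $$\Omega(e)=\int_0^\infty\frac{dr}{2\sqrt r\,\sqrt{r+e-f}\,\sqrt{r+e-g}}$$ with principal square roots (a complete elliptic integral $\int dx/(2y)$ of $y^2=(x-e_1)(x-e_2)(x-e_3)$ between $e$ and $\infty$). Put $\omega'=\Omega(e_1)$, $\omega''=\Omega(e_3)$, let $\zeta$ be the Weierstrass zeta function of the lattice $2\omega'\mathbb Z+2\omega''\mathbb Z$, and put $$u_0=\omega''-\frac{\omega'}2,\qquad \alpha=\frac{2\omega'}L,\qquad Z_{a,c}(s)=\frac{\sqrt{-1}}{\alpha}\bigl(\zeta(\alpha s+u_0)+e_1\alpha s\bigr)+c\qquad(c\in\mathbb C).$$ Then: 1. For every $a\in(-4,0]$, $Z_{a,c}$ is of type Ia: $\hat\omega=2\omega'$ is real and positive, $\omega''/\omega'\in\frac12+\sqrt{-1}\,\mathbb R_{>0}$, and there is a continuous $L$-periodic function $\varphi:\mathbb R\to\mathbb R$ (so the tangential index is zero), independent of $c$, with $\partial_sZ_{a,c}=e^{\sqrt{-1}\varphi}$ on $\mathbb R$. 2. There is a continuous, strictly increasing function $a\mapsto t(a)$ on $[-4,0]$ with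 $t(-4)=0$, $t(0)<1$ and, for $a\in(-4,0]$ and all $c$, $$w(t(a))=\bigl(Z_{a,c}(\tfrac L2)-Z_{a,c}(-\tfrac L2)\bigr)/\sqrt{-1}.$$ 3. A compression orbit on $[0,t(0)]$ exists. For every $T\in[0,1)$ and every compression orbit $(Z_t)$ on $[0,T]$: for $a=-4$, $Z_{t(-4)}(s)=X_0+s\sqrt{-1}$ is the straight segment; and for every $a\in(-4,0]$ with $t(a)\le T$ there is a constant $c\in\mathbb R$ with $Z_{t(a)}(s)=Z_{a,c}(s)$ for all $s\in[-\frac L2,\frac L2]$. -/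

import Mathlib

open Set Filter Topology MeasureTheory

namespace Elastica

noncomputable section

/-! ### Curves parametrized by arclength and their bending energy -/

/-- `𝔐_{[s₁,s₂]}`: curves `Z` on `[s₁, s₂]` that restrict to an isometric (arclength parametrized)
real analytic immersion of `(s₁, s₂)` into `ℂ` and are differentiable at the two end points.
Only the values of `Z` on `[s₁, s₂]` matter. -/
structure IsIsometricCurve (s₁ s₂ : ℝ) (Z : ℝ → ℂ) : Prop where
  analytic : AnalyticOnNhd ℝ Z (Ioo s₁ s₂)
  isometric : ∀ s ∈ Ioo s₁ s₂, ‖deriv Z s‖ = 1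
  differentiable_left : DifferentiableWithinAt ℝ Z (Icc s₁ s₂) s₁
  differentiable_right : DifferentiableWithinAt ℝ Z (Icc s₁ s₂) s₂

/-- The curvature `k` of an arclength parametrized curve: `Z'' = i k Z'`. -/
def curvature (Z : ℝ → ℂ) (s : ℝ) : ℝ :=
  (deriv (deriv Z) s / (Complex.I * deriv Z s)).re

/-- The Euler-Bernoulli energy `½ ∫ k² ds` over `(s₁, s₂)`, with values in `[0, ∞]`. -/
def energy (s₁ s₂ : ℝ) (Z : ℝ → ℂ) : ENNReal :=
  (1 / 2) * ∫⁻ s in Ioo s₁ s₂, ENNReal.ofReal (curvature Z s ^ 2)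

/-- The bending-test boundary condition `𝔅^{BT}_W` on `[-L/2, L/2]`:
`Z (± L/2) = X₀ ± (W/2) i` and `Z' (± L/2) = i` (one-sided derivatives). -/
structure BendingTest (L X₀ W : ℝ) (Z : ℝ → ℂ) : Prop where
  left : Z (-(L / 2)) = X₀ - (W / 2) * Complex.I
  right : Z (L / 2) = X₀ + (W / 2) * Complex.I
  tangent_left : HasDerivWithinAt Z Complex.I (Icc (-(L / 2)) (L / 2)) (-(L / 2))
  tangent_right : HasDerivWithinAt Z Complex.I (Icc (-(L / 2)) (L / 2)) (L / 2)

/-- The class `𝔐_{[-L/2, L/2]} ∩ 𝔅^{BT}_W` in which the energy is minimized. -/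
def Admissible (L X₀ W : ℝ) (Z : ℝ → ℂ) : Prop :=
  IsIsometricCurve (-(L / 2)) (L / 2) Z ∧ BendingTest L X₀ W Z

/-- `Z` is a minimizer `Z_m^W` of the energy in `𝔐_{[-L/2, L/2]} ∩ 𝔅^{BT}_W`. -/
def IsMinimizer (L X₀ W : ℝ) (Z : ℝ → ℂ) : Prop :=
  Admissible L X₀ W Z ∧
    ∀ Y : ℝ → ℂ, Admissible L X₀ W Y →
      energy (-(L / 2)) (L / 2) Z ≤ energy (-(L / 2)) (L / 2) Y

/-- Down-concave shapes: the arch bulges towards the positive `X` direction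
(`X = Re Z` is the height over the line through the end points). -/
def IsDownConcave (L X₀ : ℝ) (Z : ℝ → ℂ) : Prop :=
  ∀ s ∈ Icc (-(L / 2)) (L / 2), X₀ ≤ (Z s).re

/-- The width `w(t) = (1 - t) L` at compression time `t`. -/
def compressedWidth (L t : ℝ) : ℝ := (1 - t) * L

/-- A continuous compression orbit on the time interval `[0, T]`: every `Z t` is a down-concave
energy minimizer at width `w(t)`, and `t ↦ Z t` is continuous for uniform convergence on
`[-L/2, L/2]`. -/
structure IsCompressionOrbit (L X₀ T : ℝ) (Z : ℝ → ℝ → ℂ) : Prop where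
  minimizer : ∀ t ∈ Icc 0 T, IsMinimizer L X₀ (compressedWidth L t) (Z t)
  downConcave : ∀ t ∈ Icc 0 T, IsDownConcave L X₀ (Z t)
  continuous : ∀ t ∈ Icc 0 T,
    TendstoUniformlyOn Z (Z t) (𝓝[Icc 0 T] t) (Icc (-(L / 2)) (L / 2))

/-! ### The elliptic curve `y² = (x - e₁)(x - e₂)(x - e₃)` with parameter `a`, `a² - b = 16` -/

/-- `e₁ = -a/6`. -/
def e₁ (a : ℝ) : ℂ := -(a : ℂ) / 6

/-- `e₂ = a/12 + √b/4` with `√b = √(a² - 16) = i √(16 - a²)` for `|a| ≤ 4`. -/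
def e₂ (a : ℝ) : ℂ := (a : ℂ) / 12 + (Real.sqrt (16 - a ^ 2) : ℂ) * Complex.I / 4

/-- `e₃ = a/12 - √b/4`. -/
def e₃ (a : ℝ) : ℂ := (a : ℂ) / 12 - (Real.sqrt (16 - a ^ 2) : ℂ) * Complex.I / 4

/-- The complete elliptic integral of the first kind between `∞` and the branch point `(e, 0)`
of `y² = (x - e)(x - f)(x - g)`, i.e. `∫ dx / (2y)` along the horizontal ray `x = e + r`, `r > 0`,
on the sheet where `y = √(x - e) √(x - f) √(x - g)` with principal square roots. -/
def halfPeriod (e f g : ℂ) : ℂ :=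
  ∫ r in Ioi (0 : ℝ), 1 / (2 * ((r : ℂ) ^ (1 / 2 : ℂ) *
    ((r : ℂ) + (e - f)) ^ (1 / 2 : ℂ) * ((r : ℂ) + (e - g)) ^ (1 / 2 : ℂ)))

/-- `ω'`, the half period belonging to the branch point `e₁`. -/
def ω' (a : ℝ) : ℂ := halfPeriod (e₁ a) (e₂ a) (e₃ a)

/-- `ω''`, the half period belonging to the branch point `e₃`. -/
def ω'' (a : ℝ) : ℂ := halfPeriod (e₃ a) (e₁ a) (e₂ a)

/-- The lattice point `2 m ω₁ + 2 n ω₂`, where `ω₁`, `ω₂` are half periods. -/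
def latticePoint (ω₁ ω₂ : ℂ) (p : ℤ × ℤ) : ℂ := 2 * p.1 * ω₁ + 2 * p.2 * ω₂

/-- The Weierstrass `ζ`-function of the lattice `2ω₁ ℤ + 2ω₂ ℤ`. -/
def weierstrassZeta (ω₁ ω₂ u : ℂ) : ℂ :=
  1 / u + ∑' p : {p : ℤ × ℤ // p ≠ 0},
    (1 / (u - latticePoint ω₁ ω₂ p) + 1 / latticePoint ω₁ ω₂ p
      + u / latticePoint ω₁ ω₂ p ^ 2)

/-- `ζ` for the curve with parameter `a`. -/
def ζ (a : ℝ) (u : ℂ) : ℂ := weierstrassZeta (ω' a) (ω'' a) u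

/-- `u₀ = ω'' - ω'/2`. -/
def u₀ (a : ℝ) : ℂ := ω'' a - ω' a / 2

/-- `α = 2ω'/L`. -/
def α (L a : ℝ) : ℂ := 2 * ω' a / L

/-- The type Ia elastica of length `L` with parameter `a` and additive constant `c`:
`s ↦ (i/α) (ζ(α s + u₀) + e₁ α s) + c`. -/
def typeIa (L a : ℝ) (c : ℂ) (s : ℝ) : ℂ :=
  Complex.I / α L a * (ζ a (α L a * s + u₀ a) + e₁ a * (α L a * s)) + c

end

end Elastica

/-! Write `Z' = i e^{iθ}`. An admissible curve of finite energy has a continuous angle `θ` with `θ'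
= k`, `θ(-L/2) = 0` and `θ(L/2) ∈ 2πℤ`, and the boundary condition becomes `∫ cos θ = W`, `∫ sin θ =
0` (`Admissible.exists_angle`). The natural parameter is `m = (4 + a)/8 ∈ [0, 1/2]`. The candidate
of parameter `m` is the swing `sin(θ/2) = √m sin am(σ s)` of the pendulum `θ'' = -σ² sin θ`, with `σ
= 4K(m)/L`. Its width is `L N(m)/K(m)` with `N = 2E - K`. Since `N` is nonincreasing and positive
and `K` strictly increasing on `[0, 1/2]`, the time `1 - N/K` is a continuous strictly increasing
function of `m`.

That the candidate minimizes is shown by direct comparison, without an existence theorem. Suppose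
first `θ(L/2) = 0`. The intermediate value theorem yields two antipodal parameters, `L/2` apart,
where `θ` takes the same value `c`; they cut the closed angle function into two arcs of length `L/2`
on which `θ - c` vanishes at both ends. On an arc where `sin²((θ - c)/2)` has maximum `M`,
completing the square gives `k²/2 = defect + 2σ |k| √(M - sin²((θ - c)/2)) - 2σ² (M - sin²((θ -
c)/2))`. The middle term integrates to at least `4σ H(M)` with `H = 2(E - (1 - m)K)`, because `θ -
c` must climb to its extreme value and return (for `M = 1` as a limit). `H` is convex with `H' = K`,
quantitatively in `ellH_convex`; since `σ L/2 = 2K(m)`, the part of the bound linear in `M` cancels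
the term `-2σ² M L/2`. Adding both arcs, the energy exceeds that of the candidate by the defects, a
multiple of `Σ (M - m)²` and a multiple of `1 - cos c` (`exists_defect_le`). Equality therefore
forces `k² = 4σ² (m - sin²(θ/2))`. Analyticity upgrades this to the pendulum equation, ODE
uniqueness leaves the candidate and its mirror image, and down-concavity rejects the mirror image.
If `θ(L/2) = 2πn` with `n ≠ 0`, a cruder estimate and `K(m) < 2` give strictly larger energy
(`elasticaEnergy_lt_of_winding`). The segment is handled by `Admissible.eq_segment`.

It remains to recognize the candidate in the zeta function. The integrals are `ω' = K(m)` and, by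
moving the starting point of the ray along the unit circle, `ω'' = (K(m) + i K(1 - m))/2` (`ω'_eq`,
`ω''_eq`). Conversely, the invariants of this rhombic lattice have to be recovered from its periods:
on the real and the imaginary axis `℘` solves a real ODE whose periods are complete integrals of
complementary parameters, and monotonicity of `K` pins down parameter and scale
(`inversionConst_ellLattice`). Hence `Z_{a,c}' = i (e₁ - ℘)`, and `e₁ - ℘` on the line through `iK(1
- m)/2` parallel to the real axis has modulus one, by the inversion formula for translation by a
half period. It satisfies the same second order equation and initial data as `e^{iθ}`, so the two
agree (`ellTangent_eq_exp`). -/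

namespace Elastica

noncomputable section

/-! ### Elliptic integrals in Legendre form -/

/-- The delta amplitude `√(1 - m sin² φ)` of parameter `m`. -/
def delta (m φ : ℝ) : ℝ := Real.sqrt (1 - m * Real.sin φ ^ 2)

/-- The incomplete elliptic integral of the first kind of parameter `m`. -/
def ellF (m φ : ℝ) : ℝ := ∫ t in (0 : ℝ)..φ, (delta m t)⁻¹

/-- The complete elliptic integral of the first kind of parameter `m`. -/
def ellK (m : ℝ) : ℝ := ellF m (Real.pi / 2)

/-- The integral `∫ (1 - 2 m sin² φ) / √(1 - m sin² φ) = 2 E - K` over a quarter period. -/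
def ellN (m : ℝ) : ℝ :=
  ∫ t in (0 : ℝ)..(Real.pi / 2), (1 - 2 * m * Real.sin t ^ 2) * (delta m t)⁻¹

/-- `2 (E - (1 - m) K)`. -/
def ellH (m : ℝ) : ℝ := ellN m - (1 - 2 * m) * ellK m

lemma sin_sq_mem (φ : ℝ) : 0 ≤ Real.sin φ ^ 2 ∧ Real.sin φ ^ 2 ≤ 1 :=
  ⟨sq_nonneg _, Real.sin_sq_le_one φ⟩

lemma one_sub_pos_of_lt_one {m : ℝ} (hm : m < 1) (φ : ℝ) : 0 < 1 - m * Real.sin φ ^ 2 := by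
  obtain ⟨h0, h1⟩ := sin_sq_mem φ
  by_cases h : 0 ≤ m
  · nlinarith
  · nlinarith

lemma delta_pos {m : ℝ} (hm : m < 1) (φ : ℝ) : 0 < delta m φ :=
  Real.sqrt_pos.2 (one_sub_pos_of_lt_one hm φ)

lemma delta_sq {m : ℝ} (hm : m < 1) (φ : ℝ) : delta m φ ^ 2 = 1 - m * Real.sin φ ^ 2 :=
  Real.sq_sqrt (one_sub_pos_of_lt_one hm φ).le

lemma delta_le_one {m : ℝ} (hm : 0 ≤ m) (φ : ℝ) : delta m φ ≤ 1 := by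
  refine Real.sqrt_le_one.2 ?_
  nlinarith [sin_sq_mem φ, mul_nonneg hm (sin_sq_mem φ).1]

lemma one_le_inv_delta {m : ℝ} (hm : 0 ≤ m) (hm1 : m < 1) (φ : ℝ) : 1 ≤ (delta m φ)⁻¹ :=
  (one_le_inv₀ (delta_pos hm1 φ)).2 (delta_le_one hm φ)

lemma delta_zero_left (φ : ℝ) : delta 0 φ = 1 := by simp [delta]

lemma delta_add_pi (m φ : ℝ) : delta m (φ + Real.pi) = delta m φ := by
  simp [delta, Real.sin_add_pi]

lemma delta_neg (m φ : ℝ) : delta m (-φ) = delta m φ := by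
  simp [delta]

lemma continuous_delta_uncurry : Continuous fun p : ℝ × ℝ => delta p.1 p.2 := by
  unfold delta; fun_prop

@[fun_prop]
lemma continuous_delta (m : ℝ) : Continuous (delta m) := by
  unfold delta; fun_prop

lemma continuous_inv_delta {m : ℝ} (hm : m < 1) : Continuous fun t => (delta m t)⁻¹ :=
  (continuous_delta m).inv₀ fun t => (delta_pos hm t).ne'

lemma intervalIntegrable_inv_delta {m : ℝ} (hm : m < 1) (a b : ℝ) :
    IntervalIntegrable (fun t => (delta m t)⁻¹) volume a b :=
  (continuous_inv_delta hm).intervalIntegrable a b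

lemma hasDerivAt_ellF {m : ℝ} (hm : m < 1) (φ : ℝ) : HasDerivAt (ellF m) (delta m φ)⁻¹ φ :=
  intervalIntegral.integral_hasDerivAt_right (intervalIntegrable_inv_delta hm 0 φ)
    (continuous_inv_delta hm).aestronglyMeasurable.stronglyMeasurableAtFilter
    (continuous_inv_delta hm).continuousAt

lemma hasDerivAt_delta {m : ℝ} (hm : m < 1) (φ : ℝ) :
    HasDerivAt (delta m) (-(m * Real.sin φ * Real.cos φ) / delta m φ) φ := by
  have h1 : HasDerivAt (fun φ => 1 - m * Real.sin φ ^ 2)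
      (-(2 * (m * Real.sin φ * Real.cos φ))) φ := by
    have := (((Real.hasDerivAt_sin φ).pow 2).const_mul m).const_sub 1
    refine this.congr_deriv ?_
    ring
  refine (h1.sqrt (one_sub_pos_of_lt_one hm φ).ne').congr_deriv ?_
  change _ / (2 * delta m φ) = _
  have := (delta_pos hm φ).ne'
  field_simp

lemma ellF_zero_right (m : ℝ) : ellF m 0 = 0 := by simp [ellF]

lemma ellF_zero_left (φ : ℝ) : ellF 0 φ = φ := by simp [ellF, delta_zero_left]

lemma strictMono_ellF {m : ℝ} (hm : m < 1) : StrictMono (ellF m) :=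
  strictMono_of_deriv_pos fun φ => by
    rw [(hasDerivAt_ellF hm φ).deriv]; exact inv_pos.2 (delta_pos hm φ)

lemma ellF_neg (m φ : ℝ) : ellF m (-φ) = -ellF m φ := by
  have h := intervalIntegral.integral_comp_neg (a := 0) (b := φ) fun t => (delta m t)⁻¹
  simp only [delta_neg, neg_zero] at h
  rw [ellF, ellF, h, intervalIntegral.integral_symm]

lemma ellF_add_pi {m : ℝ} (hm : m < 1) (φ : ℝ) : ellF m (φ + Real.pi) = ellF m φ + 2 * ellK m := by
  have hper : Function.Periodic (fun t => (delta m t)⁻¹) Real.pi := fun t => by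
    simp [delta_add_pi]
  have h1 : ellF m (φ + Real.pi) = ellF m φ + ∫ t in φ..(φ + Real.pi), (delta m t)⁻¹ :=
    (intervalIntegral.integral_add_adjacent_intervals
      (intervalIntegrable_inv_delta hm _ _) (intervalIntegrable_inv_delta hm _ _)).symm
  have h2 := hper.intervalIntegral_add_eq φ (-(Real.pi / 2))
  have h3 : -(Real.pi / 2) + Real.pi = Real.pi / 2 := by ring
  rw [h3] at h2
  have h4 : ∫ t in (-(Real.pi / 2))..(Real.pi / 2), (delta m t)⁻¹ = 2 * ellK m := by
    rw [← intervalIntegral.integral_add_adjacent_intervals (b := 0)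
      (intervalIntegrable_inv_delta hm _ _) (intervalIntegrable_inv_delta hm _ _),
      intervalIntegral.integral_symm]
    have := ellF_neg m (Real.pi / 2)
    unfold ellF at this
    rw [this, ellK, ellF]; ring
  rw [h1, h2, h4]

lemma ellF_pi {m : ℝ} (hm : m < 1) : ellF m Real.pi = 2 * ellK m := by
  simpa [ellF_zero_right] using ellF_add_pi hm 0

/-- The integrand is at least one. This expansion property later gives surjectivity of `ellF`, the
Lipschitz bound for the amplitude, and its joint continuity in the parameter. -/
lemma abs_sub_le_abs_ellF_sub {m : ℝ} (hm : 0 ≤ m) (hm1 : m < 1) (x y : ℝ) :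
    |x - y| ≤ |ellF m x - ellF m y| := by
  have key : ∀ x y : ℝ, y ≤ x → x - y ≤ ellF m x - ellF m y := by
    intro x y hxy
    have h1 : ellF m x - ellF m y = ∫ t in y..x, (delta m t)⁻¹ :=
      intervalIntegral.integral_interval_sub_left (intervalIntegrable_inv_delta hm1 _ _)
        (intervalIntegrable_inv_delta hm1 _ _)
    rw [h1]
    calc x - y = ∫ _ in y..x, (1 : ℝ) := by simp
      _ ≤ _ := intervalIntegral.integral_mono_on hxy (by simp)
        (intervalIntegrable_inv_delta hm1 _ _) fun t _ => one_le_inv_delta hm hm1 t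
  rcases le_total y x with h | h
  · rw [abs_of_nonneg (sub_nonneg.2 h),
      abs_of_nonneg (sub_nonneg.2 ((strictMono_ellF hm1).monotone h))]
    exact key x y h
  · rw [abs_sub_comm, abs_sub_comm (ellF m x), abs_of_nonneg (sub_nonneg.2 h),
      abs_of_nonneg (sub_nonneg.2 ((strictMono_ellF hm1).monotone h))]
    exact key y x h

lemma surjective_ellF {m : ℝ} (hm : 0 ≤ m) (hm1 : m < 1) : Function.Surjective (ellF m) := by
  have hc : Continuous (ellF m) :=
    continuous_iff_continuousAt.2 fun φ => (hasDerivAt_ellF hm1 φ).continuousAt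
  have h1 : ∀ x, 0 ≤ x → x ≤ ellF m x := fun x hx => by
    have := abs_sub_le_abs_ellF_sub hm hm1 x 0
    rw [ellF_zero_right, sub_zero, sub_zero, abs_of_nonneg hx, abs_of_nonneg] at this
    · exact this
    · rw [← ellF_zero_right m]; exact (strictMono_ellF hm1).monotone hx
  refine hc.surjective ?_ ?_
  · exact tendsto_atTop_mono' _ ((eventually_ge_atTop 0).mono h1) tendsto_id
  · refine tendsto_atBot_mono' _ ((eventually_le_atBot 0).mono fun x hx => ?_) tendsto_id
    have := h1 (-x) (by linarith)
    rw [ellF_neg] at this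
    simp only [id]; linarith

lemma ellK_pos {m : ℝ} (hm : m < 1) : 0 < ellK m := by
  have := strictMono_ellF hm (show (0 : ℝ) < Real.pi / 2 by positivity)
  rwa [ellF_zero_right] at this

lemma delta_anti {m n : ℝ} (hmn : m ≤ n) (φ : ℝ) : delta n φ ≤ delta m φ :=
  Real.sqrt_le_sqrt (by nlinarith [sin_sq_mem φ, mul_le_mul_of_nonneg_right hmn (sin_sq_mem φ).1])

lemma ellK_strictMonoOn : StrictMonoOn ellK (Iio 1) := by
  intro m hm n hn hmn
  have hm : m < 1 := hm
  have hn : n < 1 := hn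
  refine intervalIntegral.integral_lt_integral_of_continuousOn_of_le_of_exists_lt
    (by positivity) (continuous_inv_delta hm).continuousOn (continuous_inv_delta hn).continuousOn
    (fun t _ => (inv_le_inv₀ (delta_pos hm t) (delta_pos hn t)).2 (delta_anti hmn.le t))
    ⟨Real.pi / 2, ⟨by positivity, le_rfl⟩, ?_⟩
  refine (inv_lt_inv₀ (delta_pos hm _) (delta_pos hn _)).2 (Real.sqrt_lt_sqrt ?_ ?_)
  · exact (one_sub_pos_of_lt_one hn _).le
  · simp; exact hmn

lemma continuous_ellN_integrand {m : ℝ} (hm : m < 1) :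
    Continuous fun t => (1 - 2 * m * Real.sin t ^ 2) * (delta m t)⁻¹ :=
  Continuous.mul (by fun_prop) (continuous_inv_delta hm)

/-- The integrand equals `2δ - δ⁻¹`, which is increasing in `δ`, and `δ` decreases with the
parameter. -/
lemma ellN_antitoneOn : AntitoneOn ellN (Iio 1) := by
  intro m hm n hn hmn
  have hm : m < 1 := hm
  have hn : n < 1 := hn
  refine intervalIntegral.integral_mono_on (by positivity)
    ((continuous_ellN_integrand hn).intervalIntegrable _ _)
    ((continuous_ellN_integrand hm).intervalIntegrable _ _) fun t _ => ?_
  have key : ∀ {k : ℝ}, k < 1 → (1 - 2 * k * Real.sin t ^ 2) * (delta k t)⁻¹ =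
      2 * delta k t - (delta k t)⁻¹ := fun {k} hk => by
    have h := delta_sq hk t
    have h' := (delta_pos hk t).ne'
    field_simp
    linarith
  rw [key hm, key hn]
  have := (inv_le_inv₀ (delta_pos hm t) (delta_pos hn t)).2 (delta_anti hmn t)
  have := delta_anti hmn t
  linarith

lemma ellN_pos {m : ℝ} (hm : m ≤ 1 / 2) : 0 < ellN m := by
  have hm1 : m < 1 := by linarith
  refine intervalIntegral.intervalIntegral_pos_of_pos_on
    ((continuous_ellN_integrand hm1).intervalIntegrable _ _) (fun t ht => ?_) (by positivity)
  refine mul_pos ?_ (inv_pos.2 (delta_pos hm1 t))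
  have hc : 0 < Real.cos t := Real.cos_pos_of_mem_Ioo ⟨by linarith [ht.1, Real.pi_pos], ht.2⟩
  nlinarith [sin_sq_mem t, Real.sin_sq_add_cos_sq t, mul_le_mul_of_nonneg_right hm (sin_sq_mem t).1]

lemma ellN_zero : ellN 0 = Real.pi / 2 := by simp [ellN, delta_zero_left]

lemma ellK_zero : ellK 0 = Real.pi / 2 := ellF_zero_left _

/-- This quotient is width over length; its monotonicity makes the compression time a valid
parameter. Only the numerator's positivity needs `m ≤ 1/2`, that is, `a ≤ 0`. -/
lemma ellN_div_ellK_strictAntiOn : StrictAntiOn (fun m => ellN m / ellK m) (Icc 0 (1 / 2)) := by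
  intro m hm n hn hmn
  have hm1 : m < 1 := by linarith [hm.2]
  have hn1 : n < 1 := by linarith [hn.2]
  change ellN n / ellK n < ellN m / ellK m
  rw [div_lt_div_iff₀ (ellK_pos hn1) (ellK_pos hm1)]
  have h1 := ellN_antitoneOn hm1 hn1 hmn.le
  have h2 := ellK_strictMonoOn hm1 hn1 hmn
  have h3 := ellN_pos hn.2
  nlinarith [ellK_pos hm1, ellK_pos hn1]

/-- For `m = 1/2` the integrand is at most `1 + sin²/2`, whose integral is `5π/8 < 2`. The bound is
what makes winding competitors lose: it gives `m K(m) < 1`. -/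
lemma ellK_lt_two {m : ℝ} (hm : m ≤ 1 / 2) : ellK m < 2 := by
  have h0 : ellK m ≤ ellK (1 / 2) := ellK_strictMonoOn.monotoneOn
    (show m < 1 by linarith) (show (1 / 2 : ℝ) < 1 by norm_num) hm
  have h1 : ellK (1 / 2) ≤ ∫ t in (0 : ℝ)..(Real.pi / 2), (1 + Real.sin t ^ 2 / 2) := by
    refine intervalIntegral.integral_mono_on (by positivity)
      (intervalIntegrable_inv_delta (by norm_num) _ _)
      ((by fun_prop : Continuous fun t : ℝ => 1 + Real.sin t ^ 2 / 2).intervalIntegrable _ _)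
      fun t _ => ?_
    have hs := sin_sq_mem t
    rw [inv_le_comm₀ (delta_pos (by norm_num) t) (by positivity)]
    refine Real.le_sqrt_of_sq_le ?_
    rw [inv_pow, inv_le_comm₀ (by positivity) (by nlinarith), inv_le_iff_one_le_mul₀ (by nlinarith)]
    nlinarith [mul_nonneg hs.1 (sub_nonneg.2 hs.2),
      mul_nonneg (mul_nonneg hs.1 hs.1) (sub_nonneg.2 hs.2)]
  have h2 : ∫ t in (0 : ℝ)..(Real.pi / 2), (1 + Real.sin t ^ 2 / 2) = Real.pi / 2 + Real.pi / 8 := by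
    rw [intervalIntegral.integral_add (by simp)
      ((by fun_prop : Continuous fun t : ℝ => Real.sin t ^ 2 / 2).intervalIntegrable _ _),
      intervalIntegral.integral_div, integral_sin_sq]
    simp; ring
  have := Real.pi_lt_d2
  linarith

end

noncomputable section

/-! ### Convexity of `ellH` -/

/-- With `u`, `v` the delta amplitudes at parameters `n`, `m`, this is the tangent line inequality
for `m ↦ m/δ`, with quadratic remainder, multiplied by `sin²` to eliminate the parameters. The
difference of the two sides factors through `(v - u)²`. -/
lemma convexity_delta_aux {u v : ℝ} (hu : 0 < u) (hu1 : u ≤ 1) (hv : 0 < v) (hv1 : v ≤ 1) :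
    (1 - v ^ 2) * v⁻¹ + (v ^ 2 - u ^ 2) * (v⁻¹ + (1 - v ^ 2) / 2 * (v⁻¹) ^ 3)
      + (v ^ 2 - u ^ 2) ^ 2 / 2 ≤ (1 - u ^ 2) * u⁻¹ := by
  have key : (1 - u ^ 2) * u⁻¹ - ((1 - v ^ 2) * v⁻¹
      + (v ^ 2 - u ^ 2) * (v⁻¹ + (1 - v ^ 2) / 2 * (v⁻¹) ^ 3) + (v ^ 2 - u ^ 2) ^ 2 / 2) =
      (v - u) ^ 2 * ((2 * v + u + u * v ^ 2) - u * v ^ 3 * (u + v) ^ 2) / (2 * u * v ^ 3) := by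
    field_simp
    ring
  have h1 : u * v ^ 3 * (u + v) ^ 2 ≤ 2 * v + u + u * v ^ 2 := by
    have e : u * v ^ 3 * (u + v) ^ 2 =
      u * (u ^ 2 * v ^ 3) + (2 * v) * (u ^ 2 * v ^ 3) + (u * v ^ 2) * v ^ 3 := by ring
    have a1 : u ^ 2 * v ^ 3 ≤ 1 := mul_le_one₀ (pow_le_one₀ hu.le hu1) (by positivity)
      (pow_le_one₀ hv.le hv1)
    have a2 : v ^ 3 ≤ 1 := pow_le_one₀ hv.le hv1
    rw [e]
    have b1 := mul_le_mul_of_nonneg_left a1 hu.le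
    have b2 := mul_le_mul_of_nonneg_left a1 (by positivity : 0 ≤ 2 * v)
    have b3 := mul_le_mul_of_nonneg_left a2 (by positivity : 0 ≤ u * v ^ 2)
    linarith
  have : 0 ≤ (v - u) ^ 2 * ((2 * v + u + u * v ^ 2) - u * v ^ 3 * (u + v) ^ 2) / (2 * u * v ^ 3) :=
    div_nonneg (mul_nonneg (sq_nonneg _) (by linarith)) (by positivity)
  linarith

lemma convexity_delta {m n : ℝ} (hm : 0 ≤ m) (hm1 : m < 1) (hn : 0 ≤ n) (hn1 : n < 1) (t : ℝ) :
    m * (delta m t)⁻¹ + (n - m) * ((delta m t)⁻¹ + m * Real.sin t ^ 2 / 2 * ((delta m t)⁻¹) ^ 3)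
      + Real.sin t ^ 2 / 2 * (n - m) ^ 2 ≤ n * (delta n t)⁻¹ := by
  have hu := delta_sq hn1 t
  have hv := delta_sq hm1 t
  rcases (sin_sq_mem t).1.eq_or_lt with h | h
  · rw [← h] at hu hv ⊢
    have h1 : delta n t = 1 := by simp [delta, ← h]
    have h2 : delta m t = 1 := by simp [delta, ← h]
    rw [h1, h2]; simp
  · have := convexity_delta_aux (delta_pos hn1 t) (delta_le_one hn t) (delta_pos hm1 t)
      (delta_le_one hm t)
    rw [hu, hv] at this
    refine le_of_mul_le_mul_left ?_ h
    refine le_trans (le_of_eq ?_) (this.trans (le_of_eq ?_)) <;> ring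

lemma ellH_eq {m : ℝ} (hm : m < 1) :
    ellH m = ∫ t in (0 : ℝ)..(Real.pi / 2), 2 * Real.cos t ^ 2 * (m * (delta m t)⁻¹) := by
  rw [ellH, ellN, ellK, ellF, ← intervalIntegral.integral_const_mul,
    ← intervalIntegral.integral_sub ((continuous_ellN_integrand hm).intervalIntegrable _ _)
      ((intervalIntegrable_inv_delta hm _ _).const_mul _)]
  congr 1
  ext t
  have := Real.sin_sq_add_cos_sq t
  rw [show Real.cos t ^ 2 = 1 - Real.sin t ^ 2 by linarith]
  ring

/-- The left side is the formal derivative of `ellH` under the integral sign, so this is `H' = K`.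
The integrands differ by the derivative of `sin · cos / δ`, which vanishes at both ends. -/
lemma integral_cos_sq_mul_delta {m : ℝ} (hm : m < 1) :
    ∫ t in (0 : ℝ)..(Real.pi / 2), 2 * Real.cos t ^ 2 *
      ((delta m t)⁻¹ + m * Real.sin t ^ 2 / 2 * ((delta m t)⁻¹) ^ 3) = ellK m := by
  have hc := continuous_inv_delta hm
  have hd : ∀ t, HasDerivAt (fun t => Real.sin t * Real.cos t * (delta m t)⁻¹)
      (2 * Real.cos t ^ 2 *
      ((delta m t)⁻¹ + m * Real.sin t ^ 2 / 2 * ((delta m t)⁻¹) ^ 3) - (delta m t)⁻¹) t := by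
    intro t
    have h0 := (delta_pos hm t).ne'
    refine (((Real.hasDerivAt_sin t).mul (Real.hasDerivAt_cos t)).mul
      ((hasDerivAt_delta hm t).inv h0)).congr_deriv ?_
    have h2 := Real.sin_sq_add_cos_sq t
    simp only [Pi.mul_apply, Pi.inv_apply]
    have h3 : Real.sin t ^ 2 = 1 - Real.cos t ^ 2 := by linarith
    field_simp
    have h4 := delta_sq hm t
    linear_combination (-delta m t ^ 2) * h2
  have hi : ∫ t in (0 : ℝ)..(Real.pi / 2), (2 * Real.cos t ^ 2 *
      ((delta m t)⁻¹ + m * Real.sin t ^ 2 / 2 * ((delta m t)⁻¹) ^ 3) - (delta m t)⁻¹) = 0 := by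
    rw [intervalIntegral.integral_eq_sub_of_hasDerivAt (fun t _ => hd t)]
    · simp
    · exact Continuous.intervalIntegrable (by fun_prop) _ _
  rw [intervalIntegral.integral_sub (Continuous.intervalIntegrable (by fun_prop) _ _)
    (hc.intervalIntegrable _ _)] at hi
  rw [ellK, ellF]
  linarith

/-- Integrating the pointwise tangent line inequality against `2 cos²`. The linear term is what
cancels in the energy bound, and the quadratic remainder forces `M = m` in the equality case; its
coefficient is `∫ sin² cos²` over a quarter period. -/
theorem ellH_convex {m n : ℝ} (hm : 0 ≤ m) (hm1 : m < 1) (hn : 0 ≤ n) (hn1 : n < 1) :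
    ellH m + ellK m * (n - m) + Real.pi / 16 * (n - m) ^ 2 ≤ ellH n := by
  have hc := continuous_inv_delta hm1
  have hcn := continuous_inv_delta hn1
  have h3 : ∫ t in (0 : ℝ)..(Real.pi / 2), Real.sin t ^ 2 * Real.cos t ^ 2 = Real.pi / 16 := by
    rw [integral_sin_sq_mul_cos_sq]
    have : Real.sin (4 * (Real.pi / 2)) = 0 := by
      rw [show 4 * (Real.pi / 2) = 2 * Real.pi by ring, Real.sin_two_pi]
    rw [this]; simp; ring
  rw [ellH_eq hm1, ellH_eq hn1, ← integral_cos_sq_mul_delta hm1, ← h3,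
    ← intervalIntegral.integral_mul_const, ← intervalIntegral.integral_mul_const,
    ← intervalIntegral.integral_add (Continuous.intervalIntegrable (by fun_prop) _ _)
      (Continuous.intervalIntegrable (by fun_prop) _ _),
    ← intervalIntegral.integral_add (Continuous.intervalIntegrable (by fun_prop) _ _)
      (Continuous.intervalIntegrable (by fun_prop) _ _)]
  refine intervalIntegral.integral_mono_on (by positivity)
    (Continuous.intervalIntegrable (by fun_prop) _ _)
    (Continuous.intervalIntegrable (by fun_prop) _ _) fun t _ => ?_
  have := mul_le_mul_of_nonneg_left (convexity_delta hm hm1 hn hn1 t)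
    (by positivity : 0 ≤ 2 * Real.cos t ^ 2)
  refine le_trans (le_of_eq ?_) this
  ring

lemma ellH_nonneg {m : ℝ} (hm : 0 ≤ m) (hm1 : m < 1) : 0 ≤ ellH m := by
  rw [ellH_eq hm1]
  refine intervalIntegral.integral_nonneg (by positivity) fun t _ => ?_
  have := delta_pos hm1 t
  positivity

/-! ### The Jacobi amplitude -/

/-- The Jacobi amplitude, inverse to the incomplete integral of the first kind. -/
def am (m z : ℝ) : ℝ := Function.invFun (ellF m) z

section Amplitude

variable {m : ℝ}

lemma ellF_am (hm : 0 ≤ m) (hm1 : m < 1) (z : ℝ) : ellF m (am m z) = z :=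
  Function.invFun_eq (surjective_ellF hm hm1 z)

lemma am_ellF (hm1 : m < 1) (φ : ℝ) : am m (ellF m φ) = φ :=
  Function.leftInverse_invFun (strictMono_ellF hm1).injective φ

lemma am_zero (hm1 : m < 1) : am m 0 = 0 := by
  simpa [ellF_zero_right] using am_ellF hm1 0

lemma am_add_two_mul_ellK (hm : 0 ≤ m) (hm1 : m < 1) (z : ℝ) :
    am m (z + 2 * ellK m) = am m z + Real.pi := by
  refine (strictMono_ellF hm1).injective ?_
  rw [ellF_am hm hm1, ellF_add_pi hm1, ellF_am hm hm1]

lemma am_neg (hm : 0 ≤ m) (hm1 : m < 1) (z : ℝ) : am m (-z) = -am m z := by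
  refine (strictMono_ellF hm1).injective ?_
  rw [ellF_am hm hm1, ellF_neg, ellF_am hm hm1]

lemma am_two_mul_ellK (hm : 0 ≤ m) (hm1 : m < 1) : am m (2 * ellK m) = Real.pi := by
  have := am_add_two_mul_ellK hm hm1 0
  rwa [zero_add, am_zero hm1, zero_add] at this

lemma strictMono_am (hm : 0 ≤ m) (hm1 : m < 1) : StrictMono (am m) := fun x y h => by
  by_contra! h'
  have := (strictMono_ellF hm1).monotone h'
  rw [ellF_am hm hm1, ellF_am hm hm1] at this
  linarith

lemma abs_am_sub_le (hm : 0 ≤ m) (hm1 : m < 1) (y z : ℝ) : |am m y - am m z| ≤ |y - z| := by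
  have := abs_sub_le_abs_ellF_sub hm hm1 (am m y) (am m z)
  rwa [ellF_am hm hm1, ellF_am hm hm1] at this

lemma continuous_am (hm : 0 ≤ m) (hm1 : m < 1) : Continuous (am m) :=
  (LipschitzWith.of_dist_le_mul (K := 1) fun y z => by
    simpa [Real.dist_eq] using abs_am_sub_le hm hm1 y z).continuous

lemma hasDerivAt_am (hm : 0 ≤ m) (hm1 : m < 1) (z : ℝ) :
    HasDerivAt (am m) (delta m (am m z)) z := by
  have := HasDerivAt.of_local_left_inverse (f := ellF m) (g := am m) (a := z)
    (continuous_am hm hm1).continuousAt (hasDerivAt_ellF hm1 (am m z))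
    (inv_pos.2 (delta_pos hm1 _)).ne' (Eventually.of_forall (ellF_am hm hm1))
  simpa using this

end Amplitude

lemma continuous_inv_delta_subtype :
    Continuous fun p : Icc (0 : ℝ) (1 / 2) × ℝ => (delta p.1 p.2)⁻¹ := by
  refine Continuous.inv₀ ?_ fun p => (delta_pos (by linarith [p.1.2.2]) _).ne'
  exact continuous_delta_uncurry.comp
    ((continuous_subtype_val.comp continuous_fst).prodMk continuous_snd)

lemma continuous_ellF_subtype :
    Continuous fun p : Icc (0 : ℝ) (1 / 2) × ℝ => ellF p.1 p.2 :=
  intervalIntegral.continuous_parametric_intervalIntegral_of_continuous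
    (f := fun (p : Icc (0 : ℝ) (1 / 2) × ℝ) t => (delta p.1 t)⁻¹)
    (continuous_inv_delta_subtype.comp
      ((continuous_fst.comp continuous_fst).prodMk continuous_snd)) continuous_snd

lemma continuous_ellK_subtype : Continuous fun m : Icc (0 : ℝ) (1 / 2) => ellK m :=
  continuous_ellF_subtype.comp (continuous_id.prodMk continuous_const)

lemma continuous_ellN_subtype : Continuous fun m : Icc (0 : ℝ) (1 / 2) => ellN m := by
  refine intervalIntegral.continuous_parametric_intervalIntegral_of_continuous'
    (f := fun (m : Icc (0 : ℝ) (1 / 2)) t => (1 - 2 * (m : ℝ) * Real.sin t ^ 2) * (delta m t)⁻¹)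
    ?_ _ _
  exact Continuous.mul (by fun_prop) continuous_inv_delta_subtype

/-- With `φ₀` the amplitude at the base point, expansion of `ellF` bounds `|am m z - φ₀|` by `|z -
ellF m φ₀|`, which is continuous in `(m, z)` and vanishes at the base point. -/
lemma continuous_am_subtype :
    Continuous fun p : Icc (0 : ℝ) (1 / 2) × ℝ => am p.1 p.2 := by
  refine continuous_iff_continuousAt.2 fun ⟨m₀, z₀⟩ => ?_
  rw [ContinuousAt, tendsto_iff_dist_tendsto_zero]
  have hlim : Tendsto (fun p : Icc (0 : ℝ) (1 / 2) × ℝ => |p.2 - ellF p.1 (am m₀ z₀)|)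
      (𝓝 (m₀, z₀)) (𝓝 0) := by
    have hc : Continuous fun p : Icc (0 : ℝ) (1 / 2) × ℝ => |p.2 - ellF p.1 (am m₀ z₀)| :=
      (continuous_snd.sub (continuous_ellF_subtype.comp
        (continuous_fst.prodMk continuous_const))).abs
    have := hc.tendsto (m₀, z₀)
    simpa [ellF_am m₀.2.1 (lt_of_le_of_lt m₀.2.2 (by norm_num))] using this
  refine squeeze_zero (fun _ => dist_nonneg) (fun p => ?_) hlim
  have hp1 : (p.1 : ℝ) < 1 := lt_of_le_of_lt p.1.2.2 (by norm_num)
  have := abs_sub_le_abs_ellF_sub p.1.2.1 hp1 (am p.1 p.2) (am m₀ z₀)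
  rwa [ellF_am p.1.2.1 hp1] at this

end

noncomputable section

/-! ### Lower bounds for `∫ |θ'| g(θ)` -/

/-- `√(M - sin² (t/2))`, cut off at zero. -/
def psi (M t : ℝ) : ℝ := Real.sqrt (max (M - Real.sin (t / 2) ^ 2) 0)

lemma psi_nonneg (M t : ℝ) : 0 ≤ psi M t := Real.sqrt_nonneg _

lemma continuous_psi (M : ℝ) : Continuous (psi M) := by
  unfold psi; fun_prop

lemma psi_neg (M t : ℝ) : psi M (-t) = psi M t := by
  simp [psi, neg_div]

lemma psi_mono {M N : ℝ} (h : M ≤ N) (t : ℝ) : psi M t ≤ psi N t :=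
  Real.sqrt_le_sqrt (max_le_max (by linarith) le_rfl)

lemma psi_sq {M t : ℝ} (h : Real.sin (t / 2) ^ 2 ≤ M) : psi M t ^ 2 = M - Real.sin (t / 2) ^ 2 := by
  rw [psi, Real.sq_sqrt (le_max_right _ _), max_eq_left (by linarith)]

/-- The primitive of `psi M` vanishing at zero. -/
def psiInt (M y : ℝ) : ℝ := ∫ t in (0 : ℝ)..y, psi M t

lemma psiInt_neg (M y : ℝ) : psiInt M (-y) = -psiInt M y := by
  have h := intervalIntegral.integral_comp_neg (a := 0) (b := y) (psi M)
  simp only [psi_neg, neg_zero] at h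
  rw [psiInt, psiInt, h, intervalIntegral.integral_symm]

lemma psiInt_zero (M : ℝ) : psiInt M 0 = 0 := by simp [psiInt]

/-- Substitute `sin(t/2) = √m sin φ`. The upper limit is the turning point of the pendulum of
parameter `m`, so `ellH` measures the climb from `0` to the turning point. -/
lemma psiInt_two_mul_arcsin {m : ℝ} (hm : 0 ≤ m) (hm1 : m < 1) :
    psiInt m (2 * Real.arcsin (Real.sqrt m)) = ellH m := by
  have hx : ∀ φ, (Real.sqrt m * Real.sin φ) ^ 2 = m * Real.sin φ ^ 2 := fun φ => by
    rw [mul_pow, Real.sq_sqrt hm]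
  have hlt : ∀ φ, (Real.sqrt m * Real.sin φ) ^ 2 < 1 := fun φ => by
    rw [hx]; linarith [one_sub_pos_of_lt_one hm1 φ]
  have hmem : ∀ φ, -1 < Real.sqrt m * Real.sin φ ∧ Real.sqrt m * Real.sin φ < 1 := fun φ => by
    have := (sq_lt_one_iff_abs_lt_one _).1 (hlt φ)
    exact abs_lt.1 this
  have hd : ∀ φ ∈ uIcc 0 (Real.pi / 2),
      HasDerivAt (fun φ => 2 * Real.arcsin (Real.sqrt m * Real.sin φ))
        (2 * (Real.sqrt m * Real.cos φ) * (delta m φ)⁻¹) φ := by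
    intro φ _
    have h1 := ((Real.hasDerivAt_arcsin (hmem φ).1.ne' (hmem φ).2.ne).comp φ
      ((Real.hasDerivAt_sin φ).const_mul (Real.sqrt m))).const_mul 2
    refine h1.congr_deriv ?_
    rw [hx, delta]
    ring
  have hsub := intervalIntegral.integral_comp_mul_deriv hd
    (Continuous.continuousOn (by have := continuous_inv_delta hm1; fun_prop)) (continuous_psi m)
  simp only [Real.sin_zero, mul_zero, Real.arcsin_zero, Real.sin_pi_div_two, mul_one] at hsub
  rw [psiInt, ← hsub, ellH_eq hm1]
  refine intervalIntegral.integral_congr fun φ hφ => ?_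
  rw [uIcc_of_le (by positivity)] at hφ
  have hcos : 0 ≤ Real.cos φ :=
    Real.cos_nonneg_of_mem_Icc ⟨by linarith [hφ.1, Real.pi_pos], hφ.2⟩
  have hs : psi m (2 * Real.arcsin (Real.sqrt m * Real.sin φ)) = Real.sqrt m * Real.cos φ := by
    rw [psi, mul_div_cancel_left₀ _ (two_ne_zero' ℝ), Real.sin_arcsin (hmem φ).1.le (hmem φ).2.le,
      hx, show m - m * Real.sin φ ^ 2 = m * Real.cos φ ^ 2 by
        linear_combination (-m) * Real.sin_sq_add_cos_sq φ,
      max_eq_left (by positivity), Real.sqrt_mul hm, Real.sqrt_sq hcos]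
  simp only [Function.comp_apply]
  rw [hs]
  linear_combination (2 * Real.cos φ ^ 2 * (delta m φ)⁻¹) * Real.mul_self_sqrt hm

/-- An angle with `sin²(y/2) ≥ n` has passed the turning point `2 arcsin √n` on one side, and `psi`
is nonnegative and monotone in its parameter. Keeping `n` separate from `M` allows `M = 1`, where
`K` diverges. -/
lemma ellH_le_abs_psiInt {n M y : ℝ} (hn : 0 ≤ n) (hn1 : n < 1) (hnM : n ≤ M)
    (hy : n ≤ Real.sin (y / 2) ^ 2) : ellH n ≤ |psiInt M y| := by
  have habs : |psiInt M y| = |psiInt M (|y|)| := by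
    rcases abs_choice y with h | h <;> rw [h]
    rw [psiInt_neg, abs_neg]
  have hint : ∀ (M a b : ℝ), IntervalIntegrable (psi M) volume a b := fun M a b =>
    (continuous_psi M).intervalIntegrable a b
  have h1 : 2 * Real.arcsin (Real.sqrt n) ≤ |y| := by
    by_contra! h
    have hpi := Real.arcsin_le_pi_div_two (Real.sqrt n)
    have h2 : Real.sin (|y| / 2) < Real.sqrt n := by
      have := Real.sin_lt_sin_of_lt_of_le_pi_div_two (x := |y| / 2) (y := Real.arcsin (Real.sqrt n))
        (by linarith [abs_nonneg y, Real.pi_pos]) hpi (by linarith)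
      rwa [Real.sin_arcsin (by linarith [Real.sqrt_nonneg n]) (Real.sqrt_le_one.2 hn1.le)] at this
    have h3 : 0 ≤ Real.sin (|y| / 2) := Real.sin_nonneg_of_nonneg_of_le_pi (by positivity)
      (by linarith [Real.pi_pos])
    have h4 : Real.sin (|y| / 2) ^ 2 < n := by
      calc _ < Real.sqrt n ^ 2 := by gcongr
        _ = n := Real.sq_sqrt hn
    have h5 : Real.sin (|y| / 2) ^ 2 = Real.sin (y / 2) ^ 2 := by
      rcases abs_choice y with h | h <;> rw [h]
      rw [neg_div, Real.sin_neg, neg_sq]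
    linarith
  rw [habs]
  refine le_trans ?_ (le_abs_self _)
  rw [← psiInt_two_mul_arcsin hn hn1]
  calc psiInt n (2 * Real.arcsin (Real.sqrt n)) ≤ psiInt n |y| :=
        intervalIntegral.integral_mono_interval le_rfl
          (by have := Real.arcsin_nonneg.2 (Real.sqrt_nonneg n); positivity) h1
          (Eventually.of_forall fun t => psi_nonneg n t) (hint _ _ _)
    _ ≤ psiInt M |y| := intervalIntegral.integral_mono_on (abs_nonneg y) (hint _ _ _) (hint _ _ _)
          fun t _ => psi_mono hnM t

/-- `θ` is continuous on `[x, y]` with integrable derivative `k` on `(x, y)`. -/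
structure IsAngle (θ k : ℝ → ℝ) (x y : ℝ) : Prop where
  le : x ≤ y
  cont : ContinuousOn θ (Icc x y)
  deriv : ∀ s ∈ Ioo x y, HasDerivAt θ (k s) s
  integrable : IntervalIntegrable k volume x y
  integrable_sq : IntervalIntegrable (fun s => k s ^ 2) volume x y

lemma IsAngle.mono {θ k : ℝ → ℝ} {x y x' y' : ℝ} (h : IsAngle θ k x y) (h1 : x ≤ x')
    (h2 : x' ≤ y') (h3 : y' ≤ y) : IsAngle θ k x' y' where
  le := h2
  cont := h.cont.mono (Icc_subset_Icc h1 h3)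
  deriv s hs := h.deriv s ⟨lt_of_le_of_lt h1 hs.1, lt_of_lt_of_le hs.2 h3⟩
  integrable := h.integrable.mono_set (by
    rw [uIcc_of_le h2, uIcc_of_le h.le]; exact Icc_subset_Icc h1 h3)
  integrable_sq := h.integrable_sq.mono_set (by
    rw [uIcc_of_le h2, uIcc_of_le h.le]; exact Icc_subset_Icc h1 h3)

lemma IsAngle.sub_const {θ k : ℝ → ℝ} {x y : ℝ} (h : IsAngle θ k x y) (c : ℝ) :
    IsAngle (fun s => θ s - c) k x y where
  le := h.le
  cont := h.cont.sub continuousOn_const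
  deriv s hs := (h.deriv s hs).sub_const c
  integrable := h.integrable
  integrable_sq := h.integrable_sq

lemma IsAngle.comp_continuousOn {θ k g : ℝ → ℝ} {x y : ℝ} (h : IsAngle θ k x y)
    (hg : Continuous g) : ContinuousOn (fun s => g (θ s)) (uIcc x y) := by
  rw [uIcc_of_le h.le]; exact hg.comp_continuousOn h.cont

lemma IsAngle.intervalIntegrable_mul {θ k g : ℝ → ℝ} {x y : ℝ} (h : IsAngle θ k x y)
    (hg : Continuous g) : IntervalIntegrable (fun s => |k s| * g (θ s)) volume x y :=
  h.integrable.abs.mul_continuousOn (h.comp_continuousOn hg)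

lemma IsAngle.abs_integral_sub_le {θ k g : ℝ → ℝ} {x y : ℝ} (h : IsAngle θ k x y)
    (hg : Continuous g) (hg0 : ∀ t, 0 ≤ g t) :
    |(∫ t in (0 : ℝ)..(θ y), g t) - ∫ t in (0 : ℝ)..(θ x), g t| ≤
      ∫ s in x..y, |k s| * g (θ s) := by
  have hd : ∀ v, HasDerivAt (fun v => ∫ t in (0 : ℝ)..v, g t) (g v) v := fun v =>
    intervalIntegral.integral_hasDerivAt_right (hg.intervalIntegrable _ _)
      hg.aestronglyMeasurable.stronglyMeasurableAtFilter hg.continuousAt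
  have hcont : Continuous fun v => ∫ t in (0 : ℝ)..v, g t :=
    continuous_iff_continuousAt.2 fun v => (hd v).continuousAt
  have hint : IntervalIntegrable (fun s => g (θ s) * k s) volume x y :=
    h.integrable.continuousOn_mul (h.comp_continuousOn hg)
  have := intervalIntegral.integral_eq_sub_of_hasDerivAt_of_le h.le
    (hcont.comp_continuousOn h.cont) (fun s hs => (hd (θ s)).comp s (h.deriv s hs)) hint
  simp only [Function.comp_apply] at this
  rw [← this]
  refine (intervalIntegral.abs_integral_le_integral_abs h.le).trans (le_of_eq ?_)
  refine intervalIntegral.integral_congr fun s _ => ?_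
  simp only [abs_mul, abs_of_nonneg (hg0 _), mul_comm]

/-- The total `psi`-variation of an angle over a cyclic arc made of the two intervals `[x₁, y₁]` and
`[x₂, y₂]`, vanishing at both ends of the arc, where `M` is the maximum of `sin² (θ/2)`. -/
lemma exists_max_and_ellH_le {θ k : ℝ → ℝ} {x₁ y₁ x₂ y₂ : ℝ} (h₁ : IsAngle θ k x₁ y₁)
    (h₂ : IsAngle θ k x₂ y₂) (hx : θ x₁ = 0) (hy : θ y₂ = 0) (hxy : θ y₁ = θ x₂) :
    ∃ M, (∀ s ∈ Icc x₁ y₁ ∪ Icc x₂ y₂, Real.sin (θ s / 2) ^ 2 ≤ M) ∧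
      ∀ m, 0 ≤ m → m < 1 → 2 * (ellH m + ellK m * (M - m) + Real.pi / 16 * (M - m) ^ 2) ≤
        (∫ s in x₁..y₁, |k s| * psi M (θ s)) + ∫ s in x₂..y₂, |k s| * psi M (θ s) := by
  have hcont : ContinuousOn (fun s => Real.sin (θ s / 2) ^ 2) (Icc x₁ y₁ ∪ Icc x₂ y₂) := by
    have : Continuous fun t : ℝ => Real.sin (t / 2) ^ 2 := by fun_prop
    exact this.comp_continuousOn (h₁.cont.union_of_isClosed h₂.cont isClosed_Icc isClosed_Icc)
  obtain ⟨q, hq, hmax⟩ := (isCompact_Icc.union isCompact_Icc).exists_isMaxOn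
    ⟨x₁, Or.inl (left_mem_Icc.2 h₁.le)⟩ hcont
  set M := Real.sin (θ q / 2) ^ 2 with hM
  have hM0 : 0 ≤ M := sq_nonneg _
  have hM1 : M ≤ 1 := Real.sin_sq_le_one _
  refine ⟨M, fun s hs => hmax hs, fun m hm hm1 => ?_⟩
  have hψ := continuous_psi M
  have hψ0 := psi_nonneg M
  have var : ∀ {x y : ℝ}, IsAngle θ k x y →
      |psiInt M (θ y) - psiInt M (θ x)| ≤ ∫ s in x..y, |k s| * psi M (θ s) :=
    fun h => h.abs_integral_sub_le hψ hψ0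
  -- The angle goes from `0` to its value at the maximum point `q` and back to `0`. The two cases
  -- say on which of the two intervals `q` lies; the junction is crossed by `hxy`.
  have htot : 2 * |psiInt M (θ q)| ≤
      (∫ s in x₁..y₁, |k s| * psi M (θ s)) + ∫ s in x₂..y₂, |k s| * psi M (θ s) := by
    rcases hq with hq | hq
    · have ha := h₁.mono le_rfl hq.1 hq.2
      have hb := h₁.mono hq.1 hq.2 le_rfl
      rw [← intervalIntegral.integral_add_adjacent_intervals (ha.intervalIntegrable_mul hψ)
        (hb.intervalIntegrable_mul hψ)]
      have a := var ha
      have b := var hb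
      have c := var h₂
      rw [hx, psiInt_zero, sub_zero] at a
      rw [hy, psiInt_zero, ← hxy] at c
      have := abs_sub_abs_le_abs_sub (psiInt M (θ q)) (psiInt M (θ y₁))
      rw [abs_sub_comm] at this
      rw [zero_sub, abs_neg] at c
      linarith
    · have ha := h₂.mono le_rfl hq.1 hq.2
      have hb := h₂.mono hq.1 hq.2 le_rfl
      rw [← intervalIntegral.integral_add_adjacent_intervals (ha.intervalIntegrable_mul hψ)
        (hb.intervalIntegrable_mul hψ)]
      have a := var ha
      have b := var hb
      have c := var h₁
      rw [hx, psiInt_zero, sub_zero, hxy] at c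
      rw [hy, psiInt_zero, zero_sub, abs_neg] at b
      have := abs_sub_abs_le_abs_sub (psiInt M (θ q)) (psiInt M (θ x₂))
      linarith
  have hn : ∀ n, 0 ≤ n → n < 1 → n ≤ M →
      2 * (ellH m + ellK m * (n - m) + Real.pi / 16 * (n - m) ^ 2) ≤
        (∫ s in x₁..y₁, |k s| * psi M (θ s)) + ∫ s in x₂..y₂, |k s| * psi M (θ s) := by
    intro n hn hn1 hnM
    have h3 := ellH_le_abs_psiInt hn hn1 hnM (y := θ q) hnM
    have h4 := ellH_convex hm hm1 hn hn1
    linarith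
  rcases hM1.lt_or_eq with h | h
  · exact hn M hM0 h le_rfl
  -- The case `M = 1`: the convexity bound is available only for parameters below `1`, so it is used
  -- for `n < M` and passed to the limit.
  · have hlim : Tendsto (fun n => 2 * (ellH m + ellK m * (n - m) + Real.pi / 16 * (n - m) ^ 2))
        (𝓝[<] M) (𝓝 (2 * (ellH m + ellK m * (M - m) + Real.pi / 16 * (M - m) ^ 2))) :=
      ((by fun_prop : Continuous fun n : ℝ =>
        2 * (ellH m + ellK m * (n - m) + Real.pi / 16 * (n - m) ^ 2)).tendsto M).mono_left
          nhdsWithin_le_nhds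
    refine le_of_tendsto hlim ?_
    filter_upwards [Ioo_mem_nhdsLT (show (0 : ℝ) < M by rw [h]; norm_num)] with n hn'
    exact hn n hn'.1.le (by linarith [hn'.2]) hn'.2.le

end

noncomputable section

/-! ### The lower bound for the bending energy -/

/-- The defect in the inequality between the arithmetic and the geometric mean. -/
def defect (σ M : ℝ) (θ k : ℝ → ℝ) (s : ℝ) : ℝ := 1 / 2 * (|k s| - 2 * σ * psi M (θ s)) ^ 2

lemma defect_nonneg (σ M : ℝ) (θ k : ℝ → ℝ) (s : ℝ) : 0 ≤ defect σ M θ k s := by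
  unfold defect; positivity

lemma IsAngle.intervalIntegrable_comp {θ k g : ℝ → ℝ} {x y : ℝ} (h : IsAngle θ k x y)
    (hg : Continuous g) : IntervalIntegrable (fun s => g (θ s)) volume x y :=
  (h.comp_continuousOn hg).intervalIntegrable

lemma IsAngle.intervalIntegrable_defect {θ k : ℝ → ℝ} {x y : ℝ} (h : IsAngle θ k x y) (σ M : ℝ) :
    IntervalIntegrable (defect σ M θ k) volume x y := by
  have h1 := h.integrable_sq.const_mul (1 / 2)
  have h2 := (h.intervalIntegrable_mul (continuous_psi M)).const_mul (2 * σ)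
  have h3 := (h.intervalIntegrable_comp ((continuous_psi M).pow 2)).const_mul (2 * σ ^ 2)
  refine ((h1.sub h2).add h3).congr fun s _ => ?_
  simp only [defect, Pi.pow_apply]
  linear_combination (-1 / 2) * sq_abs (k s)

lemma continuous_sin_half_sq : Continuous fun t : ℝ => Real.sin (t / 2) ^ 2 := by fun_prop

/-- Completion of the square: `k²/2 = (|k| - 2σψ)²/2 + 2σ|k|ψ - 2σ²ψ²`. The bound by `M` ensures
that the cutoff in `psi` is inactive. -/
lemma IsAngle.integral_half_sq {θ k : ℝ → ℝ} {x y : ℝ} (h : IsAngle θ k x y) (σ M : ℝ)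
    (hM : ∀ s ∈ Icc x y, Real.sin (θ s / 2) ^ 2 ≤ M) :
    ∫ s in x..y, 1 / 2 * k s ^ 2 = (∫ s in x..y, defect σ M θ k s)
      + 2 * σ * (∫ s in x..y, |k s| * psi M (θ s))
      - 2 * σ ^ 2 * (M * (y - x) - ∫ s in x..y, Real.sin (θ s / 2) ^ 2) := by
  have h1 := h.intervalIntegrable_defect σ M
  have h2 := h.intervalIntegrable_mul (continuous_psi M)
  have h3 := h.intervalIntegrable_comp continuous_sin_half_sq
  have e : M * (y - x) = ∫ s in x..y, M := by simp [mul_comm]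
  rw [e, ← intervalIntegral.integral_sub (by simp) h3, ← intervalIntegral.integral_const_mul,
    ← intervalIntegral.integral_const_mul, ← intervalIntegral.integral_add h1 (h2.const_mul _),
    ← intervalIntegral.integral_sub (h1.add (h2.const_mul _))
      (((by simp : IntervalIntegrable (fun _ => M) volume x y).sub h3).const_mul _)]
  refine intervalIntegral.integral_congr fun s hs => ?_
  rw [uIcc_of_le h.le] at hs
  have := psi_sq (hM s hs)
  simp only [defect]
  linear_combination (-2 * σ ^ 2) * this - 1 / 2 * sq_abs (k s)

/-- The unknown maximum `M` enters linearly twice: through `-2σ² M · length` and through the tangent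
line of `H` at `m`, with slope `K(m)`. The length condition `hlen` makes the two cancel, leaving
only `(M - m)²`. -/
lemma arc_energy_le {θ k : ℝ → ℝ} {x₁ y₁ x₂ y₂ σ m : ℝ} (h₁ : IsAngle θ k x₁ y₁)
    (h₂ : IsAngle θ k x₂ y₂) (hx : θ x₁ = 0) (hy : θ y₂ = 0) (hxy : θ y₁ = θ x₂) (hσ : 0 ≤ σ)
    (hm : 0 ≤ m) (hm1 : m < 1) (hlen : σ * (y₁ - x₁ + (y₂ - x₂)) = 2 * ellK m) :
    ∃ M, (∀ s ∈ Icc x₁ y₁ ∪ Icc x₂ y₂, Real.sin (θ s / 2) ^ 2 ≤ M) ∧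
      (∫ s in x₁..y₁, defect σ M θ k s) + (∫ s in x₂..y₂, defect σ M θ k s) +
        4 * σ * (ellH m - ellK m * m) + Real.pi / 4 * σ * (M - m) ^ 2 +
        2 * σ ^ 2 * ((∫ s in x₁..y₁, Real.sin (θ s / 2) ^ 2) +
          ∫ s in x₂..y₂, Real.sin (θ s / 2) ^ 2) ≤
      (∫ s in x₁..y₁, 1 / 2 * k s ^ 2) + ∫ s in x₂..y₂, 1 / 2 * k s ^ 2 := by
  obtain ⟨M, hM, hH⟩ := exists_max_and_ellH_le h₁ h₂ hx hy hxy
  refine ⟨M, hM, ?_⟩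
  have h3 := hH m hm hm1
  rw [h₁.integral_half_sq σ M fun s hs => hM s (Or.inl hs),
    h₂.integral_half_sq σ M fun s hs => hM s (Or.inr hs)]
  have h4 := mul_le_mul_of_nonneg_left h3 (by positivity : 0 ≤ 2 * σ)
  have h5 : 2 * σ ^ 2 * (M * (y₁ - x₁)) + 2 * σ ^ 2 * (M * (y₂ - x₂)) =
      4 * σ * (ellK m * M) := by
    linear_combination (2 * σ * M) * hlen
  linarith

/-- The scale of the pendulum `θ'' = -σ² sin θ` that has period `L` and parameter `m`. -/
def freq (L m : ℝ) : ℝ := 4 * ellK m / L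

/-- The bending energy of the elastica with length `L` and parameter `m`. -/
def elasticaEnergy (L m : ℝ) : ℝ := 16 * ellK m / L * ellH m

/-- The width of the elastica with length `L` and parameter `m`. -/
def elasticaWidth (L m : ℝ) : ℝ := L * (ellN m / ellK m)

/-- A closed angle function on `[-L/2, L/2]` with the given total displacement. -/
structure IsClosedAngle (L W : ℝ) (θ k : ℝ → ℝ) : Prop extends
    IsAngle θ k (-(L / 2)) (L / 2) where
  left : θ (-(L / 2)) = 0
  cos : ∫ s in (-(L / 2))..(L / 2), Real.cos (θ s) = W
  sin : ∫ s in (-(L / 2))..(L / 2), Real.sin (θ s) = 0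

/-- The inequality `k²/2 ≥ 2τ|k||sin(θ/2)| - 2τ² sin²(θ/2)`, integrated with `2 sin²(θ/2) = 1 - cos
θ`. The weight `|sin(θ/2)|` is that of the separatrix, suited to angles that wind. -/
lemma IsAngle.sub_le_integral_sq {θ k : ℝ → ℝ} {x y : ℝ} (h : IsAngle θ k x y) {τ : ℝ}
    (hτ : 0 ≤ τ) (hl : ∫ t in (0 : ℝ)..(θ x), |Real.sin (t / 2)| = 0) :
    2 * τ * |(∫ t in (0 : ℝ)..(θ y), |Real.sin (t / 2)|)| - τ ^ 2 *
      (∫ s in x..y, (1 - Real.cos (θ s))) ≤ ∫ s in x..y, 1 / 2 * k s ^ 2 := by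
  have hg : Continuous fun t : ℝ => |Real.sin (t / 2)| := by fun_prop
  have hg' : Continuous fun t : ℝ => 1 - Real.cos t := by fun_prop
  have h1 := h.abs_integral_sub_le hg fun t => abs_nonneg _
  have i1 := h.intervalIntegrable_mul hg
  have i2 := h.intervalIntegrable_comp hg'
  rw [hl, sub_zero] at h1
  have h2 := mul_le_mul_of_nonneg_left h1 (by positivity : 0 ≤ 2 * τ)
  have h3 : 2 * τ * (∫ s in x..y, |k s| * |Real.sin (θ s / 2)|) - τ ^ 2 *
      (∫ s in x..y, (1 - Real.cos (θ s))) ≤ ∫ s in x..y, 1 / 2 * k s ^ 2 := by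
    rw [← intervalIntegral.integral_const_mul, ← intervalIntegral.integral_const_mul,
      ← intervalIntegral.integral_sub (i1.const_mul _) (i2.const_mul _)]
    refine intervalIntegral.integral_mono_on h.le ((i1.const_mul _).sub (i2.const_mul _))
      (h.integrable_sq.const_mul _) fun s _ => ?_
    have hc : Real.cos (θ s) = 1 - 2 * |Real.sin (θ s / 2)| ^ 2 := by
      rw [sq_abs, Real.sin_sq_eq_half_sub]
      ring_nf
    rw [hc]
    nlinarith [sq_nonneg (|k s| - 2 * τ * |Real.sin (θ s / 2)|), sq_abs (k s)]
  linarith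

lemma four_le_integral_abs_sin_half {n : ℤ} (hn : n ≠ 0) :
    4 ≤ |(∫ t in (0 : ℝ)..(2 * Real.pi * n), |Real.sin (t / 2)|)| := by
  have hg : Continuous fun t : ℝ => |Real.sin (t / 2)| := by fun_prop
  have hint : ∀ a b, IntervalIntegrable (fun t : ℝ => |Real.sin (t / 2)|) volume a b :=
    fun a b => hg.intervalIntegrable a b
  have h0 : ∫ t in (0 : ℝ)..(2 * Real.pi), |Real.sin (t / 2)| = 4 := by
    have : ∫ t in (0 : ℝ)..(2 * Real.pi), |Real.sin (t / 2)| =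
        ∫ t in (0 : ℝ)..(2 * Real.pi), Real.sin (t / 2) := by
      refine intervalIntegral.integral_congr fun t ht => ?_
      rw [uIcc_of_le (by positivity)] at ht
      exact abs_of_nonneg (Real.sin_nonneg_of_nonneg_of_le_pi (by linarith [ht.1])
        (by linarith [ht.2]))
    rw [this, intervalIntegral.integral_comp_div _ two_ne_zero]
    simp; norm_num
  have key : ∀ n : ℤ, 0 < n → 4 ≤ ∫ t in (0 : ℝ)..(2 * Real.pi * n), |Real.sin (t / 2)| := by
    intro n hn
    rw [← h0]
    have h1 : (1 : ℝ) ≤ n := by exact_mod_cast hn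
    exact intervalIntegral.integral_mono_interval le_rfl (by positivity)
      (by nlinarith [Real.pi_pos]) (Eventually.of_forall fun t => abs_nonneg _) (hint _ _)
  rcases hn.lt_or_gt with h | h
  · have h1 := key (-n) (by omega)
    have h2 := intervalIntegral.integral_comp_neg (a := 0) (b := 2 * Real.pi * n)
      fun t : ℝ => |Real.sin (t / 2)|
    simp only [neg_div, Real.sin_neg, abs_neg, neg_zero] at h2
    rw [h2, intervalIntegral.integral_symm, abs_neg]
    push_cast at h1
    rw [mul_neg] at h1
    exact h1.trans (le_abs_self _)
  · exact (key n h).trans (le_abs_self _)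

/-- The sine part of `cos (θ - c)` integrates to zero, since the ends have equal height. So the
reference direction may be tilted by `c` at the sole cost of a factor `cos c` on the width. -/
lemma integral_one_sub_cos {L W : ℝ} {θ k : ℝ → ℝ} (h : IsClosedAngle L W θ k) (c : ℝ) :
    ∫ s in (-(L / 2))..(L / 2), (1 - Real.cos (θ s - c)) = L - W * Real.cos c := by
  have i1 := h.intervalIntegrable_comp Real.continuous_cos
  have i2 := h.intervalIntegrable_comp Real.continuous_sin
  simp_rw [Real.cos_sub]
  rw [intervalIntegral.integral_sub (by simp) ((i1.mul_const _).add (i2.mul_const _)),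
    intervalIntegral.integral_add (i1.mul_const _) (i2.mul_const _),
    intervalIntegral.integral_mul_const, intervalIntegral.integral_mul_const, h.cos, h.sin]
  simp

/-! ### Comparison with the elastica, for competitors with and without winding. -/

section Energy

variable {L m : ℝ}

lemma elasticaWidth_pos (hL : 0 < L) (hm : m ≤ 1 / 2) : 0 < elasticaWidth L m :=
  mul_pos hL (div_pos (ellN_pos hm) (ellK_pos (by linarith)))

lemma length_sub_elasticaWidth (hm1 : m < 1) :
    L - elasticaWidth L m = L / ellK m * (2 * m * ellK m - ellH m) := by
  have := (ellK_pos hm1).ne'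
  rw [elasticaWidth, ellH]
  field_simp
  ring

lemma elasticaEnergy_lt_of_winding (hL : 0 < L) (hm : 0 < m) (hm1 : m ≤ 1 / 2) {θ k : ℝ → ℝ}
    (h : IsClosedAngle L (elasticaWidth L m) θ k) {n : ℤ} (hn : n ≠ 0)
    (hr : θ (L / 2) = 2 * Real.pi * n) :
    elasticaEnergy L m < ∫ s in (-(L / 2))..(L / 2), 1 / 2 * k s ^ 2 := by
  have hK := ellK_pos (show m < 1 by linarith)
  have hK2 := ellK_lt_two hm1
  have hH : 0 ≤ ellH m := ellH_nonneg hm.le (by linarith)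
  have hlt : ellH m ≤ m * ellK m := by
    have := ellH_convex hm.le (show m < 1 by linarith) le_rfl one_pos
    have h0 : ellH 0 = 0 := by simp [ellH, ellN_zero, ellK_zero]
    rw [h0] at this
    nlinarith [Real.pi_pos, sq_nonneg (0 - m)]
  have hD : 0 < 2 * m * ellK m - ellH m := by nlinarith
  -- This is `4/(L - W)`, the maximizer of `8τ - τ²(L - W)`; the resulting bound is `16/(L - W)`.
  set τ : ℝ := 4 * ellK m / (L * (2 * m * ellK m - ellH m)) with hτ
  have hτ0 : 0 ≤ τ := by positivity
  have h1 := h.sub_le_integral_sq hτ0 (by rw [h.left]; simp)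
  have h2 := integral_one_sub_cos h 0
  simp only [sub_zero, Real.cos_zero, mul_one] at h2
  rw [h2, hr, length_sub_elasticaWidth (by linarith)] at h1
  have h3 := four_le_integral_abs_sin_half hn
  have h4 : 8 * τ - τ ^ 2 * (L / ellK m * (2 * m * ellK m - ellH m)) ≤
      ∫ s in (-(L / 2))..(L / 2), 1 / 2 * k s ^ 2 := by
    refine le_trans ?_ h1
    nlinarith
  refine lt_of_lt_of_le ?_ h4
  have h5 : 8 * τ - τ ^ 2 * (L / ellK m * (2 * m * ellK m - ellH m)) =
      16 * ellK m / L * (2 * m * ellK m - ellH m)⁻¹ * 1 := by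
    rw [hτ]; field_simp; ring
  rw [h5, elasticaEnergy, mul_assoc (16 * ellK m / L)]
  refine mul_lt_mul_of_pos_left ?_ (by positivity)
  -- The product of two numbers with sum `2mK` is at most `(mK)²`, and `mK < 1` because `m ≤ 1/2`
  -- and `K < 2`.
  have h6 : ellH m * (2 * m * ellK m - ellH m) < 1 := by
    have h7 : m * ellK m < 1 := by nlinarith
    nlinarith [sq_nonneg (m * ellK m - ellH m), mul_pos hm hK]
  rw [mul_comm _ (1 : ℝ)]
  exact (lt_mul_inv_iff₀ hD).2 h6

/-- The energy of a closed angle without winding exceeds that of the elastica by a sum of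
nonnegative defects. -/
lemma exists_defect_le (hL : 0 < L) (hm : 0 < m) (hm1 : m ≤ 1 / 2) {θ k : ℝ → ℝ}
    (h : IsClosedAngle L (elasticaWidth L m) θ k) (hr : θ (L / 2) = 0) :
    ∃ p ∈ Icc (-(L / 2)) 0, ∃ M₁ M₂ c : ℝ,
      (∀ s ∈ Icc (-(L / 2)) (L / 2), Real.sin ((θ s - c) / 2) ^ 2 ≤ max M₁ M₂) ∧
      elasticaEnergy L m + (∫ s in p..(p + L / 2), defect (freq L m) M₁ (fun s => θ s - c) k s) +
        (∫ s in (p + L / 2)..(L / 2), defect (freq L m) M₂ (fun s => θ s - c) k s) +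
        (∫ s in (-(L / 2))..p, defect (freq L m) M₂ (fun s => θ s - c) k s) +
        Real.pi / 4 * freq L m * ((M₁ - m) ^ 2 + (M₂ - m) ^ 2) +
        freq L m ^ 2 * (elasticaWidth L m * (1 - Real.cos c)) ≤
      ∫ s in (-(L / 2))..(L / 2), 1 / 2 * k s ^ 2 := by
  have hmlt : m < 1 := by linarith
  have hK := ellK_pos hmlt
  have hσ : 0 < freq L m := by unfold freq; positivity
  -- Antipodal points with equal angle: the difference takes the values `θ 0` and `-θ 0` at the two
  -- ends, since `θ` vanishes at `±L/2`.
  obtain ⟨p, hp, hpz⟩ : ∃ p ∈ Icc (-(L / 2)) 0, θ (p + L / 2) - θ p = 0 := by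
    have hc : ContinuousOn (fun s => θ (s + L / 2) - θ s) (Icc (-(L / 2)) 0) := by
      refine ContinuousOn.sub (h.cont.comp (by fun_prop) fun s hs => ?_)
        (h.cont.mono fun s hs => ?_)
      · exact ⟨by linarith [hs.1], by linarith [hs.2]⟩
      · exact ⟨hs.1, by linarith [hs.2]⟩
    have hle : -(L / 2) ≤ 0 := by linarith
    have e1 : θ (-(L / 2) + L / 2) - θ (-(L / 2)) = θ 0 := by rw [h.left]; simp
    have e2 : θ (0 + L / 2) - θ 0 = -θ 0 := by rw [zero_add, hr]; simp
    rcases le_total 0 (θ 0) with h0 | h0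
    · exact intermediate_value_Icc' hle hc (by rw [e1, e2]; exact ⟨by linarith, h0⟩)
    · exact intermediate_value_Icc hle hc (by rw [e1, e2]; exact ⟨h0, by linarith⟩)
  have hp2 : θ (p + L / 2) = θ p := by linarith
  obtain ⟨hpa, hpb⟩ := hp
  set c := θ p with hc
  have hA := h.toIsAngle.sub_const c
  have A0 := hA.mono (x' := -(L / 2)) (y' := p) le_rfl hpa (by linarith)
  have A1 := hA.mono (x' := p) (y' := p + L / 2) hpa (by linarith) (by linarith)
  have A2 := hA.mono (x' := p + L / 2) (y' := L / 2) (by linarith) (by linarith) le_rfl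
  -- A degenerate interval: the first arc `[p, p + L/2]` needs no second piece, whereas the
  -- complementary arc wraps around through `±L/2`.
  have A3 := hA.mono (x' := p + L / 2) (y' := p + L / 2) (by linarith) le_rfl (by linarith)
  have hlen : freq L m * (L / 2) = 2 * ellK m := by
    unfold freq; field_simp; norm_num
  obtain ⟨M₁, hM₁, h1⟩ := arc_energy_le A1 A3 (by simp [hc]) (by simp [hp2]) (by simp) hσ.le hm.le
    hmlt (by rw [← hlen]; ring)
  obtain ⟨M₂, hM₂, h2⟩ := arc_energy_le A2 A0 (by simp [hp2]) (by simp [hc])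
    (by rw [hr, h.left]) hσ.le hm.le hmlt (by rw [← hlen]; ring)
  refine ⟨p, ⟨hpa, hpb⟩, M₁, M₂, c, fun s hs => ?_, ?_⟩
  · rcases le_total s p with h3 | h3
    · exact (hM₂ s (Or.inr ⟨hs.1, h3⟩)).trans (le_max_right _ _)
    rcases le_total s (p + L / 2) with h4 | h4
    · exact (hM₁ s (Or.inl ⟨h3, h4⟩)).trans (le_max_left _ _)
    · exact (hM₂ s (Or.inl ⟨h4, hs.2⟩)).trans (le_max_right _ _)
  · simp only [intervalIntegral.integral_same, add_zero] at h1
    have split : ∀ g : ℝ → ℝ, IntervalIntegrable g volume (-(L / 2)) p →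
        IntervalIntegrable g volume p (p + L / 2) →
        IntervalIntegrable g volume (p + L / 2) (L / 2) →
        ∫ s in (-(L / 2))..(L / 2), g s = (∫ s in (-(L / 2))..p, g s) +
          (∫ s in p..(p + L / 2), g s) + ∫ s in (p + L / 2)..(L / 2), g s := fun g i0 i1 i2 => by
      rw [intervalIntegral.integral_add_adjacent_intervals i0 i1,
        intervalIntegral.integral_add_adjacent_intervals (i0.trans i1) i2]
    have e1 := split _ (A0.integrable_sq.const_mul (1 / 2)) (A1.integrable_sq.const_mul (1 / 2))
      (A2.integrable_sq.const_mul (1 / 2))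
    have e2 := split _ (A0.intervalIntegrable_comp continuous_sin_half_sq)
      (A1.intervalIntegrable_comp continuous_sin_half_sq)
      (A2.intervalIntegrable_comp continuous_sin_half_sq)
    have e3 : L - elasticaWidth L m * Real.cos c =
        2 * ∫ s in (-(L / 2))..(L / 2), Real.sin ((θ s - c) / 2) ^ 2 := by
      rw [← integral_one_sub_cos h c, ← intervalIntegral.integral_const_mul]
      refine intervalIntegral.integral_congr fun s _ => ?_
      simp only [Real.sin_sq_eq_half_sub]
      ring_nf
    rw [e2] at e3
    rw [e1]
    have e4 : elasticaEnergy L m = 8 * freq L m * (ellH m - ellK m * m) +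
        freq L m ^ 2 * (L - elasticaWidth L m) := by
      rw [length_sub_elasticaWidth hmlt, elasticaEnergy, freq]
      field_simp
      ring
    rw [e4]
    have e5 := congrArg (fun x => freq L m ^ 2 * x) e3
    linarith

lemma eqOn_zero_of_integral_eq_zero {g : ℝ → ℝ} {a b : ℝ} (hab : a ≤ b)
    (hc : ContinuousOn g (Ioo a b)) (hi : IntervalIntegrable g volume a b) (h0 : ∀ s, 0 ≤ g s)
    (h : ∫ s in a..b, g s = 0) : EqOn g 0 (Ioo a b) := by
  rw [intervalIntegral.integral_of_le hab, integral_Ioc_eq_integral_Ioo] at h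
  have hi' : IntegrableOn g (Ioo a b) := by
    rw [intervalIntegrable_iff_integrableOn_Ioo_of_le hab] at hi; exact hi
  have := (integral_eq_zero_iff_of_nonneg h0 hi').1 h
  exact Measure.eqOn_open_of_ae_eq this isOpen_Ioo hc continuousOn_const

theorem elasticaEnergy_le (hL : 0 < L) (hm : 0 < m) (hm1 : m ≤ 1 / 2) {θ k : ℝ → ℝ}
    (h : IsClosedAngle L (elasticaWidth L m) θ k) (hr : θ (L / 2) = 0) :
    elasticaEnergy L m ≤ ∫ s in (-(L / 2))..(L / 2), 1 / 2 * k s ^ 2 := by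
  obtain ⟨p, hp, M₁, M₂, c, -, hle⟩ := exists_defect_le hL hm hm1 h hr
  refine le_trans ?_ hle
  have hK := ellK_pos (show m < 1 by linarith)
  have i : ∀ {a b M : ℝ}, a ≤ b → 0 ≤ ∫ s in a..b, defect (freq L m) M (fun s => θ s - c) k s :=
    fun hab => intervalIntegral.integral_nonneg hab fun s _ => defect_nonneg _ _ _ _ _
  have i1 := i (M := M₁) (show p ≤ p + L / 2 by linarith)
  have i2 := i (M := M₂) (show p + L / 2 ≤ L / 2 by linarith [hp.2])
  have i3 := i (M := M₂) hp.1
  have i4 : 0 ≤ Real.pi / 4 * freq L m * ((M₁ - m) ^ 2 + (M₂ - m) ^ 2) := by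
    unfold freq; positivity
  have i5 : 0 ≤ freq L m ^ 2 * (elasticaWidth L m * (1 - Real.cos c)) :=
    mul_nonneg (sq_nonneg _) (mul_nonneg (elasticaWidth_pos hL hm1).le
      (sub_nonneg.2 (Real.cos_le_one c)))
  linarith

/-- Equality in the energy bound forces the first integral of the pendulum. -/
theorem sq_eq_of_energy_le (hL : 0 < L) (hm : 0 < m) (hm1 : m ≤ 1 / 2) {θ k : ℝ → ℝ}
    (h : IsClosedAngle L (elasticaWidth L m) θ k) (hr : θ (L / 2) = 0)
    (hk : ContinuousOn k (Ioo (-(L / 2)) (L / 2)))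
    (hE : ∫ s in (-(L / 2))..(L / 2), 1 / 2 * k s ^ 2 ≤ elasticaEnergy L m) :
    ∀ s ∈ Ioo (-(L / 2)) (L / 2),
      k s ^ 2 = 4 * freq L m ^ 2 * (m - Real.sin (θ s / 2) ^ 2) := by
  obtain ⟨p, hp, M₁, M₂, c, hM, hle⟩ := exists_defect_le hL hm hm1 h hr
  have hK := ellK_pos (show m < 1 by linarith)
  have hσ : 0 < freq L m := by unfold freq; positivity
  have i : ∀ {a b M : ℝ}, a ≤ b → 0 ≤ ∫ s in a..b, defect (freq L m) M (fun s => θ s - c) k s :=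
    fun hab => intervalIntegral.integral_nonneg hab fun s _ => defect_nonneg _ _ _ _ _
  have i1 := i (M := M₁) (show p ≤ p + L / 2 by linarith)
  have i2 := i (M := M₂) (show p + L / 2 ≤ L / 2 by linarith [hp.2])
  have i3 := i (M := M₂) hp.1
  have i4 : 0 ≤ Real.pi / 4 * freq L m * ((M₁ - m) ^ 2 + (M₂ - m) ^ 2) := by positivity
  have i5 : 0 ≤ freq L m ^ 2 * (elasticaWidth L m * (1 - Real.cos c)) :=
    mul_nonneg (sq_nonneg _) (mul_nonneg (elasticaWidth_pos hL hm1).le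
      (sub_nonneg.2 (Real.cos_le_one c)))
  -- All surplus terms are nonnegative and their sum is not positive, so each vanishes: the maxima
  -- equal `m`, the tilt `c` is a multiple of `2π`, and both defects are zero.
  have j4 : Real.pi / 4 * freq L m * ((M₁ - m) ^ 2 + (M₂ - m) ^ 2) = 0 := by linarith
  have j5 : freq L m ^ 2 * (elasticaWidth L m * (1 - Real.cos c)) = 0 := by linarith
  have hc : Real.cos c = 1 := by
    have := elasticaWidth_pos hL hm1
    rcases mul_eq_zero.1 j5 with h' | h'
    · exact absurd h' (by positivity)
    · rcases mul_eq_zero.1 h' with h' | h' <;> linarith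
  have j4' : (M₁ - m) ^ 2 + (M₂ - m) ^ 2 = 0 :=
    (mul_eq_zero.1 j4).resolve_left (by positivity)
  have hM₁ : M₁ = m := by nlinarith [sq_nonneg (M₁ - m), sq_nonneg (M₂ - m)]
  have hM₂ : M₂ = m := by nlinarith [sq_nonneg (M₁ - m), sq_nonneg (M₂ - m)]
  rw [hM₁, hM₂, max_self] at hM
  rw [hM₁] at i1 hle
  rw [hM₂] at i2 i3 hle
  have hA := h.toIsAngle.sub_const c
  have A0 := hA.mono (x' := -(L / 2)) (y' := p) le_rfl hp.1 (by linarith [hp.2])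
  have A1 := hA.mono (x' := p) (y' := p + L / 2) hp.1 (by linarith) (by linarith [hp.2])
  have A2 := hA.mono (x' := p + L / 2) (y' := L / 2) (by linarith [hp.1]) (by linarith [hp.2]) le_rfl
  have B0 := A0.intervalIntegrable_defect (freq L m) m
  have B1 := A1.intervalIntegrable_defect (freq L m) m
  have B2 := A2.intervalIntegrable_defect (freq L m) m
  have htot : ∫ s in (-(L / 2))..(L / 2), defect (freq L m) m (fun s => θ s - c) k s = 0 := by
    rw [← intervalIntegral.integral_add_adjacent_intervals (B0.trans B1) B2,
      ← intervalIntegral.integral_add_adjacent_intervals B0 B1]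
    linarith
  have hcont : ContinuousOn (defect (freq L m) m (fun s => θ s - c) k) (Ioo (-(L / 2)) (L / 2)) :=
    ContinuousOn.mul continuousOn_const ((hk.abs.sub (continuousOn_const.mul
      ((continuous_psi m).comp_continuousOn (hA.cont.mono Ioo_subset_Icc_self)))).pow 2)
  intro s hs
  have h0 := eqOn_zero_of_integral_eq_zero h.le hcont ((B0.trans B1).trans B2)
    (defect_nonneg _ _ _ _) htot hs
  simp only [defect, Pi.zero_apply] at h0
  have h1 : |k s| = 2 * freq L m * psi m (θ s - c) := by
    have : |k s| - 2 * freq L m * psi m (θ s - c) = 0 := by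
      rcases mul_eq_zero.1 h0 with h' | h'
      · norm_num at h'
      · exact pow_eq_zero_iff (two_ne_zero) |>.1 h'
    linarith
  have h2 : Real.sin ((θ s - c) / 2) ^ 2 = Real.sin (θ s / 2) ^ 2 := by
    have hs0 : Real.sin c = 0 := by
      have := Real.sin_sq_add_cos_sq c
      rw [hc] at this
      nlinarith
    have e : ∀ x : ℝ, Real.sin (x / 2) ^ 2 = (1 - Real.cos x) / 2 := fun x => by
      rw [Real.sin_sq_eq_half_sub]; ring_nf
    rw [e, e, Real.cos_sub, hc, hs0]
    ring
  rw [← sq_abs, h1, mul_pow, psi_sq (hM s (Ioo_subset_Icc_self hs)), h2]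
  ring

end Energy

end

noncomputable section

/-! ### The tangent angle of the elastica -/

/-- The tangent angle of the elastica of length `L` and parameter `m`. -/
def elasticaAngle (L m s : ℝ) : ℝ := 2 * Real.arcsin (Real.sqrt m * Real.sin (am m (freq L m * s)))

/-- The curvature of the elastica of length `L` and parameter `m`. -/
def elasticaCurv (L m s : ℝ) : ℝ :=
  2 * Real.sqrt m * freq L m * Real.cos (am m (freq L m * s))

section

variable {L m : ℝ}

lemma abs_sqrt_mul_sin_lt_one (hm : 0 ≤ m) (hm1 : m < 1) (φ : ℝ) :
    |Real.sqrt m * Real.sin φ| < 1 := by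
  rw [← sq_lt_one_iff_abs_lt_one, mul_pow, Real.sq_sqrt hm]
  linarith [one_sub_pos_of_lt_one hm1 φ]

lemma sin_half_elasticaAngle (hm : 0 ≤ m) (hm1 : m < 1) (s : ℝ) :
    Real.sin (elasticaAngle L m s / 2) = Real.sqrt m * Real.sin (am m (freq L m * s)) := by
  have := abs_lt.1 (abs_sqrt_mul_sin_lt_one hm hm1 (am m (freq L m * s)))
  rw [elasticaAngle, mul_div_cancel_left₀ _ (two_ne_zero' ℝ), Real.sin_arcsin this.1.le this.2.le]

lemma cos_half_elasticaAngle (hm : 0 ≤ m) (s : ℝ) :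
    Real.cos (elasticaAngle L m s / 2) = delta m (am m (freq L m * s)) := by
  rw [elasticaAngle, mul_div_cancel_left₀ _ (two_ne_zero' ℝ), Real.cos_arcsin, mul_pow,
    Real.sq_sqrt hm, delta]

lemma sin_half_elasticaAngle_sq (hm : 0 ≤ m) (hm1 : m < 1) (s : ℝ) :
    Real.sin (elasticaAngle L m s / 2) ^ 2 = m * Real.sin (am m (freq L m * s)) ^ 2 := by
  rw [sin_half_elasticaAngle hm hm1, mul_pow, Real.sq_sqrt hm]

lemma cos_eq_one_sub_sin_half_sq (x : ℝ) : Real.cos x = 1 - 2 * Real.sin (x / 2) ^ 2 := by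
  rw [Real.sin_sq_eq_half_sub]; ring_nf

lemma cos_elasticaAngle (hm : 0 ≤ m) (hm1 : m < 1) (s : ℝ) :
    Real.cos (elasticaAngle L m s) = 1 - 2 * m * Real.sin (am m (freq L m * s)) ^ 2 := by
  rw [cos_eq_one_sub_sin_half_sq, sin_half_elasticaAngle_sq hm hm1]; ring

lemma sin_elasticaAngle (hm : 0 ≤ m) (hm1 : m < 1) (s : ℝ) :
    Real.sin (elasticaAngle L m s) =
      2 * Real.sqrt m * Real.sin (am m (freq L m * s)) * delta m (am m (freq L m * s)) := by
  have h : elasticaAngle L m s = 2 * (elasticaAngle L m s / 2) := by ring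
  rw [h, Real.sin_two_mul, sin_half_elasticaAngle hm hm1, cos_half_elasticaAngle hm]; ring

lemma hasDerivAt_am_freq (hm : 0 ≤ m) (hm1 : m < 1) (s : ℝ) :
    HasDerivAt (fun s => am m (freq L m * s)) (delta m (am m (freq L m * s)) * freq L m) s := by
  have h1 : HasDerivAt (fun s => freq L m * s) (freq L m) s := by
    simpa using (hasDerivAt_id s).const_mul (freq L m)
  exact (hasDerivAt_am hm hm1 (freq L m * s)).comp s h1

lemma hasDerivAt_elasticaAngle (hm : 0 ≤ m) (hm1 : m < 1) (s : ℝ) :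
    HasDerivAt (elasticaAngle L m) (elasticaCurv L m s) s := by
  have hlt := abs_lt.1 (abs_sqrt_mul_sin_lt_one hm hm1 (am m (freq L m * s)))
  have h := ((Real.hasDerivAt_arcsin hlt.1.ne' hlt.2.ne).comp s
    (((Real.hasDerivAt_sin _).comp s (hasDerivAt_am_freq (L := L) hm hm1 s)).const_mul
      (Real.sqrt m))).const_mul 2
  refine h.congr_deriv ?_
  have hd := (delta_pos hm1 (am m (freq L m * s))).ne'
  rw [mul_pow, Real.sq_sqrt hm, elasticaCurv]
  change 2 * (1 / delta m (am m (freq L m * s)) * _) = _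
  field_simp

lemma hasDerivAt_elasticaCurv (hm : 0 ≤ m) (hm1 : m < 1) (s : ℝ) :
    HasDerivAt (elasticaCurv L m) (-(freq L m ^ 2 * Real.sin (elasticaAngle L m s))) s := by
  have h := ((Real.hasDerivAt_cos _).comp s (hasDerivAt_am_freq (L := L) hm hm1 s)).const_mul
    (2 * Real.sqrt m * freq L m)
  refine h.congr_deriv ?_
  rw [sin_elasticaAngle hm hm1]; ring

lemma elasticaCurv_sq (hm : 0 ≤ m) (hm1 : m < 1) (s : ℝ) :
    elasticaCurv L m s ^ 2 = 4 * freq L m ^ 2 * (m - Real.sin (elasticaAngle L m s / 2) ^ 2) := by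
  rw [sin_half_elasticaAngle_sq hm hm1, elasticaCurv]
  have := Real.sq_sqrt hm
  have h2 := Real.sin_sq_add_cos_sq (am m (freq L m * s))
  linear_combination (4 * freq L m ^ 2 * Real.cos (am m (freq L m * s)) ^ 2) * this +
    (4 * freq L m ^ 2 * m) * h2

lemma continuous_elasticaAngle (hm : 0 ≤ m) (hm1 : m < 1) : Continuous (elasticaAngle L m) :=
  continuous_iff_continuousAt.2 fun s => (hasDerivAt_elasticaAngle hm hm1 s).continuousAt

lemma continuous_elasticaCurv (hm : 0 ≤ m) (hm1 : m < 1) : Continuous (elasticaCurv L m) :=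
  continuous_iff_continuousAt.2 fun s => (hasDerivAt_elasticaCurv hm hm1 s).continuousAt

lemma freq_pos (hL : 0 < L) (hm1 : m < 1) : 0 < freq L m := by
  have := ellK_pos hm1
  unfold freq; positivity

lemma freq_mul_length (hL : 0 < L) : freq L m * L = 4 * ellK m := by
  unfold freq; field_simp

lemma freq_mul_half (hL : 0 < L) : freq L m * (L / 2) = 2 * ellK m := by
  linarith [freq_mul_length (m := m) hL]

lemma elasticaAngle_zero (hm1 : m < 1) : elasticaAngle L m 0 = 0 := by
  simp [elasticaAngle, am_zero hm1]

lemma elasticaCurv_zero (hm1 : m < 1) : elasticaCurv L m 0 = 2 * Real.sqrt m * freq L m := by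
  simp [elasticaCurv, am_zero hm1]

lemma elasticaAngle_neg (hm : 0 ≤ m) (hm1 : m < 1) (s : ℝ) :
    elasticaAngle L m (-s) = -elasticaAngle L m s := by
  simp [elasticaAngle, am_neg hm hm1, Real.arcsin_neg]

lemma elasticaAngle_half (hL : 0 < L) (hm : 0 ≤ m) (hm1 : m < 1) :
    elasticaAngle L m (L / 2) = 0 := by
  simp [elasticaAngle, freq_mul_half hL, am_two_mul_ellK hm hm1]

lemma elasticaAngle_neg_half (hL : 0 < L) (hm : 0 ≤ m) (hm1 : m < 1) :
    elasticaAngle L m (-(L / 2)) = 0 := by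
  rw [elasticaAngle_neg hm hm1, elasticaAngle_half hL hm hm1, neg_zero]

lemma elasticaCurv_neg_half (hL : 0 < L) (hm : 0 ≤ m) (hm1 : m < 1) :
    elasticaCurv L m (-(L / 2)) = -(2 * Real.sqrt m * freq L m) := by
  rw [elasticaCurv, mul_neg, am_neg hm hm1, freq_mul_half hL, am_two_mul_ellK hm hm1,
    Real.cos_neg, Real.cos_pi]
  ring

lemma periodic_elasticaAngle (hL : 0 < L) (hm : 0 ≤ m) (hm1 : m < 1) :
    Function.Periodic (elasticaAngle L m) L := fun s => by
  have h : freq L m * (s + L) = freq L m * s + 2 * ellK m + 2 * ellK m := by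
    rw [mul_add, freq_mul_length hL]; ring
  rw [elasticaAngle, h, am_add_two_mul_ellK hm hm1, am_add_two_mul_ellK hm hm1, Real.sin_add_pi,
    Real.sin_add_pi, neg_neg, elasticaAngle]

lemma sin_elasticaAngle_neg_of_mem (hL : 0 < L) (hm : 0 < m) (hm1 : m < 1) {s : ℝ}
    (hs : s ∈ Ioo (-(L / 2)) 0) : Real.sin (elasticaAngle L m s) < 0 := by
  have hf := freq_pos hL hm1
  have h1 : am m (freq L m * s) < 0 := by
    rw [← am_zero hm1]
    exact strictMono_am hm.le hm1 (mul_neg_of_pos_of_neg hf hs.2)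
  have h2 : -Real.pi < am m (freq L m * s) := by
    rw [← am_two_mul_ellK hm.le hm1, ← am_neg hm.le hm1]
    refine strictMono_am hm.le hm1 ?_
    rw [← freq_mul_half hL]
    nlinarith [hs.1]
  rw [sin_elasticaAngle hm.le hm1]
  have h3 := Real.sin_neg_of_neg_of_neg_pi_lt h1 h2
  have h4 := delta_pos hm1 (am m (freq L m * s))
  have h5 := Real.sqrt_pos.2 hm
  exact mul_neg_of_neg_of_pos (mul_neg_of_pos_of_neg (by positivity) h3) h4

/-- Substituting `φ = am(σ s)` carries `[-L/2, L/2]` onto `[-π, π]`, with `ds = dφ/(σ δ)`.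
Periodicity and evenness reduce this to four copies of a quarter period, and `4/σ = L/K`. -/
lemma integral_comp_am (hL : 0 < L) (hm : 0 ≤ m) (hm1 : m < 1) {g : ℝ → ℝ} (hg : Continuous g)
    (hper : Function.Periodic g Real.pi) (heven : ∀ x, g (-x) = g x) :
    ∫ s in (-(L / 2))..(L / 2), g (am m (freq L m * s)) =
      L / ellK m * ∫ φ in (0 : ℝ)..(Real.pi / 2), g φ * (delta m φ)⁻¹ := by
  have hc := continuous_inv_delta hm1
  have hf := freq_pos hL hm1
  set G : ℝ → ℝ := fun φ => g φ * (delta m φ)⁻¹ with hG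
  have hGc : Continuous G := hg.mul hc
  have hGi : ∀ a b, IntervalIntegrable G volume a b := fun a b => hGc.intervalIntegrable a b
  have hGp : Function.Periodic G Real.pi := fun x => by simp [hG, hper x, delta_add_pi]
  have hsub := intervalIntegral.integral_comp_mul_deriv (a := -(L / 2)) (b := L / 2) (g := G)
    (fun s _ => hasDerivAt_am_freq (L := L) hm hm1 s)
    (Continuous.continuousOn (((continuous_delta m).comp ((continuous_am hm hm1).comp
      (continuous_const.mul continuous_id))).mul continuous_const)) hGc
  rw [freq_mul_half hL, mul_neg, freq_mul_half hL, am_neg hm hm1, am_two_mul_ellK hm hm1] at hsub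
  have h1 : ∫ s in (-(L / 2))..(L / 2), (G ∘ fun s => am m (freq L m * s)) s *
      (delta m (am m (freq L m * s)) * freq L m) =
      freq L m * ∫ s in (-(L / 2))..(L / 2), g (am m (freq L m * s)) := by
    rw [← intervalIntegral.integral_const_mul]
    refine intervalIntegral.integral_congr fun s _ => ?_
    have := (delta_pos hm1 (am m (freq L m * s))).ne'
    simp only [hG, Function.comp_apply]
    field_simp
  have h2 : ∫ φ in (-Real.pi)..Real.pi, G φ = 4 * ∫ φ in (0 : ℝ)..(Real.pi / 2), G φ := by
    have e1 : ∫ φ in (-Real.pi)..0, G φ = ∫ φ in (-(Real.pi / 2))..(Real.pi / 2), G φ := by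
      have := hGp.intervalIntegral_add_eq (-Real.pi) (-(Real.pi / 2))
      rwa [neg_add_cancel, show -(Real.pi / 2) + Real.pi = Real.pi / 2 by ring] at this
    have e2 : ∫ φ in (0 : ℝ)..Real.pi, G φ = ∫ φ in (-(Real.pi / 2))..(Real.pi / 2), G φ := by
      have := hGp.intervalIntegral_add_eq 0 (-(Real.pi / 2))
      rwa [zero_add, show -(Real.pi / 2) + Real.pi = Real.pi / 2 by ring] at this
    have e3 : ∫ φ in (-(Real.pi / 2))..0, G φ = ∫ φ in (0 : ℝ)..(Real.pi / 2), G φ := by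
      have := intervalIntegral.integral_comp_neg (a := 0) (b := Real.pi / 2) G
      rw [neg_zero] at this
      rw [← this]
      refine intervalIntegral.integral_congr fun φ _ => ?_
      simp [hG, heven, delta_neg]
    rw [← intervalIntegral.integral_add_adjacent_intervals (hGi (-Real.pi) 0) (hGi 0 Real.pi),
      e1, e2, ← intervalIntegral.integral_add_adjacent_intervals (hGi (-(Real.pi / 2)) 0)
        (hGi 0 (Real.pi / 2)), e3]
    ring
  rw [h1, h2] at hsub
  have hK := (ellK_pos hm1).ne'
  have : freq L m * (L / ellK m) = 4 := by unfold freq; field_simp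
  refine mul_left_cancel₀ hf.ne' ?_
  rw [hsub, ← mul_assoc, this]

lemma integral_cos_elasticaAngle (hL : 0 < L) (hm : 0 ≤ m) (hm1 : m < 1) :
    ∫ s in (-(L / 2))..(L / 2), Real.cos (elasticaAngle L m s) = elasticaWidth L m := by
  simp_rw [cos_elasticaAngle hm hm1]
  rw [integral_comp_am hL hm hm1 (g := fun φ => 1 - 2 * m * Real.sin φ ^ 2) (by fun_prop)
    (fun x => by simp [Real.sin_add_pi]) (fun x => by simp), elasticaWidth, ellN]
  ring

lemma integral_half_elasticaCurv_sq (hL : 0 < L) (hm : 0 ≤ m) (hm1 : m < 1) :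
    ∫ s in (-(L / 2))..(L / 2), 1 / 2 * elasticaCurv L m s ^ 2 = elasticaEnergy L m := by
  have h1 : ∀ s, 1 / 2 * elasticaCurv L m s ^ 2 =
      2 * m * freq L m ^ 2 * Real.cos (am m (freq L m * s)) ^ 2 := fun s => by
    rw [elasticaCurv]
    linear_combination (2 * freq L m ^ 2 * Real.cos (am m (freq L m * s)) ^ 2) * Real.sq_sqrt hm
  simp_rw [h1]
  rw [integral_comp_am hL hm hm1 (g := fun φ => 2 * m * freq L m ^ 2 * Real.cos φ ^ 2)
    (by fun_prop) (fun x => by simp [Real.cos_add_pi]) (fun x => by simp), elasticaEnergy,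
    ellH_eq hm1]
  have hK := (ellK_pos hm1).ne'
  rw [← intervalIntegral.integral_const_mul, ← intervalIntegral.integral_const_mul]
  refine intervalIntegral.integral_congr fun φ _ => ?_
  have hd := (delta_pos hm1 φ).ne'
  simp only [freq]
  field_simp
  ring

lemma integral_sin_elasticaAngle (hm : 0 ≤ m) (hm1 : m < 1) :
    ∫ s in (-(L / 2))..(L / 2), Real.sin (elasticaAngle L m s) = 0 := by
  have := intervalIntegral.integral_comp_neg (a := -(L / 2)) (b := L / 2)
    fun s => Real.sin (elasticaAngle L m s)
  simp only [elasticaAngle_neg hm hm1, Real.sin_neg, intervalIntegral.integral_neg, neg_neg] at this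
  linarith

lemma lipschitzWith_pendulum (σ : ℝ) :
    LipschitzWith (max 1 (‖σ‖₊ ^ 2)) fun p : ℝ × ℝ => (p.2, -(σ ^ 2 * Real.sin p.1)) := by
  have h1 : LipschitzWith 1 fun p : ℝ × ℝ => p.2 := LipschitzWith.prod_snd
  have h2 : LipschitzWith (‖σ‖₊ ^ 2) fun p : ℝ × ℝ => -(σ ^ 2 * Real.sin p.1) := by
    refine LipschitzWith.of_dist_le_mul fun p q => ?_
    have h3 : |Real.sin p.1 - Real.sin q.1| ≤ |p.1 - q.1| := by
      have := Real.lipschitzWith_sin.dist_le_mul p.1 q.1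
      simpa [Real.dist_eq] using this
    have h4 : |p.1 - q.1| ≤ dist p q := by
      rw [← Real.dist_eq]; exact le_max_left _ _
    rw [Real.dist_eq, show -(σ ^ 2 * Real.sin p.1) - -(σ ^ 2 * Real.sin q.1) =
      -(σ ^ 2 * (Real.sin p.1 - Real.sin q.1)) by ring, abs_neg, abs_mul, abs_of_nonneg (sq_nonneg σ)]
    simp only [NNReal.coe_pow, coe_nnnorm, Real.norm_eq_abs, sq_abs]
    exact mul_le_mul_of_nonneg_left (h3.trans h4) (sq_nonneg σ)
  exact h1.prodMk h2

/-- Solutions of the pendulum equation with the energy of the elastica are the elastica or its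
mirror image. -/
theorem eqOn_elasticaAngle_or_neg (hL : 0 < L) (hm : 0 < m) (hm1 : m < 1) {θ k : ℝ → ℝ}
    (h : IsAngle θ k (-(L / 2)) (L / 2)) (h0 : θ (-(L / 2)) = 0)
    (hk : ∀ s ∈ Ioo (-(L / 2)) (L / 2),
      k s ^ 2 = 4 * freq L m ^ 2 * (m - Real.sin (θ s / 2) ^ 2))
    (hk' : ∀ s ∈ Ioo (-(L / 2)) (L / 2), HasDerivAt k (-(freq L m ^ 2 * Real.sin (θ s))) s) :
    EqOn θ (elasticaAngle L m) (Icc (-(L / 2)) (L / 2)) ∨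
      EqOn θ (fun s => -elasticaAngle L m s) (Icc (-(L / 2)) (L / 2)) := by
  set a := -(L / 2) with ha
  set b := L / 2 with hb
  have hab : a < b := by simp only [ha, hb]; linarith
  set σ := freq L m with hσ
  have hσ0 : 0 < σ := freq_pos hL hm1
  have h00 : (0 : ℝ) ∈ Ioo a b := ⟨by simp only [ha]; linarith, by simp only [hb]; linarith⟩
  -- The curvature is controlled only on the open interval. Extending `θ` continuously and
  -- redefining `k` and then `θ` as primitives gives functions differentiable everywhere, so that
  -- initial data at the end point make sense.
  set θc : ℝ → ℝ := IccExtend hab.le (domRestrict (Icc a b) θ) with hθc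
  have hθcc : Continuous θc := h.cont.domRestrict.Icc_extend'
  have hθce : ∀ s ∈ Icc a b, θc s = θ s := fun s hs => IccExtend_of_mem _ _ hs
  set κ : ℝ → ℝ := fun s => k 0 + ∫ t in (0 : ℝ)..s, -(σ ^ 2 * Real.sin (θc t)) with hκ
  have hfc : Continuous fun t => -(σ ^ 2 * Real.sin (θc t)) := by fun_prop
  have hκd : ∀ s, HasDerivAt κ (-(σ ^ 2 * Real.sin (θc s))) s := fun s =>
    (intervalIntegral.integral_hasDerivAt_right (hfc.intervalIntegrable _ _)
      hfc.aestronglyMeasurable.stronglyMeasurableAtFilter hfc.continuousAt).const_add (k 0)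
  have hκc : Continuous κ := continuous_iff_continuousAt.2 fun s => (hκd s).continuousAt
  have hκe : ∀ s ∈ Ioo a b, κ s = k s := by
    intro s hs
    have hsub : uIcc 0 s ⊆ Ioo a b := by
      rcases le_total 0 s with h' | h'
      · rw [uIcc_of_le h']; exact Icc_subset_Ioo h00.1 hs.2
      · rw [uIcc_of_ge h']; exact Icc_subset_Ioo hs.1 h00.2
    have := intervalIntegral.integral_eq_sub_of_hasDerivAt (f := k)
      (f' := fun t => -(σ ^ 2 * Real.sin (θc t))) (a := 0) (b := s)
      (fun t ht => by
        rw [hθce t (Ioo_subset_Icc_self (hsub ht))]; exact hk' t (hsub ht))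
      (hfc.intervalIntegrable _ _)
    simp only [hκ, this]; ring
  set ϑ : ℝ → ℝ := fun s => ∫ t in a..s, κ t with hϑ
  have hϑd : ∀ s, HasDerivAt ϑ (κ s) s := fun s =>
    intervalIntegral.integral_hasDerivAt_right (hκc.intervalIntegrable _ _)
      hκc.aestronglyMeasurable.stronglyMeasurableAtFilter hκc.continuousAt
  have hϑe : ∀ s ∈ Icc a b, ϑ s = θ s := by
    intro s hs
    have := intervalIntegral.integral_eq_sub_of_hasDerivAt_of_le hs.1
      (h.cont.mono (Icc_subset_Icc_right hs.2)) (f' := κ)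
      (fun t ht => by
        have ht' : t ∈ Ioo a b := ⟨ht.1, lt_of_lt_of_le ht.2 hs.2⟩
        rw [hκe t ht']; exact h.deriv t ht') (hκc.intervalIntegrable _ _)
    rw [hϑ]; simp only; rw [this, h0, sub_zero]
  have hκa : κ a ^ 2 = 4 * σ ^ 2 * m := by
    have hlim1 : Tendsto (fun s => κ s ^ 2) (𝓝[>] a) (𝓝 (κ a ^ 2)) :=
      ((hκc.pow 2).tendsto a).mono_left nhdsWithin_le_nhds
    have hg : Continuous fun s => 4 * σ ^ 2 * (m - Real.sin (θc s / 2) ^ 2) := by fun_prop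
    have hlim2 := (hg.tendsto a).mono_left (nhdsWithin_le_nhds (s := Ioi a))
    have hz : θc a = 0 := by rw [hθce a (left_mem_Icc.2 hab.le), h0]
    simp only [hz, zero_div, Real.sin_zero] at hlim2
    have heq : (fun s => κ s ^ 2) =ᶠ[𝓝[>] a] fun s => 4 * σ ^ 2 * (m - Real.sin (θc s / 2) ^ 2) := by
      filter_upwards [Ioo_mem_nhdsGT hab] with s hs
      rw [hκe s hs, hk s hs, hθce s (Ioo_subset_Icc_self hs)]
    have := tendsto_nhds_unique hlim1 (hlim2.congr' heq.symm)
    rw [this]; ring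
  have uniq : ∀ f g : ℝ → ℝ, (∀ s, HasDerivAt f (g s) s) →
      (∀ s, HasDerivAt g (-(σ ^ 2 * Real.sin (f s))) s) → f a = 0 → g a = κ a →
      EqOn θ f (Icc a b) := by
    intro f g hf hg hfa hga
    have h3 := ODE_solution_unique_of_mem_Icc_right (s := fun _ => univ)
      (v := fun _ p => (p.2, -(σ ^ 2 * Real.sin p.1))) (f := fun s => (ϑ s, κ s))
      (g := fun s => (f s, g s)) (a := a) (b := b)
      (fun t _ => (lipschitzWith_pendulum σ).lipschitzOnWith)
      (Continuous.continuousOn (continuous_iff_continuousAt.2 fun s =>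
        ((hϑd s).continuousAt.prodMk (hκd s).continuousAt)))
      (fun t ht => by
        have e : θc t = ϑ t := by
          rw [hθce t (Ico_subset_Icc_self ht), hϑe t (Ico_subset_Icc_self ht)]
        have := (hϑd t).prodMk (hκd t)
        rw [e] at this
        exact this.hasDerivWithinAt) (fun _ _ => mem_univ _)
      (Continuous.continuousOn (continuous_iff_continuousAt.2 fun s =>
        ((hf s).continuousAt.prodMk (hg s).continuousAt)))
      (fun t ht => ((hf t).prodMk (hg t)).hasDerivWithinAt) (fun _ _ => mem_univ _)
      (by
        simp only [Prod.mk.injEq]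
        exact ⟨by rw [hϑe a (left_mem_Icc.2 hab.le), h0, hfa], hga.symm⟩)
    intro s hs
    have := congrArg Prod.fst (h3 hs)
    simp only at this
    rw [← hϑe s hs, this]
  -- The first integral determines the initial curvature up to sign; the two signs are the elastica
  -- and its mirror image.
  have hsq : (κ a - elasticaCurv L m a) * (κ a + elasticaCurv L m a) = 0 := by
    rw [elasticaCurv_neg_half hL hm.le hm1]
    linear_combination hκa - 4 * σ ^ 2 * Real.sq_sqrt hm.le
  have hE := hasDerivAt_elasticaAngle (L := L) hm.le hm1
  have hC := hasDerivAt_elasticaCurv (L := L) hm.le hm1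
  have ha0 := elasticaAngle_neg_half hL hm.le hm1
  rcases mul_eq_zero.1 hsq with h' | h'
  · exact Or.inl (uniq _ _ hE hC ha0 (by linarith))
  · refine Or.inr (uniq _ (fun s => -elasticaCurv L m s) (fun s => (hE s).neg) (fun s => ?_)
      (by rw [neg_eq_zero]; exact ha0) (by linarith))
    refine (hC s).neg.congr_deriv ?_
    rw [Real.sin_neg]; ring

end

end

noncomputable section

/-! ### Tangent angles of isometric curves -/

section Curve

variable {L X₀ W : ℝ} {Z : ℝ → ℂ}

lemma IsIsometricCurve.deriv_ne_zero {s₁ s₂ : ℝ} (h : IsIsometricCurve s₁ s₂ Z) {s : ℝ}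
    (hs : s ∈ Ioo s₁ s₂) : deriv Z s ≠ 0 := by
  rw [← norm_ne_zero_iff, h.isometric s hs]; exact one_ne_zero

lemma IsIsometricCurve.analyticOnNhd_curvature {s₁ s₂ : ℝ} (h : IsIsometricCurve s₁ s₂ Z) :
    AnalyticOnNhd ℝ (curvature Z) (Ioo s₁ s₂) := by
  have h1 := h.analytic.deriv
  have h2 := h1.deriv
  have h3 : AnalyticOnNhd ℝ (fun s => deriv (deriv Z) s / (Complex.I * deriv Z s)) (Ioo s₁ s₂) :=
    h2.div (analyticOnNhd_const.mul h1) fun s hs =>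
      mul_ne_zero Complex.I_ne_zero (h.deriv_ne_zero hs)
  exact Complex.reCLM.comp_analyticOnNhd h3

/-- Differentiating `|Z'|² = 1` shows `Z'' ⟂ Z'`, so `Z''/(i Z')` is real and nothing is lost by
taking the real part in `curvature`. -/
lemma IsIsometricCurve.hasDerivAt_deriv {s₁ s₂ : ℝ} (h : IsIsometricCurve s₁ s₂ Z) {s : ℝ}
    (hs : s ∈ Ioo s₁ s₂) :
    HasDerivAt (deriv Z) (Complex.I * curvature Z s * deriv Z s) s := by
  have hd : HasDerivAt (deriv Z) (deriv (deriv Z) s) s :=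
    (h.analytic.deriv s hs).differentiableAt.hasDerivAt
  refine hd.congr_deriv ?_
  set q := deriv (deriv Z) s / (Complex.I * deriv Z s) with hq
  have hne := h.deriv_ne_zero hs
  have hZ : deriv (deriv Z) s = Complex.I * q * deriv Z s := by
    rw [hq]; field_simp [Complex.I_ne_zero]
  have h1 : HasDerivAt (fun s => ‖deriv Z s‖ ^ 2) (2 * inner ℝ (deriv Z s) (deriv (deriv Z) s)) s :=
    hd.norm_sq
  have h2 : (fun s => ‖deriv Z s‖ ^ 2) =ᶠ[𝓝 s] fun _ => 1 := by
    filter_upwards [isOpen_Ioo.mem_nhds hs] with t ht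
    rw [h.isometric t ht]; norm_num
  have h3 : (2 : ℝ) * inner ℝ (deriv Z s) (deriv (deriv Z) s) = 0 :=
    h1.unique ((hasDerivAt_const s (1 : ℝ)).congr_of_eventuallyEq h2)
  have h4 : (inner ℝ (deriv Z s) (deriv (deriv Z) s) : ℝ) = -q.im := by
    rw [Complex.inner, hZ, show Complex.I * q * deriv Z s * (starRingEnd ℂ) (deriv Z s) =
      Complex.I * q * (deriv Z s * (starRingEnd ℂ) (deriv Z s)) by ring, Complex.mul_conj,
      Complex.normSq_eq_norm_sq, h.isometric s hs]
    simp
  have h5 : q.im = 0 := by rw [h4] at h3; linarith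
  have h6 : (curvature Z s : ℂ) = q := by
    apply Complex.ext
    · simp [curvature, hq]
    · simp [h5]
  rw [h6, ← hZ]

lemma exp_mul_I_eq (x : ℝ) :
    Complex.I * Complex.exp (Complex.I * x) = Complex.I * Real.cos x - Real.sin x := by
  rw [mul_comm Complex.I (x : ℂ), Complex.exp_mul_I]
  push_cast
  linear_combination Complex.sin x * Complex.I_mul_I

/-- An admissible curve of finite energy has a tangent angle. -/
theorem Admissible.exists_angle (hL : 0 < L) (h : Admissible L X₀ W Z)
    (hE : energy (-(L / 2)) (L / 2) Z ≠ ⊤) :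
    ∃ θ : ℝ → ℝ, IsClosedAngle L W θ (curvature Z) ∧ (∃ n : ℤ, θ (L / 2) = 2 * Real.pi * n) ∧
      (∀ s ∈ Ioo (-(L / 2)) (L / 2),
        HasDerivAt Z (Complex.I * Complex.exp (Complex.I * θ s)) s) ∧
      energy (-(L / 2)) (L / 2) Z =
        ENNReal.ofReal (∫ s in (-(L / 2))..(L / 2), 1 / 2 * curvature Z s ^ 2) := by
  obtain ⟨hZ, hB⟩ := h
  set a := -(L / 2) with ha
  set b := L / 2 with hb
  set k := curvature Z with hk
  have hab : a < b := by simp only [ha, hb]; linarith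
  have hkc : ContinuousOn k (Ioo a b) := hZ.analyticOnNhd_curvature.continuousOn
  have hkm : AEStronglyMeasurable k (volume.restrict (Ioo a b)) :=
    hkc.aestronglyMeasurable measurableSet_Ioo
  have hfin : ∫⁻ s in Ioo a b, ENNReal.ofReal (k s ^ 2) ≠ ⊤ := by
    intro h'
    apply hE
    rw [energy, h', ENNReal.mul_top (by simp)]
  have hsq : IntegrableOn (fun s => k s ^ 2) (Ioo a b) :=
    (lintegral_ofReal_ne_top_iff_integrable (hkm.pow 2)
      (Eventually.of_forall fun s => sq_nonneg _)).1 hfin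
  have hk1 : IntegrableOn k (Ioo a b) :=
    ((memLp_two_iff_integrable_sq hkm).2 hsq).integrable one_le_two
  have hki : IntervalIntegrable k volume a b :=
    (intervalIntegrable_iff_integrableOn_Ioo_of_le hab.le).2 hk1
  have hksq : IntervalIntegrable (fun s => k s ^ 2) volume a b :=
    (intervalIntegrable_iff_integrableOn_Ioo_of_le hab.le).2 hsq
  have henergy : energy a b Z = ENNReal.ofReal (∫ s in a..b, 1 / 2 * k s ^ 2) := by
    rw [intervalIntegral.integral_of_le hab.le, integral_Ioc_eq_integral_Ioo, integral_const_mul,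
      ENNReal.ofReal_mul (by norm_num), ofReal_integral_eq_lintegral_ofReal hsq
        (Eventually.of_forall fun s => sq_nonneg _), energy]
    congr 1
    rw [ENNReal.ofReal_div_of_pos (by norm_num)]
    simp
  set θ : ℝ → ℝ := fun s => ∫ t in a..s, k t with hθ
  have hθd : ∀ s ∈ Ioo a b, HasDerivAt θ (k s) s := fun s hs =>
    intervalIntegral.integral_hasDerivAt_right
      (hki.mono_set (by
        rw [uIcc_of_le hs.1.le, uIcc_of_le hab.le]; exact Icc_subset_Icc_right hs.2.le))
      (hkc.stronglyMeasurableAtFilter isOpen_Ioo s hs) (hkc.continuousAt (isOpen_Ioo.mem_nhds hs))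
  have hθc : ContinuousOn θ (Icc a b) := by
    have := intervalIntegral.continuousOn_primitive_interval (μ := volume) (f := k) (a := a) (b := b)
      (by rw [uIcc_of_le hab.le]; exact (integrableOn_Icc_iff_integrableOn_Ioo).2 hk1)
    rwa [uIcc_of_le hab.le] at this
  have hθa : θ a = 0 := by simp [hθ]
  have hangle : IsAngle θ k a b := ⟨hab.le, hθc, hθd, hki, hksq⟩
  have hZd : ∀ s ∈ Ioo a b, HasDerivAt Z (deriv Z s) s := fun s hs =>
    (hZ.analytic s hs).differentiableAt.hasDerivAt
  -- `Z' e^{-iθ}` has derivative zero, because `Z'' = i k Z'` and `θ' = k`.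
  obtain ⟨C, hC⟩ : ∃ C : ℂ, ∀ s ∈ Ioo a b, deriv Z s = C * Complex.exp (Complex.I * θ s) := by
    have hd : ∀ s ∈ Ioo a b,
        HasDerivAt (fun s => deriv Z s * Complex.exp (-(Complex.I * θ s))) 0 s := by
      intro s hs
      have h1 := hZ.hasDerivAt_deriv hs
      have h2 := (((hθd s hs).ofReal_comp.const_mul Complex.I).neg).cexp
      refine (h1.mul h2).congr_deriv ?_
      rw [← hk]
      ring
    have hex : ∀ x ∈ Ioo a b, ∀ y ∈ Ioo a b,
        deriv Z x * Complex.exp (-(Complex.I * θ x)) =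
          deriv Z y * Complex.exp (-(Complex.I * θ y)) := fun x hx y hy =>
      (convex_Ioo a b).is_const_of_fderivWithin_eq_zero (𝕜 := ℝ)
      (f := fun s => deriv Z s * Complex.exp (-(Complex.I * θ s)))
      (fun s hs => (hd s hs).differentiableAt.differentiableWithinAt) (fun s hs => by
        rw [fderivWithin_eq_fderiv (isOpen_Ioo.uniqueDiffWithinAt hs) (hd s hs).differentiableAt]
        ext
        simp [(hd s hs).deriv]) hx hy
    have h0 : (0 : ℝ) ∈ Ioo a b := ⟨by simp only [ha]; linarith, by simp only [hb]; linarith⟩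
    refine ⟨deriv Z 0 * Complex.exp (-(Complex.I * θ 0)), fun s hs => ?_⟩
    rw [hex 0 h0 s hs, mul_assoc, ← Complex.exp_add]
    simp
  have hcE : ContinuousOn (fun s => C * Complex.exp (Complex.I * θ s)) (Icc a b) :=
    continuousOn_const.mul (Complex.continuous_exp.comp_continuousOn
      (continuousOn_const.mul (Complex.continuous_ofReal.comp_continuousOn hθc)))
  have hdiff : DifferentiableOn ℝ Z (Ioo a b) := fun s hs =>
    (hZd s hs).differentiableAt.differentiableWithinAt
  -- The formula for `Z'` extends continuously to the end point, so the one-sided derivative there,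
  -- prescribed to be `i`, equals the limit `C`. The same argument at the right end gives
  -- `e^{iθ(L/2)} = 1`.
  have hCI : C = Complex.I := by
    have hlim : Tendsto (fun s => deriv Z s) (𝓝[>] a) (𝓝 C) := by
      have := (hcE a (left_mem_Icc.2 hab.le)).mono_left (nhdsWithin_mono a Ioo_subset_Icc_self)
      rw [nhdsWithin_Ioo_eq_nhdsGT hab] at this
      simp only [hθa, Complex.ofReal_zero, mul_zero, Complex.exp_zero, mul_one] at this
      refine this.congr' ?_
      filter_upwards [Ioo_mem_nhdsGT hab] with s hs
      exact (hC s hs).symm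
    have h1 := hasDerivWithinAt_Ici_of_tendsto_deriv hdiff
      (hB.tangent_left.continuousWithinAt.mono Ioo_subset_Icc_self) (Ioo_mem_nhdsGT hab) hlim
    exact (uniqueDiffOn_Icc hab a (left_mem_Icc.2 hab.le)).eq_deriv _
      (h1.mono Icc_subset_Ici_self) hB.tangent_left
  have hbI : Complex.I * Complex.exp (Complex.I * θ b) = Complex.I := by
    have hlim : Tendsto (fun s => deriv Z s) (𝓝[<] b) (𝓝 (C * Complex.exp (Complex.I * θ b))) := by
      have := (hcE b (right_mem_Icc.2 hab.le)).mono_left (nhdsWithin_mono b Ioo_subset_Icc_self)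
      rw [nhdsWithin_Ioo_eq_nhdsLT hab] at this
      refine this.congr' ?_
      filter_upwards [Ioo_mem_nhdsLT hab] with s hs
      exact (hC s hs).symm
    have h1 := hasDerivWithinAt_Iic_of_tendsto_deriv hdiff
      (hB.tangent_right.continuousWithinAt.mono Ioo_subset_Icc_self) (Ioo_mem_nhdsLT hab) hlim
    rw [hCI] at h1
    exact (uniqueDiffOn_Icc hab b (right_mem_Icc.2 hab.le)).eq_deriv _
      (h1.mono Icc_subset_Iic_self) hB.tangent_right
  rw [hCI] at hC
  have hder : ∀ s ∈ Ioo a b, HasDerivAt Z (Complex.I * Complex.exp (Complex.I * θ s)) s :=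
    fun s hs => by rw [← hC s hs]; exact hZd s hs
  have hZc : ContinuousOn Z (Icc a b) := by
    intro s hs
    rcases hs.1.eq_or_lt with h1 | h1
    · rw [← h1]; exact hB.tangent_left.continuousWithinAt
    rcases hs.2.eq_or_lt with h2 | h2
    · rw [h2]; exact hB.tangent_right.continuousWithinAt
    · exact (hder s ⟨h1, h2⟩).continuousAt.continuousWithinAt
  have hsin : IntervalIntegrable (fun s => ((Real.sin (θ s) : ℝ) : ℂ)) volume a b :=
    (Complex.continuous_ofReal.comp_continuousOn
      (hangle.comp_continuousOn Real.continuous_sin)).intervalIntegrable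
  have hcos : IntervalIntegrable (fun s => ((Real.cos (θ s) : ℝ) : ℂ)) volume a b :=
    (Complex.continuous_ofReal.comp_continuousOn
      (hangle.comp_continuousOn Real.continuous_cos)).intervalIntegrable
  have hint : ∫ s in a..b, Complex.I * Complex.exp (Complex.I * θ s) =
      Complex.I * (∫ s in a..b, Real.cos (θ s) : ℝ) - (∫ s in a..b, Real.sin (θ s) : ℝ) := by
    simp_rw [exp_mul_I_eq]
    rw [intervalIntegral.integral_sub (hcos.const_mul _) hsin, intervalIntegral.integral_const_mul,
      intervalIntegral.integral_ofReal, intervalIntegral.integral_ofReal]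
  have hdisp := intervalIntegral.integral_eq_sub_of_hasDerivAt_of_le hab.le hZc hder
    (by
      refine ContinuousOn.intervalIntegrable ?_
      rw [uIcc_of_le hab.le]; rw [hCI] at hcE; exact hcE)
  rw [hint, hB.left, hB.right] at hdisp
  have hre := congrArg Complex.re hdisp
  have him := congrArg Complex.im hdisp
  simp at hre him
  refine ⟨θ, ⟨hangle, hθa, by linarith, hre⟩, ?_, hder, henergy⟩
  have h1 : Complex.exp (Complex.I * θ b) = 1 :=
    mul_left_cancel₀ Complex.I_ne_zero (by rw [hbI, mul_one])
  obtain ⟨n, hn⟩ := Complex.exp_eq_one_iff.1 h1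
  refine ⟨n, ?_⟩
  have h2 : (θ b : ℂ) = ((2 * Real.pi * n : ℝ) : ℂ) := by
    refine mul_left_cancel₀ Complex.I_ne_zero ?_
    rw [hn]; push_cast; ring
  exact_mod_cast h2

end Curve

end

noncomputable section

/-! ### Minimizers of the bending energy -/

section Minimizer

variable {L X₀ m : ℝ} {Z : ℝ → ℂ}

/-- Every admissible curve has at least the energy of the elastica. -/
theorem Admissible.elasticaEnergy_le_energy (hL : 0 < L) (hm : 0 < m) (hm1 : m ≤ 1 / 2)
    (h : Admissible L X₀ (elasticaWidth L m) Z) :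
    ENNReal.ofReal (elasticaEnergy L m) ≤ energy (-(L / 2)) (L / 2) Z := by
  by_cases hE : energy (-(L / 2)) (L / 2) Z = ⊤
  · rw [hE]; exact le_top
  obtain ⟨θ, hθ, ⟨n, hn⟩, -, hen⟩ := h.exists_angle hL hE
  rw [hen]
  refine ENNReal.ofReal_le_ofReal ?_
  by_cases hn0 : n = 0
  · exact Elastica.elasticaEnergy_le hL hm hm1 hθ (by rw [hn, hn0]; simp)
  · exact (elasticaEnergy_lt_of_winding hL hm hm1 hθ hn0 hn).le

lemma elasticaEnergy_nonneg (hL : 0 < L) (hm : 0 ≤ m) (hm1 : m < 1) : 0 ≤ elasticaEnergy L m := by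
  have h1 := ellK_pos hm1
  have h2 := ellH_nonneg hm hm1
  unfold elasticaEnergy; positivity

/-- The curvature of a curve satisfying the first integral of the pendulum satisfies the pendulum
equation. -/
lemma hasDerivAt_curvature (hL : 0 < L) (hm : 0 < m)
    (hZ : IsIsometricCurve (-(L / 2)) (L / 2) Z) {θ : ℝ → ℝ} {σ : ℝ} (hσ : σ ≠ 0)
    (hθ : IsAngle θ (curvature Z) (-(L / 2)) (L / 2)) (h0 : θ (-(L / 2)) = 0)
    (hd : ∀ s ∈ Ioo (-(L / 2)) (L / 2), HasDerivAt Z (Complex.I * Complex.exp (Complex.I * θ s)) s)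
    (hk : ∀ s ∈ Ioo (-(L / 2)) (L / 2),
      curvature Z s ^ 2 = 4 * σ ^ 2 * (m - Real.sin (θ s / 2) ^ 2)) :
    ∀ s ∈ Ioo (-(L / 2)) (L / 2), HasDerivAt (curvature Z) (-(σ ^ 2 * Real.sin (θ s))) s := by
  set a := -(L / 2) with ha
  set b := L / 2 with hb
  have hab : a < b := by simp only [ha, hb]; linarith
  have hkan := hZ.analyticOnNhd_curvature
  have hsin : ∀ s ∈ Ioo a b, Real.sin (θ s) = -(deriv Z s).re := fun s hs => by
    rw [(hd s hs).deriv, exp_mul_I_eq, Complex.sub_re, Complex.ofReal_re, Complex.re_mul_ofReal,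
      Complex.I_re]
    ring
  have hkd : ∀ s ∈ Ioo a b, HasDerivAt (curvature Z) (deriv (curvature Z) s) s := fun s hs =>
    (hkan s hs).differentiableAt.hasDerivAt
  have hprod : ∀ s ∈ Ioo a b,
      curvature Z s • (deriv (curvature Z) s - σ ^ 2 * (deriv Z s).re) = 0 := by
    intro s hs
    have h1 := (hkd s hs).pow 2
    have h2 : HasDerivAt (fun s => 4 * σ ^ 2 * (m - Real.sin (θ s / 2) ^ 2))
        (-(2 * σ ^ 2 * Real.sin (θ s) * curvature Z s)) s := by
      have h3 := ((((hθ.deriv s hs).div_const 2).sin.pow 2).const_sub m).const_mul (4 * σ ^ 2)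
      refine h3.congr_deriv ?_
      have : Real.sin (θ s) = 2 * Real.sin (θ s / 2) * Real.cos (θ s / 2) := by
        rw [← Real.sin_two_mul]; ring_nf
      rw [this]; push_cast; ring
    have h4 : (fun s => curvature Z s ^ 2) =ᶠ[𝓝 s]
        fun s => 4 * σ ^ 2 * (m - Real.sin (θ s / 2) ^ 2) := by
      filter_upwards [isOpen_Ioo.mem_nhds hs] with t ht using hk t ht
    have h5 := h1.unique (h2.congr_of_eventuallyEq h4)
    rw [smul_eq_mul]
    rw [hsin s hs] at h5
    push_cast at h5
    linear_combination h5 / 2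
  have han : AnalyticOnNhd ℝ (fun s => deriv (curvature Z) s - σ ^ 2 * (deriv Z s).re) (Ioo a b) :=
    hkan.deriv.sub (analyticOnNhd_const.mul (Complex.reCLM.comp_analyticOnNhd hZ.analytic.deriv))
  -- Differentiating the first integral only gives the pendulum equation multiplied by `k`.
  -- Analyticity lets one factor vanish identically, and `k ≡ 0` would contradict `k² → 4σ² m > 0`
  -- at the left end, where `θ` vanishes.
  rcases AnalyticOnNhd.eq_zero_or_eq_zero_of_smul_eq_zero hkan han hprod isPreconnected_Ioo
    with h | h
  · exfalso
    have hc : ContinuousWithinAt (fun s => m - Real.sin (θ s / 2) ^ 2) (Ioi a) a := by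
      have h6 : ContinuousWithinAt θ (Ioi a) a :=
        (((hθ.cont a (left_mem_Icc.2 hab.le)).mono Ioo_subset_Icc_self).mono_of_mem_nhdsWithin
          (Ioo_mem_nhdsGT hab))
      exact continuousWithinAt_const.sub ((Real.continuous_sin.continuousAt.comp_continuousWithinAt
        (h6.div_const 2)).pow 2)
    have h7 : (fun _ => (0 : ℝ)) =ᶠ[𝓝[>] a] fun s => m - Real.sin (θ s / 2) ^ 2 := by
      filter_upwards [Ioo_mem_nhdsGT hab] with s hs
      have h8 := hk s hs
      rw [h s hs] at h8
      have h9 : 4 * σ ^ 2 ≠ 0 := by positivity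
      have h10 : 4 * σ ^ 2 * (m - Real.sin (θ s / 2) ^ 2) = 0 := by rw [← h8]; norm_num
      exact ((mul_eq_zero.1 h10).resolve_left h9).symm
    have h8 := tendsto_nhds_unique (tendsto_const_nhds.congr' h7) hc
    simp only [h0, zero_div, Real.sin_zero] at h8
    linarith
  · intro s hs
    refine (hkd s hs).congr_deriv ?_
    rw [hsin s hs]
    linarith [h s hs]

/-- A down-concave admissible curve whose energy is at most that of the elastica has the tangent
angle of the elastica. -/
theorem hasDerivAt_of_energy_le (hL : 0 < L) (hm : 0 < m) (hm1 : m ≤ 1 / 2)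
    (h : Admissible L X₀ (elasticaWidth L m) Z)
    (hE : energy (-(L / 2)) (L / 2) Z ≤ ENNReal.ofReal (elasticaEnergy L m))
    (hdc : IsDownConcave L X₀ Z) :
    ∀ s ∈ Ioo (-(L / 2)) (L / 2),
      HasDerivAt Z (Complex.I * Complex.exp (Complex.I * elasticaAngle L m s)) s := by
  have hmlt : m < 1 := by linarith
  obtain ⟨θ, hθ, ⟨n, hn⟩, hd, hen⟩ := h.exists_angle hL (ne_top_of_le_ne_top ENNReal.ofReal_ne_top hE)
  rw [hen] at hE
  replace hE := (ENNReal.ofReal_le_ofReal_iff (elasticaEnergy_nonneg hL hm.le hmlt)).1 hE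
  have hn0 : n = 0 := by
    by_contra hn0
    exact absurd hE (not_le.2 (elasticaEnergy_lt_of_winding hL hm hm1 hθ hn0 hn))
  have hr : θ (L / 2) = 0 := by rw [hn, hn0]; simp
  have hk := sq_eq_of_energy_le hL hm hm1 hθ hr h.1.analyticOnNhd_curvature.continuousOn hE
  have hk' := hasDerivAt_curvature hL hm h.1 (freq_pos hL hmlt).ne' hθ.toIsAngle hθ.left hd hk
  rcases eqOn_elasticaAngle_or_neg hL hm hmlt hθ.toIsAngle hθ.left hk hk' with heq | heq
  · intro s hs
    rw [← heq (Ioo_subset_Icc_self hs)]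
    exact hd s hs
  -- For the mirror image, `Re Z` has derivative `sin(elasticaAngle) < 0` on the left half, so the
  -- curve drops below its end points at `s = 0`.
  · exfalso
    have hle : -(L / 2) < 0 := by linarith
    have hZc : ContinuousOn (fun s => (Z s).re) (Icc (-(L / 2)) 0) := by
      refine Complex.continuous_re.comp_continuousOn fun s hs => ?_
      rcases hs.1.eq_or_lt with h1 | h1
      · rw [← h1]
        exact h.2.tangent_left.continuousWithinAt.mono (Icc_subset_Icc_right (by linarith))
      · exact (hd s ⟨h1, by linarith [hs.2]⟩).continuousAt.continuousWithinAt
    have hre : ∀ s ∈ Ioo (-(L / 2)) 0,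
        HasDerivAt (fun s => (Z s).re) (Real.sin (elasticaAngle L m s)) s := by
      intro s hs
      have hs' : s ∈ Ioo (-(L / 2)) (L / 2) := ⟨hs.1, by linarith [hs.2]⟩
      have h1 := Complex.reCLM.hasFDerivAt.comp_hasDerivAt s (hd s hs')
      refine h1.congr_deriv ?_
      rw [exp_mul_I_eq, heq (Ioo_subset_Icc_self hs')]
      simp only [Complex.reCLM_apply, Complex.sub_re, Complex.ofReal_re, Complex.re_mul_ofReal,
        Complex.I_re, Real.sin_neg]
      ring
    have hanti : StrictAntiOn (fun s => (Z s).re) (Icc (-(L / 2)) 0) := by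
      refine strictAntiOn_of_deriv_neg (convex_Icc _ _) hZc fun s hs => ?_
      rw [interior_Icc] at hs
      rw [(hre s hs).deriv]
      exact sin_elasticaAngle_neg_of_mem hL hm hmlt hs
    have h1 := hanti (left_mem_Icc.2 hle.le) (right_mem_Icc.2 hle.le) hle
    have h2 := hdc 0 ⟨hle.le, by linarith⟩
    simp only [h.2.left] at h1
    simp at h1
    linarith

lemma Admissible.continuousOn {W : ℝ} (h : Admissible L X₀ W Z) :
    ContinuousOn Z (Icc (-(L / 2)) (L / 2)) := by
  intro s hs
  rcases hs.1.eq_or_lt with h1 | h1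
  · rw [← h1]; exact h.2.tangent_left.continuousWithinAt
  rcases hs.2.eq_or_lt with h2 | h2
  · rw [h2]; exact h.2.tangent_right.continuousWithinAt
  · exact (h.1.analytic s ⟨h1, h2⟩).continuousAt.continuousWithinAt

/-- The only admissible curve whose width is its length is the straight segment. -/
theorem Admissible.eq_segment (hL : 0 < L) (h : Admissible L X₀ L Z) :
    ∀ s ∈ Icc (-(L / 2)) (L / 2), Z s = X₀ + s * Complex.I := by
  have hcont := h.continuousOn
  obtain ⟨hZ, hB⟩ := h
  set a := -(L / 2) with ha
  set b := L / 2 with hb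
  have hab : a < b := by simp only [ha, hb]; linarith
  have hZd : ∀ s ∈ Ioo a b, HasDerivAt Z (deriv Z s) s := fun s hs =>
    (hZ.analytic s hs).differentiableAt.hasDerivAt
  have hZc : ContinuousOn Z (Icc a b) := hcont
  have him : ∀ s ∈ Ioo a b, HasDerivAt (fun s => s - (Z s).im) (1 - (deriv Z s).im) s :=
    fun s hs => (hasDerivAt_id s).sub (Complex.imCLM.hasFDerivAt.comp_hasDerivAt s (hZd s hs))
  have himle : ∀ s ∈ Ioo a b, (deriv Z s).im ≤ 1 := fun s hs => by
    rw [← hZ.isometric s hs]; exact (le_abs_self _).trans (Complex.abs_im_le_norm _)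
  -- A unit speed curve gains height in `Im Z` at rate at most one; having to gain `L` over length
  -- `L`, it has no slack anywhere.
  have hmono : MonotoneOn (fun s => s - (Z s).im) (Icc a b) := by
    refine monotoneOn_of_deriv_nonneg (convex_Icc _ _)
      (continuousOn_id.sub (Complex.continuous_im.comp_continuousOn hZc)) ?_ ?_
    · rw [interior_Icc]
      exact fun s hs => (him s hs).differentiableAt.differentiableWithinAt
    · rw [interior_Icc]
      intro s hs
      rw [(him s hs).deriv]
      linarith [himle s hs]
  have hea : a - (Z a).im = 0 := by rw [hB.left]; simp [ha, hb]
  have heb : b - (Z b).im = 0 := by rw [hB.right]; simp [hb]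
  have hzero : ∀ s ∈ Icc a b, s - (Z s).im = 0 := fun s hs => by
    have h1 := hmono (left_mem_Icc.2 hab.le) hs hs.1
    have h2 := hmono hs (right_mem_Icc.2 hab.le) hs.2
    simp only at h1 h2
    linarith
  have hder : ∀ s ∈ Ioo a b, deriv Z s = Complex.I := by
    intro s hs
    have h1 : (fun s => s - (Z s).im) =ᶠ[𝓝 s] fun _ => 0 := by
      filter_upwards [isOpen_Ioo.mem_nhds hs] with t ht using hzero t (Ioo_subset_Icc_self ht)
    have h2 := (him s hs).unique ((hasDerivAt_const s (0 : ℝ)).congr_of_eventuallyEq h1)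
    have h3 : (deriv Z s).im = 1 := by linarith
    have h4 : (deriv Z s).re ^ 2 + (deriv Z s).im ^ 2 = 1 := by
      have := Complex.sq_norm (deriv Z s)
      rw [hZ.isometric s hs, Complex.normSq_apply] at this
      linarith
    rw [h3] at h4
    have h5 : (deriv Z s).re = 0 := by nlinarith
    exact Complex.ext (by simp [h5]) (by simp [h3])
  intro s hs
  have hint := intervalIntegral.integral_eq_sub_of_hasDerivAt_of_le hs.1
    (hZc.mono (Icc_subset_Icc_right hs.2)) (f' := fun _ => Complex.I) (fun t ht => by
      have ht' : t ∈ Ioo a b := ⟨ht.1, lt_of_lt_of_le ht.2 hs.2⟩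
      rw [← hder t ht']; exact hZd t ht') (by simp)
  rw [intervalIntegral.integral_const, hB.left] at hint
  have : Z s = (X₀ - (L / 2 : ℂ) * Complex.I) + (s - a) • Complex.I := by rw [hint]; ring
  rw [this, Complex.real_smul]
  simp only [ha, hb]
  push_cast
  ring

/-- The straight segment is a minimizer. -/
lemma isMinimizer_segment : IsMinimizer L X₀ L fun s => X₀ + s * Complex.I := by
  have hd : ∀ s : ℝ, HasDerivAt (fun s : ℝ => (X₀ + s * Complex.I : ℂ)) Complex.I s := fun s => by
    simpa using ((hasDerivAt_id s).ofReal_comp.mul_const Complex.I).const_add (X₀ : ℂ)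
  have hder : deriv (fun s : ℝ => (X₀ + s * Complex.I : ℂ)) = fun _ => Complex.I :=
    funext fun s => (hd s).deriv
  have han : AnalyticOnNhd ℝ (fun s : ℝ => (X₀ + s * Complex.I : ℂ)) (Ioo (-(L / 2)) (L / 2)) :=
    fun s _ => analyticAt_const.add ((Complex.ofRealCLM.analyticAt s).mul analyticAt_const)
  refine ⟨⟨⟨han, fun s _ => by rw [hder]; simp, (hd _).differentiableAt.differentiableWithinAt,
    (hd _).differentiableAt.differentiableWithinAt⟩, ⟨?_, ?_, (hd _).hasDerivWithinAt,
    (hd _).hasDerivWithinAt⟩⟩, fun Y _ => ?_⟩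
  · push_cast; ring
  · push_cast; ring
  · have : energy (-(L / 2)) (L / 2) (fun s : ℝ => (X₀ + s * Complex.I : ℂ)) = 0 := by
      simp [energy, curvature, hder]
    rw [this]; exact zero_le

/-- A curve with the tangent angle and the end point of the elastica. -/
structure IsElastica (L X₀ m : ℝ) (Z : ℝ → ℂ) : Prop where
  hasDerivAt : ∀ s, HasDerivAt Z (Complex.I * Complex.exp (Complex.I * elasticaAngle L m s)) s
  analytic : AnalyticOnNhd ℝ Z univ
  left : Z (-(L / 2)) = X₀ - (elasticaWidth L m / 2 : ℝ) * Complex.I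

lemma integral_exp_elasticaAngle (hm : 0 ≤ m) (hm1 : m < 1) (a b : ℝ) :
    ∫ s in a..b, Complex.I * Complex.exp (Complex.I * elasticaAngle L m s) =
      Complex.I * (∫ s in a..b, Real.cos (elasticaAngle L m s) : ℝ) -
        (∫ s in a..b, Real.sin (elasticaAngle L m s) : ℝ) := by
  have hc := continuous_elasticaAngle (L := L) hm hm1
  simp_rw [exp_mul_I_eq]
  rw [intervalIntegral.integral_sub (Continuous.intervalIntegrable (by fun_prop) _ _)
    (Continuous.intervalIntegrable (by fun_prop) _ _), intervalIntegral.integral_const_mul,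
    intervalIntegral.integral_ofReal, intervalIntegral.integral_ofReal]

lemma continuous_exp_elasticaAngle (hm : 0 ≤ m) (hm1 : m < 1) :
    Continuous fun s => Complex.I * Complex.exp (Complex.I * elasticaAngle L m s) := by
  have hc := continuous_elasticaAngle (L := L) hm hm1
  fun_prop

lemma IsElastica.eq_add_integral (h : IsElastica L X₀ m Z) (hm : 0 ≤ m) (hm1 : m < 1) (s : ℝ) :
    Z s = X₀ - (elasticaWidth L m / 2 : ℝ) * Complex.I +
      ∫ t in (-(L / 2))..s, Complex.I * Complex.exp (Complex.I * elasticaAngle L m t) := by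
  rw [intervalIntegral.integral_eq_sub_of_hasDerivAt (fun t _ => h.hasDerivAt t)
    ((continuous_exp_elasticaAngle hm hm1).intervalIntegrable _ _), ← h.left]
  ring

lemma IsElastica.admissible (h : IsElastica L X₀ m Z) (hL : 0 < L) (hm : 0 ≤ m) (hm1 : m < 1) :
    Admissible L X₀ (elasticaWidth L m) Z := by
  refine ⟨⟨h.analytic.mono (subset_univ _), fun s _ => ?_,
    (h.hasDerivAt _).differentiableAt.differentiableWithinAt,
    (h.hasDerivAt _).differentiableAt.differentiableWithinAt⟩, ⟨?_, ?_, ?_, ?_⟩⟩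
  · rw [(h.hasDerivAt s).deriv, norm_mul, Complex.norm_I, mul_comm Complex.I,
      Complex.norm_exp_ofReal_mul_I, one_mul]
  · rw [h.left]; push_cast; ring
  · rw [h.eq_add_integral hm hm1, integral_exp_elasticaAngle hm hm1,
      integral_cos_elasticaAngle hL hm hm1, integral_sin_elasticaAngle hm hm1]
    push_cast; ring
  · have := h.hasDerivAt (-(L / 2))
    rw [elasticaAngle_neg_half hL hm hm1] at this
    simpa using this.hasDerivWithinAt
  · have := h.hasDerivAt (L / 2)
    rw [elasticaAngle_half hL hm hm1] at this
    simpa using this.hasDerivWithinAt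

lemma IsElastica.curvature_eq (h : IsElastica L X₀ m Z) (hm : 0 ≤ m) (hm1 : m < 1) (s : ℝ) :
    curvature Z s = elasticaCurv L m s := by
  have h1 : deriv Z = fun s => Complex.I * Complex.exp (Complex.I * elasticaAngle L m s) :=
    funext fun s => (h.hasDerivAt s).deriv
  have h2 := (((hasDerivAt_elasticaAngle (L := L) hm hm1 s).ofReal_comp.const_mul
    Complex.I).cexp).const_mul Complex.I
  rw [curvature, h1, h2.deriv, mul_comm (Complex.exp _), mul_div_mul_left _ _ Complex.I_ne_zero,
    mul_div_mul_right _ _ (Complex.exp_ne_zero _), mul_div_cancel_left₀ _ Complex.I_ne_zero]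
  exact Complex.ofReal_re _

lemma IsElastica.energy_eq (h : IsElastica L X₀ m Z) (hL : 0 < L) (hm : 0 ≤ m) (hm1 : m < 1) :
    energy (-(L / 2)) (L / 2) Z = ENNReal.ofReal (elasticaEnergy L m) := by
  have hc := continuous_elasticaCurv (L := L) hm hm1
  have hab : -(L / 2) ≤ L / 2 := by linarith
  have hsq : IntegrableOn (fun s => elasticaCurv L m s ^ 2) (Ioo (-(L / 2)) (L / 2)) :=
    (intervalIntegrable_iff_integrableOn_Ioo_of_le hab).1 ((hc.pow 2).intervalIntegrable _ _)
  rw [← integral_half_elasticaCurv_sq hL hm hm1, intervalIntegral.integral_of_le hab,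
    integral_Ioc_eq_integral_Ioo, integral_const_mul, ENNReal.ofReal_mul (by norm_num),
    ofReal_integral_eq_lintegral_ofReal hsq (Eventually.of_forall fun s => sq_nonneg _), energy]
  simp_rw [h.curvature_eq hm hm1]
  congr 1
  rw [ENNReal.ofReal_div_of_pos (by norm_num)]
  simp

lemma IsElastica.isMinimizer (h : IsElastica L X₀ m Z) (hL : 0 < L) (hm : 0 < m)
    (hm1 : m ≤ 1 / 2) : IsMinimizer L X₀ (elasticaWidth L m) Z :=
  ⟨h.admissible hL hm.le (by linarith), fun Y hY => by
    rw [h.energy_eq hL hm.le (by linarith)]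
    exact hY.elasticaEnergy_le_energy hL hm hm1⟩

/-- `Re Z - X₀` is minus the integral of `sin θ`, which is nonpositive on the left half. For `s ≥
0`, oddness of the angle makes the contribution of `[-s, s]` vanish. -/
lemma IsElastica.isDownConcave (h : IsElastica L X₀ m Z) (hL : 0 < L) (hm : 0 < m) (hm1 : m < 1) :
    IsDownConcave L X₀ Z := by
  have hc : Continuous fun s => Real.sin (elasticaAngle L m s) :=
    Real.continuous_sin.comp (continuous_elasticaAngle hm.le hm1)
  have hre : ∀ s, (Z s).re = X₀ - ∫ t in (-(L / 2))..s, Real.sin (elasticaAngle L m t) := fun s => by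
    rw [h.eq_add_integral hm.le hm1, integral_exp_elasticaAngle hm.le hm1]
    simp
    ring
  have key : ∀ s ∈ Icc (-(L / 2)) 0, ∫ t in (-(L / 2))..s, Real.sin (elasticaAngle L m t) ≤ 0 := by
    intro s hs
    have h1 : 0 ≤ ∫ t in (-(L / 2))..s, -Real.sin (elasticaAngle L m t) := by
      refine intervalIntegral.integral_nonneg hs.1 fun t ht => ?_
      rcases ht.1.eq_or_lt with h2 | h2
      · rw [← h2, elasticaAngle_neg_half hL hm.le hm1]; simp
      rcases (ht.2.trans hs.2).eq_or_lt with h3 | h3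
      · rw [h3, elasticaAngle_zero hm1]; simp
      · exact (neg_pos.2 (sin_elasticaAngle_neg_of_mem hL hm hm1 ⟨h2, h3⟩)).le
    rw [intervalIntegral.integral_neg] at h1
    linarith
  intro s hs
  rw [hre]
  rcases le_total s 0 with h0 | h0
  · linarith [key s ⟨hs.1, h0⟩]
  · have h1 := intervalIntegral.integral_comp_neg (a := -s) (b := s)
      fun s => Real.sin (elasticaAngle L m s)
    simp only [elasticaAngle_neg hm.le hm1, Real.sin_neg, intervalIntegral.integral_neg,
      neg_neg] at h1
    have h2 := intervalIntegral.integral_add_adjacent_intervals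
      (hc.intervalIntegrable (μ := volume) (-(L / 2)) (-s)) (hc.intervalIntegrable (-s) s)
    linarith [key (-s) ⟨by linarith [hs.2], by linarith⟩]

end Minimizer

end

noncomputable section

/-! ### The half period `ω'` -/

/-- The first kind integral in the variable `x = tan² (φ/2)`. -/
def legendreT (m x : ℝ) : ℝ := ellF m (2 * Real.arctan (Real.sqrt x)) / 2

/-- The derivative of `legendreT`. -/
def legendreDensity (m x : ℝ) : ℝ :=
  (2 * (Real.sqrt x * Real.sqrt (x ^ 2 + (2 - 4 * m) * x + 1)))⁻¹

lemma quadratic_pos {m x : ℝ} (hm : m < 1) (hx : 0 ≤ x) : 0 < x ^ 2 + (2 - 4 * m) * x + 1 := by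
  rcases hx.eq_or_lt with rfl | h
  · norm_num
  · nlinarith [sq_nonneg (x - 1), mul_pos (sub_pos.2 hm) h]

lemma sin_two_arctan (t : ℝ) : Real.sin (2 * Real.arctan t) = 2 * t / (1 + t ^ 2) := by
  have h : 0 < 1 + t ^ 2 := by positivity
  rw [Real.sin_two_mul, Real.sin_arctan, Real.cos_arctan]
  have h3 : Real.sqrt (1 + t ^ 2) ≠ 0 := (Real.sqrt_pos.2 h).ne'
  rw [eq_div_iff h.ne']
  field_simp
  rw [Real.sq_sqrt h.le]

lemma hasDerivAt_legendreT {m x : ℝ} (hm : m < 1) (hx : 0 < x) :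
    HasDerivAt (legendreT m) (legendreDensity m x) x := by
  have hs := Real.sqrt_pos.2 hx
  have h1 := ((hasDerivAt_ellF hm (2 * Real.arctan (Real.sqrt x))).comp x
    (((Real.hasDerivAt_sqrt hx.ne').arctan).const_mul 2)).div_const 2
  refine h1.congr_deriv ?_
  have hq := quadratic_pos hm hx.le
  have hd : delta m (2 * Real.arctan (Real.sqrt x)) =
      Real.sqrt (x ^ 2 + (2 - 4 * m) * x + 1) / (1 + x) := by
    rw [delta, sin_two_arctan, Real.sq_sqrt hx.le, div_pow, mul_pow, Real.sq_sqrt hx.le,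
      show 1 - m * (2 ^ 2 * x / (1 + x) ^ 2) = (x ^ 2 + (2 - 4 * m) * x + 1) / (1 + x) ^ 2 by
        field_simp; ring,
      Real.sqrt_div hq.le, Real.sqrt_sq (by positivity)]
  have hq' := Real.sqrt_pos.2 hq
  rw [hd, Real.sq_sqrt hx.le, legendreDensity]
  field_simp

lemma continuous_legendreT {m : ℝ} (hm : m < 1) : Continuous (legendreT m) := by
  have hc : Continuous (ellF m) :=
    continuous_iff_continuousAt.2 fun φ => (hasDerivAt_ellF hm φ).continuousAt
  unfold legendreT
  exact (hc.comp (continuous_const.mul (Real.continuous_arctan.comp Real.continuous_sqrt))).div_const 2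

lemma legendreT_zero (m : ℝ) : legendreT m 0 = 0 := by
  simp [legendreT, ellF_zero_right]

lemma legendreT_one (m : ℝ) : legendreT m 1 = ellK m / 2 := by
  rw [legendreT, Real.sqrt_one, Real.arctan_one, ellK]
  ring_nf

lemma tendsto_legendreT {m : ℝ} (hm : m < 1) : Tendsto (legendreT m) atTop (𝓝 (ellK m)) := by
  have hc : ContinuousAt (ellF m) Real.pi := (hasDerivAt_ellF hm _).continuousAt
  have h1 : Tendsto (fun x => 2 * Real.arctan (Real.sqrt x)) atTop (𝓝 Real.pi) := by
    have := ((Real.tendsto_arctan_atTop.mono_right nhdsWithin_le_nhds).comp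
      Real.tendsto_sqrt_atTop).const_mul 2
    rwa [show 2 * (Real.pi / 2) = Real.pi by ring] at this
  have h2 := (hc.tendsto.comp h1).div_const 2
  rw [ellF_pi hm, mul_div_cancel_left₀ _ (two_ne_zero' ℝ)] at h2
  exact h2

lemma legendreDensity_nonneg (m x : ℝ) : 0 ≤ legendreDensity m x := by
  unfold legendreDensity; positivity

lemma integrableOn_legendreDensity {m : ℝ} (hm : m < 1) :
    IntegrableOn (legendreDensity m) (Ioi 0) :=
  integrableOn_Ioi_deriv_of_nonneg (continuous_legendreT hm).continuousWithinAt
    (fun _ hx => hasDerivAt_legendreT hm hx) (fun x _ => legendreDensity_nonneg m x)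
    (tendsto_legendreT hm)

lemma integral_legendreDensity {m : ℝ} (hm : m < 1) :
    ∫ x in Ioi (0 : ℝ), legendreDensity m x = ellK m := by
  rw [integral_Ioi_of_hasDerivAt_of_nonneg (continuous_legendreT hm).continuousWithinAt
    (fun _ hx => hasDerivAt_legendreT hm hx) (fun x _ => legendreDensity_nonneg m x)
    (tendsto_legendreT hm), legendreT_zero, sub_zero]

/-- The point `x = 1` corresponds to amplitude `π/2`, halfway to `π`. This is the value from which
the integral is continued along the unit circle. -/
lemma integral_legendreDensity_add_one {m : ℝ} (hm : m < 1) :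
    ∫ r in Ioi (0 : ℝ), legendreDensity m (1 + r) = ellK m / 2 := by
  have hlim : Tendsto (fun r => legendreT m (1 + r)) atTop (𝓝 (ellK m)) :=
    (tendsto_legendreT hm).comp (tendsto_atTop_add_const_left _ _ tendsto_id)
  have hd : ∀ r ∈ Ici (0 : ℝ),
      HasDerivAt (fun r => legendreT m (1 + r)) (legendreDensity m (1 + r)) r := fun r hr => by
    have h0 : (0 : ℝ) ≤ r := hr
    simpa using (hasDerivAt_legendreT hm (show 0 < 1 + r by linarith)).comp_const_add 1 r
  rw [integral_Ioi_of_hasDerivAt_of_nonneg' hd (fun x _ => legendreDensity_nonneg m _) hlim,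
    add_zero, legendreT_one]
  ring

/-! ### Principal square roots -/

lemma csqrt_sq (z : ℂ) : (z ^ (1 / 2 : ℂ)) ^ 2 = z := by
  rw [one_div]; exact Complex.cpow_ofNat_inv_pow z 2

lemma csqrt_re_nonneg (z : ℂ) : 0 ≤ (z ^ (1 / 2 : ℂ)).re := by
  rw [one_div, Complex.cpow_inv_two_re]; exact Real.sqrt_nonneg _

lemma norm_csqrt_sq (z : ℂ) : ‖z ^ (1 / 2 : ℂ)‖ ^ 2 = ‖z‖ := by
  rw [← norm_pow, csqrt_sq]

lemma norm_csqrt (z : ℂ) : ‖z ^ (1 / 2 : ℂ)‖ = Real.sqrt ‖z‖ := by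
  rw [← Real.sqrt_sq (norm_nonneg (z ^ (1 / 2 : ℂ))), norm_csqrt_sq]

lemma csqrt_sq_eq {v : ℂ} (hv : 0 < v.re) : (v ^ 2) ^ (1 / 2 : ℂ) = v := by
  rcases sq_eq_sq_iff_eq_or_eq_neg.1 (csqrt_sq (v ^ 2)) with h | h
  · exact h
  · have := csqrt_re_nonneg (v ^ 2)
    rw [h] at this
    simp at this
    linarith

lemma csqrt_ofReal {r : ℝ} (hr : 0 ≤ r) : (r : ℂ) ^ (1 / 2 : ℂ) = (Real.sqrt r : ℝ) := by
  rw [Real.sqrt_eq_rpow, Complex.ofReal_cpow hr]; simp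

/-- Off the cut the principal root commutes with conjugation. This turns the complex integrand on
the real axis into the real `legendreDensity`. -/
lemma csqrt_mul_csqrt_conj {w : ℂ} (hw : w ∈ Complex.slitPlane) :
    w ^ (1 / 2 : ℂ) * ((starRingEnd ℂ) w) ^ (1 / 2 : ℂ) = (‖w‖ : ℝ) := by
  have hc : (starRingEnd ℂ) (1 / 2 : ℂ) = 1 / 2 := by simp [Complex.conj_ofNat]
  have h := Complex.conj_cpow w (1 / 2) (Complex.mem_slitPlane_iff_arg.1 hw).1
  rw [hc] at h
  rw [h, Complex.mul_conj, Complex.normSq_eq_norm_sq, norm_csqrt_sq]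

/-- The branch point `e^{iA}` with `cos A = 1 - 2m`. -/
def branchPt (m : ℝ) : ℂ := (1 - 2 * m : ℝ) + (2 * Real.sqrt (m * (1 - m)) : ℝ) * Complex.I

lemma norm_add_branchPt {m : ℝ} (hm : 0 ≤ m) (hm1 : m ≤ 1) (r : ℝ) :
    ‖(r : ℂ) + branchPt m‖ = Real.sqrt (r ^ 2 + (2 - 4 * m) * r + 1) := by
  have h : (r : ℂ) + branchPt m = Complex.mk (r + (1 - 2 * m)) (2 * Real.sqrt (m * (1 - m))) := by
    apply Complex.ext <;> simp [branchPt]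
  rw [h, Complex.norm_def, Complex.normSq_mk]
  congr 1
  have := Real.mul_self_sqrt (mul_nonneg hm (sub_nonneg.2 hm1))
  linear_combination 4 * this

lemma add_branchPt_mem_slitPlane {m : ℝ} (hm : 0 < m) (hm1 : m < 1) (r : ℝ) :
    (r : ℂ) + branchPt m ∈ Complex.slitPlane := by
  right
  have := Real.sqrt_pos.2 (mul_pos hm (sub_pos.2 hm1))
  simp [branchPt, this.ne']

/-- The integrand `1 / (2 √y √(y + E) √(y + Ē))` of the first kind. -/
def firstKind (m : ℝ) (y : ℂ) : ℂ :=
  (2 * (y ^ (1 / 2 : ℂ) * (y + branchPt m) ^ (1 / 2 : ℂ) *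
    (y + (starRingEnd ℂ) (branchPt m)) ^ (1 / 2 : ℂ)))⁻¹

lemma firstKind_ofReal {m r : ℝ} (hm : 0 < m) (hm1 : m < 1) (hr : 0 ≤ r) :
    firstKind m r = (legendreDensity m r : ℝ) := by
  have h1 := csqrt_mul_csqrt_conj (add_branchPt_mem_slitPlane hm hm1 r)
  rw [map_add, Complex.conj_ofReal] at h1
  rw [firstKind, mul_assoc ((r : ℂ) ^ (1 / 2 : ℂ)), h1, norm_add_branchPt hm.le hm1.le,
    csqrt_ofReal hr, legendreDensity]
  push_cast
  rfl

/-! ### From the parameter `a` to the elliptic parameter `m`. -/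

section Parameter

variable {a : ℝ}

/-- The elliptic parameter `m = k²` of the curve with parameter `a`. -/
def ellParam (a : ℝ) : ℝ := (4 + a) / 8

lemma sqrt_sixteen_sub (a : ℝ) :
    Real.sqrt (16 - a ^ 2) = 8 * Real.sqrt (ellParam a * (1 - ellParam a)) := by
  have : 16 - a ^ 2 = 8 ^ 2 * (ellParam a * (1 - ellParam a)) := by unfold ellParam; ring
  rw [this, Real.sqrt_mul (by norm_num), Real.sqrt_sq (by norm_num)]

/-- With `e₁` as origin the other branch points are `-E` and `-Ē` with `|E| = 1`, so the cubic
becomes `x (x² + (2 - 4m) x + 1)`. The ray for `ω'` then starts at `0`, the one for `ω''` at `-E`.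
-/
lemma e₁_sub_e₃ (a : ℝ) : e₁ a - e₃ a = branchPt (ellParam a) := by
  rw [e₁, e₃, branchPt, sqrt_sixteen_sub]
  push_cast [ellParam]
  ring

lemma e₁_sub_e₂ (a : ℝ) : e₁ a - e₂ a = (starRingEnd ℂ) (branchPt (ellParam a)) := by
  rw [e₁, e₂, branchPt, sqrt_sixteen_sub, map_add, map_mul, Complex.conj_ofReal,
    Complex.conj_ofReal, Complex.conj_I]
  push_cast [ellParam]
  ring

lemma ellParam_mem (ha : a ∈ Ioc (-4 : ℝ) 0) : ellParam a ∈ Ioc (0 : ℝ) (1 / 2) := by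
  unfold ellParam; constructor <;> linarith [ha.1, ha.2]

/-- `ω' = K(m)`. -/
theorem ω'_eq (ha : a ∈ Ioc (-4 : ℝ) 0) : ω' a = (ellK (ellParam a) : ℝ) := by
  obtain ⟨h0, h1⟩ := ellParam_mem ha
  have h1' : ellParam a < 1 := by linarith
  rw [ω', halfPeriod, ← integral_legendreDensity h1', ← integral_complex_ofReal]
  refine setIntegral_congr_fun measurableSet_Ioi fun r hr => ?_
  have hr0 : (0 : ℝ) < r := hr
  rw [← firstKind_ofReal h0 h1' hr0.le, e₁_sub_e₂, e₁_sub_e₃, firstKind, one_div, mul_right_comm]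

end Parameter

end

noncomputable section

/-! ### Integrals over horizontal rays -/

lemma add_ofReal_mem_slitPlane {z : ℂ} (hz : z ∈ Complex.slitPlane) {r : ℝ} (hr : 0 ≤ r) :
    z + r ∈ Complex.slitPlane := by
  rcases hz with h | h
  · left; simp; linarith
  · right; simpa using h

/-- A ray to the right from a point off the cut stays away from `0`, uniformly near `z₀`. Combining
this gap with `‖z + r‖ ≥ r - ‖z‖` gives linear growth, hence the `r^{-3/2}` domination of products
of three roots. -/
lemma eventually_le_norm_add {z₀ : ℂ} (hz : z₀ ∈ Complex.slitPlane) :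
    ∃ c > 0, ∀ᶠ z : ℂ in 𝓝 z₀, ∀ r : ℝ, 0 ≤ r → c * (1 + r) ≤ ‖z + r‖ := by
  rcases hz with h | h
  · refine ⟨min (z₀.re / 2) 1, by positivity, ?_⟩
    filter_upwards [Complex.continuous_re.continuousAt.eventually_const_lt (half_lt_self h)]
      with z hz r hr
    have h1 : (z + r).re ≤ ‖z + r‖ := Complex.re_le_norm _
    simp only [Complex.add_re, Complex.ofReal_re] at h1
    have h2 := min_le_left (z₀.re / 2) 1
    have h3 := mul_le_mul_of_nonneg_right (min_le_right (z₀.re / 2) 1) hr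
    linarith
  · set b := |z₀.im| / 2 with hb
    have hb0 : 0 < b := by positivity
    set M := ‖z₀‖ + 1 with hM
    have hM0 : 0 < M := by positivity
    refine ⟨b / (1 + M + b), by positivity, ?_⟩
    have e1 : ∀ᶠ z in 𝓝 z₀, b < |z.im| :=
      (Complex.continuous_im.abs.continuousAt (x := z₀)).eventually_const_lt
        (half_lt_self (abs_pos.2 h))
    have e2 : ∀ᶠ z in 𝓝 z₀, ‖z‖ < M :=
      (continuous_norm.continuousAt (x := z₀)).eventually_lt_const (lt_add_one _)
    filter_upwards [e1, e2] with z h1 h2 r hr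
    have h3 : b ≤ ‖z + r‖ := by
      have := Complex.abs_im_le_norm (z + r)
      simp at this
      linarith
    have h4 : r - M ≤ ‖z + r‖ := by
      have := norm_sub_le (z + r) z
      rw [add_sub_cancel_left, Complex.norm_real, Real.norm_of_nonneg hr] at this
      linarith
    rw [div_mul_eq_mul_div, div_le_iff₀ (by positivity)]
    nlinarith [mul_le_mul_of_nonneg_left h3 hM0.le, mul_le_mul_of_nonneg_left h4 hb0.le]

/-- The integral over a horizontal ray of a function that decays faster than `r⁻¹` is a primitive
of minus this function. -/
lemma hasDerivAt_integral_ray {f : ℂ → ℂ} {U : Set ℂ} (hU : IsOpen U)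
    (hUr : ∀ z ∈ U, ∀ r : ℝ, 0 ≤ r → z + r ∈ U) (hf : DifferentiableOn ℂ f U) {y₀ : ℂ}
    (hy : y₀ ∈ U) {C : ℝ}
    (hC : ∀ᶠ z in 𝓝 y₀, ∀ r : ℝ, 0 ≤ r → ‖f (z + r)‖ ≤ C * (r + 1) ^ (-(3 / 2) : ℝ)) :
    HasDerivAt (fun y => ∫ r in Ioi (0 : ℝ), f (y + r)) (-f y₀) y₀ := by
  obtain ⟨ρ, hρ, hball⟩ := Metric.eventually_nhds_iff_ball.1 (hC.and (hU.mem_nhds hy))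
  have hρ2 : 0 < ρ / 2 := by positivity
  have hint : ∀ D : ℝ, Integrable (fun r : ℝ => D * (r + 1) ^ (-(3 / 2) : ℝ))
      (volume.restrict (Ioi 0)) := fun D =>
    (integrableOn_add_rpow_Ioi_of_lt (by norm_num) (by norm_num)).const_mul D
  have hcont : ∀ {g : ℂ → ℂ} {z : ℂ}, ContinuousOn g U → z ∈ U →
      AEStronglyMeasurable (fun r : ℝ => g (z + r)) (volume.restrict (Ioi 0)) := by
    intro g z hg hz
    refine ContinuousOn.aestronglyMeasurable ?_ measurableSet_Ioi
    exact hg.comp (by fun_prop) fun r hr => hUr z hz r (le_of_lt hr)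
  have hder : ∀ z ∈ U, ∀ r : ℝ, 0 ≤ r →
      HasDerivAt (fun z : ℂ => f (z + r)) (deriv f (z + r)) z := fun z hz r hr =>
    ((hf.differentiableAt (hU.mem_nhds (hUr z hz r hr))).hasDerivAt).comp_add_const z (r : ℂ)
  -- Cauchy's estimate on discs of radius `ρ/4` transfers the decay of `f` to `f'`; the discs fit
  -- because translating back by `r` lands in the ball of radius `ρ`.
  have hbound : ∀ z ∈ Metric.ball y₀ (ρ / 2), ∀ r : ℝ, 0 ≤ r →
      ‖deriv f (z + r)‖ ≤ C / (ρ / 4) * (r + 1) ^ (-(3 / 2) : ℝ) := by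
    intro z hz r hr
    have hsub : ∀ w ∈ Metric.closedBall (z + r) (ρ / 4), w - r ∈ Metric.ball y₀ ρ := by
      intro w hw
      rw [Metric.mem_closedBall, dist_eq_norm] at hw
      rw [Metric.mem_ball, dist_eq_norm] at hz ⊢
      calc ‖w - r - y₀‖ = ‖(w - (z + r)) + (z - y₀)‖ := by ring_nf
        _ ≤ _ := norm_add_le _ _
        _ < ρ := by linarith
    have hU' : Metric.closedBall (z + r) (ρ / 4) ⊆ U := fun w hw => by
      have := hUr _ (hball _ (hsub w hw)).2 r hr
      rwa [sub_add_cancel] at this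
    have := Complex.norm_deriv_le_of_forall_mem_sphere_norm_le (c := z + r) (R := ρ / 4)
      (C := C * (r + 1) ^ (-(3 / 2) : ℝ)) (f := f) (by positivity)
      ((hf.mono hU').diffContOnCl_ball subset_rfl) fun w hw => by
        have := (hball _ (hsub w (Metric.sphere_subset_closedBall hw))).1 r hr
        rwa [sub_add_cancel] at this
    refine this.trans (le_of_eq ?_)
    ring
  have hy₀ : y₀ ∈ Metric.ball y₀ (ρ / 2) := Metric.mem_ball_self hρ2
  have hsubU : Metric.ball y₀ (ρ / 2) ⊆ U := fun z hz =>
    (hball z (Metric.ball_subset_ball (by linarith) hz)).2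
  have hI : Integrable (fun r : ℝ => f (y₀ + r)) (volume.restrict (Ioi 0)) := by
    refine (hint C).mono' (hcont hf.continuousOn hy) ?_
    filter_upwards [ae_restrict_mem measurableSet_Ioi] with r hr
    exact (hball y₀ (Metric.mem_ball_self hρ)).1 r (le_of_lt hr)
  obtain ⟨hI', hD⟩ := hasDerivAt_integral_of_dominated_loc_of_deriv_le
    (Metric.ball_mem_nhds y₀ hρ2) (F := fun z (r : ℝ) => f (z + r))
    (F' := fun z (r : ℝ) => deriv f (z + r)) (μ := volume.restrict (Ioi 0))
    (by filter_upwards [hU.mem_nhds hy] with z hz using hcont hf.continuousOn hz) hI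
    (hcont (hf.deriv hU).continuousOn hy)
    (by
      filter_upwards [ae_restrict_mem measurableSet_Ioi] with r hr z hz
      exact hbound z hz r (le_of_lt hr))
    (hint _)
    (by
      filter_upwards [ae_restrict_mem measurableSet_Ioi] with r hr z hz
      exact hder z (hsubU hz) r (le_of_lt hr))
  have hlim : Tendsto (fun r : ℝ => f (y₀ + r)) atTop (𝓝 0) := by
    have h0 : Tendsto (fun r : ℝ => C * (r + 1) ^ (-(3 / 2) : ℝ)) atTop (𝓝 0) := by
      have := ((tendsto_rpow_neg_atTop (y := 3 / 2) (by norm_num)).comp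
        (tendsto_atTop_add_const_right atTop (1 : ℝ) tendsto_id)).const_mul C
      simpa [Function.comp_def] using this
    refine squeeze_zero_norm' ?_ h0
    filter_upwards [eventually_ge_atTop 0] with r hr
    exact (hball y₀ (Metric.mem_ball_self hρ)).1 r hr
  have hFTC := integral_Ioi_of_hasDerivAt_of_tendsto' (a := (0 : ℝ))
    (f := fun r : ℝ => f (y₀ + r)) (f' := fun r : ℝ => deriv f (y₀ + r)) (fun r hr => by
      have h1 := (hf.differentiableAt (hU.mem_nhds (hUr y₀ hy r hr))).hasDerivAt.comp_const_add y₀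
        (r : ℂ)
      exact h1.comp_ofReal) hI' hlim
  rw [hFTC] at hD
  simpa using hD

/-! ### The integral of the first kind as a function of its end point -/

/-- The domain of `firstKind m`: the complement of three horizontal rays. -/
def rayDomain (m : ℝ) : Set ℂ :=
  {y | y ∈ Complex.slitPlane ∧ y + branchPt m ∈ Complex.slitPlane ∧
    y + (starRingEnd ℂ) (branchPt m) ∈ Complex.slitPlane}

lemma isOpen_rayDomain (m : ℝ) : IsOpen (rayDomain m) :=
  Complex.isOpen_slitPlane.inter
    ((Complex.isOpen_slitPlane.preimage (by fun_prop : Continuous fun y => y + branchPt m)).inter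
      (Complex.isOpen_slitPlane.preimage
        (by fun_prop : Continuous fun y => y + (starRingEnd ℂ) (branchPt m))))

lemma add_mem_rayDomain {m : ℝ} {y : ℂ} (hy : y ∈ rayDomain m) {r : ℝ} (hr : 0 ≤ r) :
    y + r ∈ rayDomain m := by
  obtain ⟨h1, h2, h3⟩ := hy
  refine ⟨add_ofReal_mem_slitPlane h1 hr, ?_, ?_⟩
  · rw [add_right_comm]; exact add_ofReal_mem_slitPlane h2 hr
  · rw [add_right_comm]; exact add_ofReal_mem_slitPlane h3 hr

lemma csqrt_ne_zero {z : ℂ} (hz : z ∈ Complex.slitPlane) : z ^ (1 / 2 : ℂ) ≠ 0 := fun h => by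
  have := csqrt_sq z
  rw [h] at this
  exact Complex.slitPlane_ne_zero hz (by simpa using this.symm)

lemma differentiableOn_firstKind (m : ℝ) : DifferentiableOn ℂ (firstKind m) (rayDomain m) := by
  intro y hy
  have h1 : DifferentiableAt ℂ (fun y : ℂ => y ^ (1 / 2 : ℂ)) y :=
    differentiableAt_id.cpow_const hy.1
  have h2 : DifferentiableAt ℂ (fun y : ℂ => (y + branchPt m) ^ (1 / 2 : ℂ)) y :=
    (differentiableAt_id.add_const _).cpow_const hy.2.1
  have h3 : DifferentiableAt ℂ
      (fun y : ℂ => (y + (starRingEnd ℂ) (branchPt m)) ^ (1 / 2 : ℂ)) y :=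
    (differentiableAt_id.add_const _).cpow_const hy.2.2
  exact ((((h1.mul h2).mul h3).const_mul 2).inv (mul_ne_zero two_ne_zero (mul_ne_zero
    (mul_ne_zero (csqrt_ne_zero hy.1) (csqrt_ne_zero hy.2.1))
      (csqrt_ne_zero hy.2.2)))).differentiableWithinAt

lemma norm_firstKind (m : ℝ) (y : ℂ) :
    ‖firstKind m y‖ = (2 * Real.sqrt (‖y‖ * ‖y + branchPt m‖ *
      ‖y + (starRingEnd ℂ) (branchPt m)‖))⁻¹ := by
  rw [firstKind, norm_inv, norm_mul, norm_mul, norm_mul, norm_csqrt, norm_csqrt, norm_csqrt,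
    Real.sqrt_mul (by positivity), Real.sqrt_mul (by positivity)]
  simp

/-- The integral of the first kind from `y` to `∞` along a horizontal ray. -/
def rayIntegral (m : ℝ) (y : ℂ) : ℂ := ∫ r in Ioi (0 : ℝ), firstKind m (y + r)

lemma hasDerivAt_rayIntegral {m : ℝ} {y₀ : ℂ} (hy : y₀ ∈ rayDomain m) :
    HasDerivAt (rayIntegral m) (-firstKind m y₀) y₀ := by
  obtain ⟨c₁, hc₁, h₁⟩ := eventually_le_norm_add hy.1
  obtain ⟨c₂, hc₂, h₂⟩ := eventually_le_norm_add hy.2.1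
  obtain ⟨c₃, hc₃, h₃⟩ := eventually_le_norm_add hy.2.2
  have h₂' := (by fun_prop : Continuous fun y => y + branchPt m).continuousAt (x := y₀) |>.tendsto.eventually h₂
  have h₃' := (by fun_prop : Continuous fun y =>
    y + (starRingEnd ℂ) (branchPt m)).continuousAt (x := y₀) |>.tendsto.eventually h₃
  refine hasDerivAt_integral_ray (isOpen_rayDomain m) (fun z hz r hr => add_mem_rayDomain hz hr)
    (differentiableOn_firstKind m) hy (C := (2 * Real.sqrt (c₁ * c₂ * c₃))⁻¹) ?_
  filter_upwards [h₁, h₂', h₃'] with z g₁ g₂ g₃ r hr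
  have hr1 : 0 < r + 1 := by linarith
  have : (2 * Real.sqrt (c₁ * c₂ * c₃))⁻¹ * (r + 1) ^ (-(3 / 2) : ℝ) =
      (2 * Real.sqrt ((c₁ * (1 + r)) * (c₂ * (1 + r)) * (c₃ * (1 + r))))⁻¹ := by
    rw [Real.rpow_neg hr1.le, ← mul_inv, mul_assoc,
      show (r + 1) ^ (3 / 2 : ℝ) = Real.sqrt ((r + 1) ^ 3) by
        rw [Real.sqrt_eq_rpow, ← Real.rpow_natCast, ← Real.rpow_mul hr1.le]; norm_num,
      ← Real.sqrt_mul (by positivity)]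
    ring_nf
  rw [this, norm_firstKind]
  have g₂' := g₂ r hr
  have g₃' := g₃ r hr
  rw [add_right_comm] at g₂' g₃'
  have p : ∀ {c : ℝ}, 0 < c → 0 < c * (1 + r) := fun hc => mul_pos hc (by linarith)
  have := p hc₁; have := p hc₂; have := p hc₃
  gcongr
  exact g₁ r hr

/-! ### The unit circle arc from `1` to `-E` -/

/-- A square root of the point on the unit circle arc from `1` to `-E`. -/
def arcRoot (m φ : ℝ) : ℂ := delta (1 - m) φ - (Real.sqrt (1 - m) * Real.sin φ : ℝ) * Complex.I

lemma arcRoot_re (m φ : ℝ) : (arcRoot m φ).re = delta (1 - m) φ := by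
  rw [arcRoot, Complex.sub_re, Complex.re_ofReal_mul]; simp

lemma arcRoot_im (m φ : ℝ) : (arcRoot m φ).im = -(Real.sqrt (1 - m) * Real.sin φ) := by
  rw [arcRoot, Complex.sub_im, Complex.im_ofReal_mul]; simp

lemma hasDerivAt_arcRoot {m : ℝ} (hm : 0 < m) (hm1 : m < 1) (φ : ℝ) :
    HasDerivAt (arcRoot m)
      (-((Real.sqrt (1 - m) * Real.cos φ / delta (1 - m) φ : ℝ) * Complex.I) * arcRoot m φ) φ := by
  have hm' : 1 - m < 1 := by linarith
  have hd := delta_pos hm' φ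
  have h1 := ((hasDerivAt_delta hm' φ).ofReal_comp).sub
    ((((Real.hasDerivAt_sin φ).const_mul (Real.sqrt (1 - m))).ofReal_comp).mul_const Complex.I)
  refine h1.congr_deriv ?_
  have hk := Real.mul_self_sqrt (sub_nonneg.2 hm1.le)
  apply Complex.ext
  · rw [Complex.sub_re, Complex.re_ofReal_mul, neg_mul, mul_assoc _ Complex.I, Complex.neg_re,
      Complex.re_ofReal_mul, Complex.I_mul_re, arcRoot_im, Complex.ofReal_re, Complex.I_re]
    field_simp
    linear_combination Real.sin φ * Real.cos φ * hk
  · rw [Complex.sub_im, Complex.im_ofReal_mul, neg_mul, mul_assoc _ Complex.I, Complex.neg_im,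
      Complex.im_ofReal_mul, Complex.I_mul_im, arcRoot_re, Complex.ofReal_im, Complex.I_im]
    field_simp
    ring

lemma norm_arcRoot_sq {m : ℝ} (hm : 0 < m) (hm1 : m < 1) (φ : ℝ) :
    arcRoot m φ * (starRingEnd ℂ) (arcRoot m φ) = 1 := by
  have hk := Real.sq_sqrt (sub_nonneg.2 hm1.le)
  have hd := delta_sq (show 1 - m < 1 by linarith) φ
  rw [Complex.mul_conj, Complex.normSq_apply]
  simp only [arcRoot_re, arcRoot_im]
  norm_cast
  linear_combination hd + Real.sin φ ^ 2 * hk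

/-- A square root of the branch point. -/
def branchRoot (m : ℝ) : ℂ := Real.sqrt (1 - m) + Real.sqrt m * Complex.I

lemma branchRoot_mul_conj {m : ℝ} (hm : 0 < m) (hm1 : m < 1) :
    branchRoot m * (starRingEnd ℂ) (branchRoot m) = 1 := by
  have hk := Real.sq_sqrt (sub_nonneg.2 hm1.le)
  have hk2 := Real.sq_sqrt hm.le
  rw [Complex.mul_conj, Complex.normSq_apply]
  norm_cast
  simp [branchRoot]
  linear_combination hk + hk2

lemma branchRoot_sq {m : ℝ} (hm : 0 < m) (hm1 : m < 1) : branchRoot m ^ 2 = branchPt m := by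
  have hk := Real.sq_sqrt (sub_nonneg.2 hm1.le)
  have hk2 := Real.sq_sqrt hm.le
  rw [branchPt, Real.sqrt_mul hm.le]
  apply Complex.ext
  · simp [branchRoot, sq] at hk hk2 ⊢
    linear_combination hk - hk2
  · simp [branchRoot, sq]
    ring

/-- For unit numbers `v² + u² = uv (v ū + u v̄)`. Applied to `arcRoot` and `branchRoot`, it factors
`y + E` on the unit circle into a real number times a known root. -/
lemma sq_add_sq_of_mul_conj {u v : ℂ} (hu : u * (starRingEnd ℂ) u = 1)
    (hv : v * (starRingEnd ℂ) v = 1) :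
    v ^ 2 + u ^ 2 = (2 * (u * (starRingEnd ℂ) v).re : ℝ) * (u * v) := by
  have h := Complex.add_conj (u * (starRingEnd ℂ) v)
  rw [map_mul, Complex.conj_conj] at h
  rw [← h]
  linear_combination (-v ^ 2) * hu - u ^ 2 * hv

/-- Each principal root lies in the open sector of half angle `π/4`, so the product lies in the
right half plane. This selects the sign of the product of roots from its square. -/
lemma csqrt_mul_re_pos {z w : ℂ} (hz : 0 < z.re) (hw : 0 < w.re) :
    0 < (z ^ (1 / 2 : ℂ) * w ^ (1 / 2 : ℂ)).re := by
  have key : ∀ {z : ℂ}, 0 < z.re → |(z ^ (1 / 2 : ℂ)).im| < (z ^ (1 / 2 : ℂ)).re := by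
    intro z hz
    have h := congrArg Complex.re (csqrt_sq z)
    rw [sq, Complex.mul_re] at h
    exact abs_lt_of_sq_lt_sq (by nlinarith) (csqrt_re_nonneg z)
  have h1 := key hz
  have h2 := key hw
  rw [Complex.mul_re, sub_pos]
  refine (le_abs_self _).trans_lt ?_
  rw [abs_mul]
  exact mul_lt_mul'' h1 h2 (abs_nonneg _) (abs_nonneg _)

lemma eq_of_sq_eq_of_re_pos {z w : ℂ} (h : z ^ 2 = w ^ 2) (hz : 0 < z.re) (hw : 0 < w.re) :
    z = w := by
  rcases sq_eq_sq_iff_eq_or_eq_neg.1 h with h | h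
  · exact h
  · rw [h, Complex.neg_re] at hz
    linarith

lemma sqrt_mul_abs_sin_lt_delta {m : ℝ} (hm : 0 < m) {φ : ℝ} (hφ : Real.cos φ ≠ 0) :
    |Real.sqrt m * Real.sin φ| < delta (1 - m) φ := by
  have hm' : 1 - m < 1 := by linarith
  refine abs_lt_of_sq_lt_sq ?_ (delta_pos hm' φ).le
  rw [delta_sq hm', mul_pow, Real.sq_sqrt hm.le]
  have := Real.sin_sq_add_cos_sq φ
  have : 0 < Real.cos φ ^ 2 := by positivity
  nlinarith

section Arc

variable {m φ : ℝ}

lemma arcRoot_sq_add_branchPt (hm : 0 < m) (hm1 : m < 1) :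
    arcRoot m φ ^ 2 + branchPt m =
      (2 * Real.sqrt (1 - m) * (delta (1 - m) φ - Real.sqrt m * Real.sin φ) : ℝ) *
        (branchRoot m * arcRoot m φ) := by
  rw [← branchRoot_sq hm hm1,
    sq_add_sq_of_mul_conj (branchRoot_mul_conj hm hm1) (norm_arcRoot_sq hm hm1 φ)]
  congr 2
  simp [branchRoot, arcRoot_re, arcRoot_im]
  ring

lemma arcRoot_sq_add_conj_branchPt (hm : 0 < m) (hm1 : m < 1) :
    arcRoot m φ ^ 2 + (starRingEnd ℂ) (branchPt m) =
      (2 * Real.sqrt (1 - m) * (delta (1 - m) φ + Real.sqrt m * Real.sin φ) : ℝ) *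
        ((starRingEnd ℂ) (branchRoot m) * arcRoot m φ) := by
  have hu := branchRoot_mul_conj hm hm1
  rw [← branchRoot_sq hm hm1, map_pow, sq_add_sq_of_mul_conj
    (by rw [Complex.conj_conj, mul_comm, hu]) (norm_arcRoot_sq hm hm1 φ)]
  congr 2
  simp [branchRoot, arcRoot_re, arcRoot_im]
  ring

lemma re_branchRoot_mul_arcRoot (m φ : ℝ) : (branchRoot m * arcRoot m φ).re =
    Real.sqrt (1 - m) * (delta (1 - m) φ + Real.sqrt m * Real.sin φ) := by
  simp [branchRoot, arcRoot_re, arcRoot_im]; ring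

lemma re_conj_branchRoot_mul_arcRoot (m φ : ℝ) :
    ((starRingEnd ℂ) (branchRoot m) * arcRoot m φ).re =
      Real.sqrt (1 - m) * (delta (1 - m) φ - Real.sqrt m * Real.sin φ) := by
  simp [branchRoot, arcRoot_re, arcRoot_im]; ring

lemma arcRoot_re_pos (hm : 0 < m) (φ : ℝ) : 0 < (arcRoot m φ).re := by
  have := delta_pos (show 1 - m < 1 by linarith) φ
  rwa [arcRoot_re]

lemma re_arcRoot_sq_add_pos (hm : 0 < m) (hm1 : m < 1) (hφ : Real.cos φ ≠ 0) :
    0 < (arcRoot m φ ^ 2 + branchPt m).re ∧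
      0 < (arcRoot m φ ^ 2 + (starRingEnd ℂ) (branchPt m)).re := by
  obtain ⟨h1, h2⟩ := abs_lt.1 (sqrt_mul_abs_sin_lt_delta hm hφ)
  have hk := Real.sqrt_pos.2 (sub_pos.2 hm1)
  have h3 : 0 < delta (1 - m) φ - Real.sqrt m * Real.sin φ := by linarith
  have h4 : 0 < delta (1 - m) φ + Real.sqrt m * Real.sin φ := by linarith
  rw [arcRoot_sq_add_branchPt hm hm1, arcRoot_sq_add_conj_branchPt hm hm1,
    Complex.re_ofReal_mul, Complex.re_ofReal_mul, re_branchRoot_mul_arcRoot,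
    re_conj_branchRoot_mul_arcRoot]
  constructor <;> positivity

lemma sq_mem_slitPlane {v : ℂ} (hv : 0 < v.re) : v ^ 2 ∈ Complex.slitPlane := by
  rw [Complex.mem_slitPlane_iff, sq, Complex.mul_re, Complex.mul_im]
  by_cases h : v.im = 0
  · left; rw [h]; nlinarith
  · right
    rw [mul_comm v.im, ← two_mul]
    exact mul_ne_zero two_ne_zero (mul_ne_zero hv.ne' h)

lemma arcRoot_sq_mem_rayDomain (hm : 0 < m) (hm1 : m < 1) (hφ : Real.cos φ ≠ 0) :
    arcRoot m φ ^ 2 ∈ rayDomain m := by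
  obtain ⟨h1, h2⟩ := re_arcRoot_sq_add_pos hm hm1 hφ
  exact ⟨sq_mem_slitPlane (arcRoot_re_pos hm φ), Or.inl h1, Or.inl h2⟩

lemma firstKind_arcRoot_sq (hm : 0 < m) (hm1 : m < 1) (hφ : 0 < Real.cos φ) :
    firstKind m (arcRoot m φ ^ 2) =
      (4 * (Real.sqrt (1 - m) * Real.cos φ : ℝ) * arcRoot m φ ^ 2)⁻¹ := by
  obtain ⟨h1, h2⟩ := re_arcRoot_sq_add_pos hm hm1 hφ.ne'
  have hk := Real.sqrt_pos.2 (sub_pos.2 hm1)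
  have hprod : (arcRoot m φ ^ 2 + branchPt m) ^ (1 / 2 : ℂ) *
      (arcRoot m φ ^ 2 + (starRingEnd ℂ) (branchPt m)) ^ (1 / 2 : ℂ) =
      (2 * (Real.sqrt (1 - m) * Real.cos φ) : ℝ) * arcRoot m φ := by
    refine eq_of_sq_eq_of_re_pos ?_ (csqrt_mul_re_pos h1 h2) ?_
    · rw [mul_pow, csqrt_sq, csqrt_sq, arcRoot_sq_add_branchPt hm hm1,
        arcRoot_sq_add_conj_branchPt hm hm1]
      have hd : ((delta (1 - m) φ : ℝ) : ℂ) ^ 2 - ((Real.sqrt m : ℝ) : ℂ) ^ 2 *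
          ((Real.sin φ : ℝ) : ℂ) ^ 2 = ((Real.cos φ : ℝ) : ℂ) ^ 2 := by
        norm_cast
        rw [delta_sq (by linarith), Real.sq_sqrt hm.le, Real.cos_sq']
        ring
      push_cast at hd ⊢
      linear_combination (4 * (Real.sqrt (1 - m) : ℂ) ^ 2 * arcRoot m φ ^ 2) * hd +
        (4 * (Real.sqrt (1 - m) : ℂ) ^ 2 * arcRoot m φ ^ 2) *
          (((delta (1 - m) φ : ℝ) : ℂ) ^ 2 - ((Real.sqrt m : ℝ) : ℂ) ^ 2 *
          Complex.sin φ ^ 2) * branchRoot_mul_conj hm hm1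
    · rw [Complex.re_ofReal_mul]
      have := arcRoot_re_pos hm φ
      positivity
  rw [firstKind, csqrt_sq_eq (arcRoot_re_pos hm φ), mul_assoc (arcRoot m φ), hprod]
  push_cast
  ring_nf

/-- On the arc `y = arcRoot²` the integrand is real up to the factor `y⁻¹`, and `dy/y` is imaginary,
so the first kind differential becomes the Legendre differential of the complementary parameter `1 -
m`, times `i/2`. -/
lemma hasDerivAt_rayIntegral_arc (hm : 0 < m) (hm1 : m < 1) (hφ : 0 < Real.cos φ) :
    HasDerivAt (fun φ => rayIntegral m (arcRoot m φ ^ 2))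
      (Complex.I / 2 * ((delta (1 - m) φ)⁻¹ : ℝ)) φ := by
  have h := (hasDerivAt_rayIntegral (arcRoot_sq_mem_rayDomain hm hm1 hφ.ne')).comp_of_eq φ
    ((hasDerivAt_arcRoot hm hm1 φ).pow 2) rfl
  refine h.congr_deriv ?_
  rw [firstKind_arcRoot_sq hm hm1 hφ]
  have hk := Real.sqrt_pos.2 (sub_pos.2 hm1)
  have h0 : arcRoot m φ ≠ 0 := fun h => by simpa [h] using arcRoot_re_pos hm φ
  have hd := delta_pos (show 1 - m < 1 by linarith) φ
  have hk' : (Real.sqrt (1 - m) : ℂ) ≠ 0 := by exact_mod_cast hk.ne'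
  have hd' : (delta (1 - m) φ : ℂ) ≠ 0 := by exact_mod_cast hd.ne'
  have hc' : Complex.cos φ ≠ 0 := by exact_mod_cast hφ.ne'
  push_cast
  field_simp
  norm_num

lemma arcRoot_zero (m : ℝ) : arcRoot m 0 = 1 := by simp [arcRoot, delta]

lemma arcRoot_pi_div_two_sq (hm : 0 < m) (hm1 : m < 1) :
    arcRoot m (Real.pi / 2) ^ 2 = -branchPt m := by
  have hd : delta (1 - m) (Real.pi / 2) = Real.sqrt m := by simp [delta]
  rw [eq_neg_iff_add_eq_zero, arcRoot_sq_add_branchPt hm hm1, hd]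
  simp

lemma rayIntegral_arc (hm : 0 < m) (hm1 : m < 1) (hφ : φ ∈ Ico 0 (Real.pi / 2)) :
    rayIntegral m (arcRoot m φ ^ 2) =
      (ellK m / 2 : ℝ) + Complex.I / 2 * (ellF (1 - m) φ : ℝ) := by
  have hcos : ∀ x ∈ Ioo (-(Real.pi / 2)) (Real.pi / 2), 0 < Real.cos x := fun x hx =>
    Real.cos_pos_of_mem_Ioo hx
  have hD : ∀ x ∈ Ioo (-(Real.pi / 2)) (Real.pi / 2), HasDerivAt
      (fun φ => rayIntegral m (arcRoot m φ ^ 2) - Complex.I / 2 * (ellF (1 - m) φ : ℝ)) 0 x := by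
    intro x hx
    have := (hasDerivAt_rayIntegral_arc hm hm1 (hcos x hx)).sub
      (((hasDerivAt_ellF (show 1 - m < 1 by linarith) x).ofReal_comp).const_mul (Complex.I / 2))
    rwa [sub_self] at this
  have h := isOpen_Ioo.is_const_of_deriv_eq_zero isPreconnected_Ioo
    (fun x hx => (hD x hx).differentiableAt.differentiableWithinAt) (fun x hx => (hD x hx).deriv)
    (x := φ) (y := 0) ⟨by linarith [hφ.1, Real.pi_pos], hφ.2⟩
    ⟨by linarith [Real.pi_pos], by linarith [Real.pi_pos]⟩
  have h1 : rayIntegral m 1 = (ellK m / 2 : ℝ) := by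
    rw [← integral_legendreDensity_add_one hm1, ← integral_complex_ofReal]
    refine setIntegral_congr_fun measurableSet_Ioi fun r hr => ?_
    have hr0 : (0 : ℝ) < r := hr
    rw [← firstKind_ofReal hm hm1 (by linarith)]
    push_cast
    rfl
  rw [arcRoot_zero, one_pow, h1, ellF_zero_right] at h
  rw [← sub_eq_iff_eq_add, h]
  simp

end Arc

/-- The limit point `-E` is a branch point, outside `rayDomain`, so continuity is not automatic. The
factor `y + E` has positive real part along the arc, so its modulus on the ray is at least `r`, and
the integrand is dominated by a multiple of `1/(√r (1 + r))`, which is `legendreDensity 0` up to a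
constant. -/
lemma tendsto_rayIntegral_arc {m : ℝ} (hm : 0 < m) (hm1 : m < 1) :
    Tendsto (fun φ => rayIntegral m (arcRoot m φ ^ 2)) (𝓝[<] (Real.pi / 2))
      (𝓝 (rayIntegral m (-branchPt m))) := by
  have hyc : ContinuousAt (fun φ => arcRoot m φ ^ 2) (Real.pi / 2) :=
    ((hasDerivAt_arcRoot hm hm1 _).pow 2).continuousAt
  have hy : Tendsto (fun φ => arcRoot m φ ^ 2) (𝓝[<] (Real.pi / 2)) (𝓝 (-branchPt m)) := by
    rw [← arcRoot_pi_div_two_sq hm hm1]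
    exact hyc.tendsto.mono_left nhdsWithin_le_nhds
  have him : 0 < (branchPt m).im := by
    have := Real.sqrt_pos.2 (mul_pos hm (sub_pos.2 hm1))
    simpa [branchPt] using this
  have hs1 : -branchPt m ∈ Complex.slitPlane := Or.inr (by simpa using him.ne')
  have hs2 : -branchPt m + (starRingEnd ℂ) (branchPt m) ∈ Complex.slitPlane :=
    Or.inr (by simp; linarith)
  obtain ⟨c₁, hc₁, h₁⟩ := eventually_le_norm_add hs1
  obtain ⟨c₂, hc₂, h₂⟩ := eventually_le_norm_add hs2
  have h₁' := hy.eventually h₁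
  have h₂' := (hy.add_const ((starRingEnd ℂ) (branchPt m))).eventually h₂
  have hcos : ∀ᶠ φ in 𝓝[<] (Real.pi / 2), 0 < Real.cos φ := by
    filter_upwards [Ioo_mem_nhdsLT (show -(Real.pi / 2) < Real.pi / 2 by linarith [Real.pi_pos])]
      with φ hφ using Real.cos_pos_of_mem_Ioo hφ
  refine tendsto_integral_filter_of_dominated_convergence
    (fun r => (Real.sqrt (c₁ * c₂))⁻¹ * legendreDensity 0 r) ?_ ?_
    ((integrableOn_legendreDensity zero_lt_one).const_mul _) ?_
  · filter_upwards [hcos] with φ hφ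
    refine ContinuousOn.aestronglyMeasurable ?_ measurableSet_Ioi
    exact (differentiableOn_firstKind m).continuousOn.comp (by fun_prop) fun r hr =>
      add_mem_rayDomain (arcRoot_sq_mem_rayDomain hm hm1 hφ.ne') (le_of_lt hr)
  · filter_upwards [hcos, h₁', h₂'] with φ hφ g₁ g₂
    filter_upwards [ae_restrict_mem measurableSet_Ioi] with r hr
    have hr0 : (0 : ℝ) < r := hr
    have g₁' := g₁ r hr0.le
    have g₂' := g₂ r hr0.le
    have g₃ : r ≤ ‖arcRoot m φ ^ 2 + r + branchPt m‖ := by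
      refine le_trans ?_ (Complex.re_le_norm _)
      have := (re_arcRoot_sq_add_pos hm hm1 hφ.ne').1
      simp only [Complex.add_re, Complex.ofReal_re] at this ⊢
      linarith
    rw [add_right_comm] at g₂'
    have : (Real.sqrt (c₁ * c₂))⁻¹ * legendreDensity 0 r =
        (2 * Real.sqrt ((c₁ * (1 + r)) * r * (c₂ * (1 + r))))⁻¹ := by
      rw [legendreDensity, ← mul_inv, ← Real.sqrt_mul hr0.le, mul_left_comm,
        ← Real.sqrt_mul (by positivity)]
      ring_nf
    rw [this, norm_firstKind]
    have p : ∀ {c : ℝ}, 0 < c → 0 < c * (1 + r) := fun hc => mul_pos hc (by linarith)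
    have := p hc₁; have := p hc₂
    gcongr
  · filter_upwards [ae_restrict_mem measurableSet_Ioi] with r hr
    have hr0 : (0 : ℝ) < r := hr
    have hmem : -branchPt m + r ∈ rayDomain m := by
      refine ⟨add_ofReal_mem_slitPlane hs1 hr0.le, ?_, ?_⟩
      · rw [neg_add_cancel_comm]
        exact Or.inl (by simpa using hr0)
      · rw [add_right_comm]; exact add_ofReal_mem_slitPlane hs2 hr0.le
    exact (((differentiableOn_firstKind m).differentiableAt
      ((isOpen_rayDomain m).mem_nhds hmem)).continuousAt.tendsto).comp (hy.add_const (r : ℂ))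

lemma rayIntegral_neg_branchPt {m : ℝ} (hm : 0 < m) (hm1 : m < 1) :
    rayIntegral m (-branchPt m) = (ellK m / 2 : ℝ) + Complex.I / 2 * (ellK (1 - m) : ℝ) := by
  refine tendsto_nhds_unique (tendsto_rayIntegral_arc hm hm1) ?_
  have hc : ContinuousAt (fun φ => ((ellK m / 2 : ℝ) : ℂ) + Complex.I / 2 * (ellF (1 - m) φ : ℝ))
      (Real.pi / 2) :=
    (((hasDerivAt_ellF (show 1 - m < 1 by linarith) _).ofReal_comp).const_mul
      (Complex.I / 2)).continuousAt.const_add _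
  refine (hc.tendsto.mono_left nhdsWithin_le_nhds).congr' ?_
  filter_upwards [Ico_mem_nhdsLT (show (0 : ℝ) < Real.pi / 2 by linarith [Real.pi_pos])] with φ hφ
  exact (rayIntegral_arc hm hm1 hφ).symm

/-- `ω'' = (K(m) + i K(1 - m)) / 2`. -/
theorem ω''_eq {a : ℝ} (ha : a ∈ Ioc (-4 : ℝ) 0) :
    ω'' a = (ellK (ellParam a) / 2 : ℝ) + (ellK (1 - ellParam a) / 2 : ℝ) * Complex.I := by
  obtain ⟨h0, h1⟩ := ellParam_mem ha
  have h1' : ellParam a < 1 := by linarith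
  have h := rayIntegral_neg_branchPt h0 h1'
  rw [ω'', halfPeriod]
  rw [show ((ellK (ellParam a) / 2 : ℝ) : ℂ) + (ellK (1 - ellParam a) / 2 : ℝ) * Complex.I =
    (ellK (ellParam a) / 2 : ℝ) + Complex.I / 2 * (ellK (1 - ellParam a) : ℝ) by push_cast; ring,
    ← h, rayIntegral]
  refine setIntegral_congr_fun measurableSet_Ioi fun r hr => ?_
  have h2 := e₁_sub_e₃ a
  have h3 := e₁_sub_e₂ a
  rw [firstKind, ← h3, ← h2, one_div]
  ring_nf

end

noncomputable section

/-! ### Half periods of a general lattice -/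

section HalfPeriod

variable (Λ : PeriodPair)

lemma isPreconnected_compl_lattice : IsPreconnected ((Λ.lattice : Set ℂ)ᶜ) := by
  have hc : (Λ.lattice : Set ℂ).Countable :=
    Set.countable_coe_iff.1 (Λ.latticeEquivProd.toEquiv.injective.countable)
  exact (hc.isConnected_compl_of_one_lt_rank
    (by rw [Complex.rank_real_complex]; norm_num)).isPreconnected

lemma isOpen_compl_lattice : IsOpen ((Λ.lattice : Set ℂ)ᶜ) := Λ.isClosed_lattice.isOpen_compl

lemma hasDerivAt_weierstrassP {u : ℂ} (hu : u ∉ Λ.lattice) :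
    HasDerivAt Λ.weierstrassP (Λ.derivWeierstrassP u) u := by
  have h := (Λ.analyticOnNhd_weierstrassP u hu).differentiableAt.hasDerivAt
  rwa [Λ.deriv_weierstrassP] at h

lemma tendsto_sq_mul_weierstrassP :
    Tendsto (fun u => u ^ 2 * Λ.weierstrassP u) (𝓝[≠] 0) (𝓝 1) := by
  have h : ContinuousAt (fun u : ℂ => u ^ 2 * Λ.weierstrassPExcept 0 u + 1) 0 := by
    have := (Λ.analyticAt_weierstrassPExcept 0).continuousAt
    fun_prop
  have h' := h.tendsto.mono_left (nhdsWithin_le_nhds (s := {0}ᶜ))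
  simp only [ne_eq, OfNat.ofNat_ne_zero, not_false_eq_true, zero_pow, zero_mul, zero_add] at h'
  refine h'.congr' ?_
  filter_upwards [self_mem_nhdsWithin] with u (hu : u ≠ 0)
  have := Λ.weierstrassPExcept_add 0 u
  simp only [ZeroMemClass.coe_zero, sub_zero] at this
  rw [← this]
  field_simp
  ring

lemma compl_lattice_mem_nhdsNE (l : ℂ) : ∀ᶠ u in 𝓝[≠] l, u ∉ Λ.lattice := by
  filter_upwards [self_mem_nhdsWithin,
    mem_nhdsWithin_of_mem_nhds (Λ.compl_lattice_sdiff_singleton_mem_nhds l)] with w hw hw' h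
  exact hw' ⟨h, hw⟩

lemma not_eventually_weierstrassP_eq (e : ℂ) : ¬ ∀ᶠ u in 𝓝[≠] 0, Λ.weierstrassP u = e := by
  intro h
  have h1 : Tendsto (fun u : ℂ => u ^ 2 * e) (𝓝[≠] 0) (𝓝 0) := by
    have : ContinuousAt (fun u : ℂ => u ^ 2 * e) 0 := by fun_prop
    simpa using this.tendsto.mono_left (nhdsWithin_le_nhds (s := {0}ᶜ))
  have h2 : Tendsto (fun u : ℂ => u ^ 2 * e) (𝓝[≠] 0) (𝓝 1) := by
    refine (tendsto_sq_mul_weierstrassP Λ).congr' ?_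
    filter_upwards [h] with u hu
    rw [hu]
  exact zero_ne_one (tendsto_nhds_unique h1 h2)

lemma not_eqOn_derivWeierstrassP_zero :
    ¬ EqOn Λ.derivWeierstrassP 0 ((Λ.lattice : Set ℂ)ᶜ) := by
  intro h
  have hmem : Λ.ω₁ / 2 ∈ ((Λ.lattice : Set ℂ)ᶜ) := Λ.ω₁_div_two_notMem_lattice
  refine not_eventually_weierstrassP_eq Λ (Λ.weierstrassP (Λ.ω₁ / 2))
    ((compl_lattice_mem_nhdsNE Λ 0).mono fun u hu => ?_)
  exact (isOpen_compl_lattice Λ).is_const_of_deriv_eq_zero (isPreconnected_compl_lattice Λ)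
    Λ.differentiableOn_weierstrassP (by rwa [Λ.deriv_weierstrassP]) hu hmem

/-- `℘'' = 6 ℘² - g₂ / 2`. -/
lemma hasDerivAt_derivWeierstrassP {u : ℂ} (hu : u ∉ Λ.lattice) :
    HasDerivAt Λ.derivWeierstrassP (6 * Λ.weierstrassP u ^ 2 - Λ.g₂ / 2) u := by
  have hA := Λ.analyticOnNhd_derivWeierstrassP
  have hB := Λ.analyticOnNhd_weierstrassP
  have hd := (hA u hu).differentiableAt.hasDerivAt
  have hprod : ∀ z ∈ ((Λ.lattice : Set ℂ)ᶜ), Λ.derivWeierstrassP z *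
      (deriv Λ.derivWeierstrassP z - (6 * Λ.weierstrassP z ^ 2 - Λ.g₂ / 2)) = 0 := by
    intro z hz
    have h1 := ((hA z hz).differentiableAt.hasDerivAt).pow 2
    have h2 := ((((hasDerivAt_weierstrassP Λ hz).pow 3).const_mul 4).sub
      ((hasDerivAt_weierstrassP Λ hz).const_mul Λ.g₂)).sub_const Λ.g₃
    have h3 := (h1.congr_of_eventuallyEq (by
      filter_upwards [(isOpen_compl_lattice Λ).mem_nhds hz] with w hw
      exact (Λ.derivWeierstrassP_sq w hw).symm)).unique h2
    push_cast at h3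
    linear_combination h3 / 2
  have hC : AnalyticOnNhd ℂ (fun z => deriv Λ.derivWeierstrassP z -
      (6 * Λ.weierstrassP z ^ 2 - Λ.g₂ / 2)) ((Λ.lattice : Set ℂ)ᶜ) := fun z hz => by
    have h1 := (hA z hz).deriv
    have h2 := hB z hz
    fun_prop
  rcases AnalyticOnNhd.eq_zero_or_eq_zero_of_mul_eq_zero hA hC hprod
    (isPreconnected_compl_lattice Λ) with h | h
  · exact absurd h (not_eqOn_derivWeierstrassP_zero Λ)
  · rw [sub_eq_zero.1 (h u hu)] at hd
    exact hd

variable {Λ} {w : ℂ}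

lemma derivWeierstrassP_half (hw2 : 2 * w ∈ Λ.lattice) :
    Λ.derivWeierstrassP w = 0 := by
  have h := Λ.derivWeierstrassP_add_coe (-w) ⟨2 * w, hw2⟩
  simp only [show -w + 2 * w = w by ring, Λ.derivWeierstrassP_neg] at h
  linear_combination h / 2

/-- At a half period `℘'` vanishes, so the limit is `℘''(w)/2`. The divided slope `dslope` makes the
second order expansion rigorous. -/
lemma tendsto_weierstrassP_half (hw : w ∉ Λ.lattice) (hw2 : 2 * w ∈ Λ.lattice) :
    Tendsto (fun u => (Λ.weierstrassP (u + w) - Λ.weierstrassP w) / u ^ 2) (𝓝[≠] 0)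
      (𝓝 (3 * Λ.weierstrassP w ^ 2 - Λ.g₂ / 4)) := by
  set f := Λ.weierstrassP with hf
  set g := dslope f w with hg
  have hfd : DifferentiableOn ℂ f ((Λ.lattice : Set ℂ)ᶜ) := Λ.differentiableOn_weierstrassP
  have hnhds : ((Λ.lattice : Set ℂ)ᶜ) ∈ 𝓝 w := (isOpen_compl_lattice Λ).mem_nhds hw
  have hgd : DifferentiableOn ℂ g ((Λ.lattice : Set ℂ)ᶜ) :=
    (Complex.differentiableOn_dslope hnhds).2 hfd
  have hga : AnalyticAt ℂ g w := hgd.analyticAt hnhds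
  have hgw : g w = 0 := by
    rw [hg, dslope_same, hf, Λ.deriv_weierstrassP, derivWeierstrassP_half hw2]
  have hfg : ∀ z, f z = f w + (z - w) * g z := fun z => by
    have := sub_smul_dslope f w z
    rw [smul_eq_mul] at this
    rw [hg, this]; ring
  have hder : deriv g w = 3 * f w ^ 2 - Λ.g₂ / 4 := by
    have h1 : HasDerivAt (fun z => g z + (z - w) * deriv g z)
        (deriv g w + (1 * deriv g w + (w - w) * deriv (deriv g) w)) w :=
      hga.differentiableAt.hasDerivAt.add
        (((hasDerivAt_id w).sub_const w).mul hga.deriv.differentiableAt.hasDerivAt)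
    have h2 := (hasDerivAt_derivWeierstrassP Λ hw).congr_of_eventuallyEq (f₁ := fun z =>
        g z + (z - w) * deriv g z) (by
      filter_upwards [hnhds] with z hz
      refine HasDerivAt.unique (f := f) (x := z) ?_ (hasDerivAt_weierstrassP Λ hz)
      have := (((hasDerivAt_id z).sub_const w).mul
        (hgd.differentiableAt ((isOpen_compl_lattice Λ).mem_nhds hz)).hasDerivAt).const_add (f w)
      refine (this.congr_of_eventuallyEq (Eventually.of_forall fun y => hfg y)).congr_deriv ?_
      simp)
    have h3 := h1.unique h2
    linear_combination h3 / 2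
  have h1 : Tendsto (slope g w) (𝓝[≠] w) (𝓝 (deriv g w)) :=
    hasDerivAt_iff_tendsto_slope.1 hga.differentiableAt.hasDerivAt
  rw [hder] at h1
  have hmap : Tendsto (fun u : ℂ => u + w) (𝓝[≠] 0) (𝓝[≠] w) := by
    refine tendsto_nhdsWithin_iff.2 ⟨?_, ?_⟩
    · have : Tendsto (fun u : ℂ => u + w) (𝓝 0) (𝓝 (0 + w)) :=
        (continuous_id.add continuous_const).tendsto 0
      rw [zero_add] at this
      exact this.mono_left nhdsWithin_le_nhds
    · filter_upwards [self_mem_nhdsWithin] with u hu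
      simpa using hu
  refine (h1.comp hmap).congr' ?_
  filter_upwards [self_mem_nhdsWithin] with u (hu : u ≠ 0)
  simp only [Function.comp_apply, slope_def_field, hgw, hfg (u + w), add_sub_cancel_right,
    sub_zero, add_sub_cancel_left]
  field_simp

/-- Translation by a half period acts on `℘ - ℘(w)` by inversion. -/
theorem weierstrassP_sub_mul_half (hw : w ∉ Λ.lattice) (hw2 : 2 * w ∈ Λ.lattice) {u : ℂ}
    (hu : u ∉ Λ.lattice) (huw : u + w ∉ Λ.lattice) :
    (Λ.weierstrassP u - Λ.weierstrassP w) * (Λ.weierstrassP (u + w) - Λ.weierstrassP w) =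
      3 * Λ.weierstrassP w ^ 2 - Λ.g₂ / 4 := by
  classical
  set e := Λ.weierstrassP w
  set C := 3 * e ^ 2 - Λ.g₂ / 4 with hC
  set F : ℂ → ℂ := fun u => (Λ.weierstrassP u - e) * (Λ.weierstrassP (u + w) - e) with hF
  -- The double pole of one factor meets the double zero of the other, so `F` has removable
  -- singularities; `C` is the limit at `0`. The patched function is periodic and entire, hence
  -- bounded and constant.
  set G : ℂ → ℂ := fun u => if u ∈ Λ.lattice ∨ u + w ∈ Λ.lattice then C else F u with hG
  have hper : ∀ z l, l ∈ Λ.lattice → G (z + l) = G z := by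
    intro z l hl
    have h1 : z + l ∈ Λ.lattice ↔ z ∈ Λ.lattice := Λ.lattice.add_mem_iff_left hl
    have h2 : z + l + w ∈ Λ.lattice ↔ z + w ∈ Λ.lattice := by
      rw [add_right_comm]; exact Λ.lattice.add_mem_iff_left hl
    have h3 := Λ.weierstrassP_add_coe z ⟨l, hl⟩
    have h4 := Λ.weierstrassP_add_coe (z + w) ⟨l, hl⟩
    rw [add_right_comm] at h4
    simp only [hG, hF, h1, h2, h3, h4]
  have hperw : ∀ z, G (z + w) = G z := by
    intro z
    have h1 : z + w + w ∈ Λ.lattice ↔ z ∈ Λ.lattice := by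
      rw [add_assoc, ← two_mul]; exact Λ.lattice.add_mem_iff_left hw2
    have h3 := Λ.weierstrassP_add_coe z ⟨2 * w, hw2⟩
    simp only [two_mul, ← add_assoc] at h3
    simp only [hG, hF, h1, h3, or_comm (a := z + w ∈ Λ.lattice)]
    rw [mul_comm]
  have hlim : Tendsto F (𝓝[≠] 0) (𝓝 C) := by
    have h1 : Tendsto (fun u : ℂ => u ^ 2 * Λ.weierstrassP u - u ^ 2 * e) (𝓝[≠] 0) (𝓝 1) := by
      have h2 : Tendsto (fun u : ℂ => u ^ 2 * e) (𝓝[≠] 0) (𝓝 0) := by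
        have : ContinuousAt (fun u : ℂ => u ^ 2 * e) 0 := by fun_prop
        simpa using this.tendsto.mono_left (nhdsWithin_le_nhds (s := {0}ᶜ))
      simpa using (tendsto_sq_mul_weierstrassP Λ).sub h2
    have h2 := h1.mul (tendsto_weierstrassP_half hw hw2)
    rw [one_mul] at h2
    refine h2.congr' ?_
    filter_upwards [self_mem_nhdsWithin] with u (hu : u ≠ 0)
    simp only [hF]
    field_simp
    rfl
  have hdiff0 : ∀ z, z ∉ Λ.lattice → z + w ∉ Λ.lattice → DifferentiableAt ℂ G z := by
    intro z hz hzw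
    have h1 := (hasDerivAt_weierstrassP Λ hz).differentiableAt
    have h2 := ((hasDerivAt_weierstrassP Λ hzw).comp_add_const z w).differentiableAt
    refine ((h1.sub_const e).mul (h2.sub_const e)).congr_of_eventuallyEq ?_
    filter_upwards [(isOpen_compl_lattice Λ).mem_nhds hz,
      ((isOpen_compl_lattice Λ).preimage (continuous_id.add continuous_const)).mem_nhds hzw]
      with y h3 h4
    simp only [hG]
    exact if_neg (not_or.2 ⟨h3, h4⟩)
  have hat0 : DifferentiableAt ℂ G 0 := by
    have hev : ∀ᶠ u in 𝓝[≠] (0 : ℂ), u ∉ Λ.lattice ∧ u + w ∉ Λ.lattice := by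
      refine (compl_lattice_mem_nhdsNE Λ 0).and (mem_nhdsWithin_of_mem_nhds ?_)
      refine ((isOpen_compl_lattice Λ).preimage (continuous_id.add continuous_const)).mem_nhds ?_
      simpa using hw
    refine (Complex.analyticAt_of_differentiable_on_punctured_nhds_of_continuousAt
      (hev.mono fun z hz => hdiff0 z hz.1 hz.2) ?_).differentiableAt
    rw [continuousAt_iff_punctured_nhds]
    have h0 : G 0 = C := if_pos (Or.inl (zero_mem _))
    rw [h0]
    refine hlim.congr' ?_
    filter_upwards [hev] with z hz
    simp only [hG]
    exact (if_neg (not_or.2 hz)).symm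
  -- Every exceptional point is itself a period of `G`, either a lattice point or one minus `w`, so
  -- it suffices to remove the singularity at `0`.
  have htrans : ∀ c, (∀ z, G (z + c) = G z) → DifferentiableAt ℂ G c := by
    intro c hc
    have h0 : DifferentiableAt ℂ G (c - c) := by rwa [sub_self]
    have h1 : DifferentiableAt ℂ (fun z => G (z - c)) c :=
      (h0.hasDerivAt.comp_sub_const c c).differentiableAt
    convert h1 using 2 with z
    rw [← hc (z - c), sub_add_cancel]
  have hdiff : Differentiable ℂ G := by
    intro z
    by_cases h1 : z ∈ Λ.lattice
    · exact htrans z fun y => hper y z h1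
    by_cases h2 : z + w ∈ Λ.lattice
    · refine htrans z fun y => ?_
      have h3 : G (y + (z + w)) = G y := hper y _ h2
      rw [← add_assoc, hperw] at h3
      exact h3
    · exact hdiff0 z h1 h2
  have hconst := hdiff.apply_eq_apply_of_bounded (IsZLattice.isCompact_range_of_periodic
    Λ.lattice _ hdiff.continuous hper).isBounded u 0
  have h0 : G 0 = C := if_pos (Or.inl (zero_mem _))
  have hu' : G u = F u := if_neg (not_or.2 ⟨hu, huw⟩)
  rw [h0, hu'] at hconst
  exact hconst

/-- If the constant vanished, one of two analytic factors would vanish identically on a connected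
set, making `℘` constant near its pole. -/
lemma weierstrassP_half_ne_zero (hw : w ∉ Λ.lattice) (hw2 : 2 * w ∈ Λ.lattice) :
    3 * Λ.weierstrassP w ^ 2 - Λ.g₂ / 4 ≠ 0 := by
  intro h0
  set U : Set ℂ := ((Λ.lattice : Set ℂ) ∪ (fun u => u + w) ⁻¹' Λ.lattice)ᶜ with hU
  have hc : (Λ.lattice : Set ℂ).Countable :=
    Set.countable_coe_iff.1 (Λ.latticeEquivProd.toEquiv.injective.countable)
  have hpre : IsPreconnected U :=
    ((hc.union (hc.preimage (add_left_injective w))).isConnected_compl_of_one_lt_rank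
      (by rw [Complex.rank_real_complex]; norm_num)).isPreconnected
  have hmem : ∀ u, u ∈ U ↔ u ∉ Λ.lattice ∧ u + w ∉ Λ.lattice := fun u => by
    simp [hU]
  have hA : AnalyticOnNhd ℂ (fun u => Λ.weierstrassP u - Λ.weierstrassP w) U := fun u hu =>
    (Λ.analyticOnNhd_weierstrassP u ((hmem u).1 hu).1).sub analyticAt_const
  have hB : AnalyticOnNhd ℂ (fun u => Λ.weierstrassP (u + w) - Λ.weierstrassP w) U :=
    fun u hu => ((Λ.analyticOnNhd_weierstrassP (u + w) ((hmem u).1 hu).2).comp_of_eq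
      (analyticAt_id.add analyticAt_const) rfl).sub analyticAt_const
  rcases AnalyticOnNhd.eq_zero_or_eq_zero_of_mul_eq_zero hA hB (fun u hu => by
    rw [weierstrassP_sub_mul_half hw hw2 ((hmem u).1 hu).1 ((hmem u).1 hu).2, h0]) hpre with h | h
  · refine not_eventually_weierstrassP_eq Λ (Λ.weierstrassP w) ?_
    filter_upwards [compl_lattice_mem_nhdsNE Λ 0, mem_nhdsWithin_of_mem_nhds
      (((isOpen_compl_lattice Λ).preimage (by fun_prop : Continuous fun u => u + w)).mem_nhds
        (show (0 : ℂ) ∈ _ by simpa using hw))] with u h1 h2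
    exact sub_eq_zero.1 (h u ((hmem u).2 ⟨h1, h2⟩))
  · refine not_eventually_weierstrassP_eq Λ (Λ.weierstrassP w) ?_
    filter_upwards [compl_lattice_mem_nhdsNE Λ 0, mem_nhdsWithin_of_mem_nhds
      (((isOpen_compl_lattice Λ).preimage (by fun_prop : Continuous fun u => u - w)).mem_nhds
        (show (0 : ℂ) ∈ _ by simpa using hw))] with u h1 h2
    have := h (u - w) ((hmem _).2 ⟨h2, by simpa using h1⟩)
    rw [sub_add_cancel] at this
    exact sub_eq_zero.1 this

lemma derivWeierstrassP_sq_half (hw : w ∉ Λ.lattice) (hw2 : 2 * w ∈ Λ.lattice) {u : ℂ}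
    (hu : u ∉ Λ.lattice) :
    Λ.derivWeierstrassP u ^ 2 = 4 * (Λ.weierstrassP u - Λ.weierstrassP w) *
      ((Λ.weierstrassP u - Λ.weierstrassP w) ^ 2 +
        3 * Λ.weierstrassP w * (Λ.weierstrassP u - Λ.weierstrassP w) +
        (3 * Λ.weierstrassP w ^ 2 - Λ.g₂ / 4)) := by
  have h1 := Λ.derivWeierstrassP_sq w hw
  rw [derivWeierstrassP_half hw2] at h1
  rw [Λ.derivWeierstrassP_sq u hu]
  linear_combination -h1

end HalfPeriod

end

noncomputable section

/-! ### The real periods of `r'² = 4 r (r² + (2 - 4m) c² r + c⁴)` -/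

/-- Separation of variables: a positive solution has nonvanishing, hence one-signed, derivative, and
coming from `∞` it must decrease. Then `legendreT (r/c²) + c u` is constant, and comparing its
limits at the two ends gives the period. -/
lemma neg_and_mul_eq_ellK_of_ode {r r' : ℝ → ℝ} {ℓ c m : ℝ} (hℓ : 0 < ℓ) (hc : 0 < c) (hm : m < 1)
    (hr : ∀ u ∈ Ioo 0 ℓ, HasDerivAt r (r' u) u) (hpos : ∀ u ∈ Ioo 0 ℓ, 0 < r u)
    (hode : ∀ u ∈ Ioo 0 ℓ, r' u ^ 2 = 4 * r u * (r u ^ 2 + (2 - 4 * m) * c ^ 2 * r u + c ^ 4))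
    (h0 : Tendsto r (𝓝[>] 0) atTop) (h1 : Tendsto r (𝓝[<] ℓ) (𝓝 0)) :
    (∀ u ∈ Ioo 0 ℓ, r' u < 0) ∧ c * ℓ = ellK m := by
  have hquad : ∀ u ∈ Ioo 0 ℓ, r u ^ 2 + (2 - 4 * m) * c ^ 2 * r u + c ^ 4 =
      c ^ 4 * ((r u / c ^ 2) ^ 2 + (2 - 4 * m) * (r u / c ^ 2) + 1) := fun u hu => by
    field_simp
  have hne : ∀ u ∈ Ioo 0 ℓ, r' u ≠ 0 := fun u hu h => by
    have h2 := hode u hu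
    have h3 := hpos u hu
    have h4 := quadratic_pos hm (show 0 ≤ r u / c ^ 2 by positivity)
    rw [h, hquad u hu] at h2
    have : 0 < 4 * r u * (c ^ 4 * ((r u / c ^ 2) ^ 2 + (2 - 4 * m) * (r u / c ^ 2) + 1)) := by
      positivity
    simp only [ne_eq, OfNat.ofNat_ne_zero, not_false_eq_true, zero_pow] at h2
    linarith
  have hneg : ∀ u ∈ Ioo 0 ℓ, r' u < 0 := by
    rcases hasDerivWithinAt_forall_lt_or_forall_gt_of_forall_ne (convex_Ioo 0 ℓ)
      (fun u hu => (hr u hu).hasDerivWithinAt) hne with h | h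
    · exact h
    · exfalso
      have hmono : StrictMonoOn r (Ioo 0 ℓ) := by
        refine strictMonoOn_of_deriv_pos (convex_Ioo 0 ℓ)
          (fun u hu => (hr u hu).continuousAt.continuousWithinAt) fun u hu => ?_
        rw [interior_Ioo] at hu
        rw [(hr u hu).deriv]
        exact h u hu
      obtain ⟨u, hu1, hu2⟩ := ((h0.eventually_gt_atTop (r (ℓ / 2))).and
        (Ioo_mem_nhdsGT (half_pos hℓ))).exists
      exact absurd (hmono ⟨hu2.1, by linarith [hu2.2]⟩ ⟨by linarith, by linarith⟩ hu2.2)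
        (not_lt.2 hu1.le)
  refine ⟨hneg, ?_⟩
  have hD : ∀ u ∈ Ioo 0 ℓ, HasDerivAt (fun u => legendreT m (r u / c ^ 2) + c * u) 0 u := by
    intro u hu
    have h3 := hpos u hu
    have hx : 0 < r u / c ^ 2 := by positivity
    have h4 := quadratic_pos hm hx.le
    refine (((hasDerivAt_legendreT hm hx).comp u ((hr u hu).div_const _)).add
      ((hasDerivAt_id u).const_mul c)).congr_deriv ?_
    set x := r u / c ^ 2 with hxdef
    set y := x ^ 2 + (2 - 4 * m) * x + 1 with hy
    have hrx : r u = c ^ 2 * x := by rw [hxdef]; field_simp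
    have hr' : r' u = -(2 * c ^ 3 * (Real.sqrt x * Real.sqrt y)) := by
      have h5 : r' u ^ 2 = (2 * c ^ 3 * (Real.sqrt x * Real.sqrt y)) ^ 2 := by
        rw [mul_pow, mul_pow (Real.sqrt x), Real.sq_sqrt hx.le, Real.sq_sqrt h4.le, hode u hu,
          hquad u hu, ← hxdef, ← hy, hrx]
        ring
      rcases sq_eq_sq_iff_eq_or_eq_neg.1 h5 with h6 | h6
      · have := hneg u hu
        have : 0 ≤ 2 * c ^ 3 * (Real.sqrt x * Real.sqrt y) := by positivity
        linarith
      · exact h6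
    have hsx := Real.sqrt_pos.2 hx
    have hsy := Real.sqrt_pos.2 h4
    rw [hr', legendreDensity, ← hy]
    field_simp
    ring
  have hconst : ∀ u ∈ Ioo 0 ℓ, legendreT m (r u / c ^ 2) + c * u =
      legendreT m (r (ℓ / 2) / c ^ 2) + c * (ℓ / 2) := fun u hu =>
    isOpen_Ioo.is_const_of_deriv_eq_zero isPreconnected_Ioo
      (fun x hx => (hD x hx).differentiableAt.differentiableWithinAt) (fun x hx => (hD x hx).deriv)
      hu ⟨by linarith, by linarith⟩
  have hid : ∀ (a : ℝ) (s : Set ℝ), Tendsto (fun u => c * u) (𝓝[s] a) (𝓝 (c * a)) := fun a s =>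
    ((continuous_const.mul continuous_id).tendsto a).mono_left nhdsWithin_le_nhds
  have hl0 : Tendsto (fun u => legendreT m (r u / c ^ 2) + c * u) (𝓝[>] 0) (𝓝 (ellK m + c * 0)) :=
    ((tendsto_legendreT hm).comp (h0.atTop_div_const (by positivity))).add (hid 0 _)
  have hl1 : Tendsto (fun u => legendreT m (r u / c ^ 2) + c * u) (𝓝[<] ℓ)
      (𝓝 (legendreT m (0 / c ^ 2) + c * ℓ)) :=
    (((continuous_legendreT hm).tendsto _).comp (h1.div_const _)).add (hid ℓ _)
  have e0 := tendsto_nhds_unique (hl0.congr' (by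
    filter_upwards [Ioo_mem_nhdsGT hℓ] with u hu using hconst u hu)) tendsto_const_nhds
  have e1 := tendsto_nhds_unique (hl1.congr' (by
    filter_upwards [Ioo_mem_nhdsLT hℓ] with u hu using hconst u hu)) tendsto_const_nhds
  rw [zero_div, legendreT_zero] at e1
  linarith

/-! ### Rhombic lattices -/

/-- The lattice with periods `2p` and `p + iq`. -/
def rhombicLattice {p q : ℝ} (hp : 0 < p) (hq : 0 < q) : PeriodPair where
  ω₁ := 2 * p
  ω₂ := p + q * Complex.I
  indep := by
    rw [LinearIndependent.pair_iff]
    intro s t h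
    have h1 := congrArg Complex.re h
    have h2 := congrArg Complex.im h
    simp at h1 h2
    have ht : t = 0 := h2.resolve_right hq.ne'
    rw [ht, zero_mul, add_zero] at h1
    exact ⟨by simpa [hp.ne'] using h1, ht⟩

section Rhombic

variable {p q : ℝ} (hp : 0 < p) (hq : 0 < q)

lemma mem_rhombicLattice {z : ℂ} : z ∈ (rhombicLattice hp hq).lattice ↔
    ∃ m n : ℤ, z.re = (2 * m + n) * p ∧ z.im = n * q := by
  rw [PeriodPair.mem_lattice]
  refine exists_congr fun m => exists_congr fun n => ?_
  rw [eq_comm, Complex.ext_iff]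
  simp [rhombicLattice]
  intro _
  ring_nf

lemma notMem_rhombicLattice_of_im {z : ℂ} (h0 : 0 < z.im) (h1 : z.im < q) :
    z ∉ (rhombicLattice hp hq).lattice := by
  rw [mem_rhombicLattice]
  rintro ⟨m, n, -, h⟩
  rw [h] at h0 h1
  have h2 : (0 : ℝ) < n := pos_of_mul_pos_left h0 hq.le
  have h3 : (n : ℝ) < 1 := by nlinarith
  have h4 : 0 < n := by exact_mod_cast h2
  have h5 : n < 1 := by exact_mod_cast h3
  omega

lemma notMem_rhombicLattice_of_re {x : ℝ} (h0 : 0 < x) (h1 : x < 2 * p) :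
    (x : ℂ) ∉ (rhombicLattice hp hq).lattice := by
  rw [mem_rhombicLattice]
  rintro ⟨m, n, h, h'⟩
  have hn : (n : ℝ) = 0 := by
    have : (n : ℝ) * q = 0 := by rw [← h', Complex.ofReal_im]
    simpa [hq.ne'] using this
  rw [hn, add_zero, Complex.ofReal_re] at h
  rw [h] at h0 h1
  have h2 : (0 : ℝ) < m := by
    have := pos_of_mul_pos_left h0 hp.le
    linarith
  have h3 : (m : ℝ) < 1 := by nlinarith
  have h4 : 0 < m := by exact_mod_cast h2
  have h5 : m < 1 := by exact_mod_cast h3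
  omega

lemma two_p_mem : (2 * p : ℂ) ∈ (rhombicLattice hp hq).lattice :=
  (rhombicLattice hp hq).ω₁_mem_lattice

lemma p_add_q_mem : (p + q * Complex.I : ℂ) ∈ (rhombicLattice hp hq).lattice :=
  (rhombicLattice hp hq).ω₂_mem_lattice

lemma p_notMem : (p : ℂ) ∉ (rhombicLattice hp hq).lattice :=
  notMem_rhombicLattice_of_re hp hq hp (by linarith)

lemma q_notMem : (q * Complex.I : ℂ) ∉ (rhombicLattice hp hq).lattice := fun h =>
  p_notMem hp hq (by simpa using sub_mem (p_add_q_mem hp hq) h)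

lemma conj_mem_rhombicLattice {z : ℂ} : (starRingEnd ℂ) z ∈ (rhombicLattice hp hq).lattice ↔
    z ∈ (rhombicLattice hp hq).lattice := by
  have key : ∀ z, z ∈ (rhombicLattice hp hq).lattice →
      (starRingEnd ℂ) z ∈ (rhombicLattice hp hq).lattice := by
    intro z
    simp only [mem_rhombicLattice]
    rintro ⟨m, n, h1, h2⟩
    refine ⟨m + n, -n, ?_, ?_⟩
    · rw [Complex.conj_re, h1]; push_cast; ring
    · rw [Complex.conj_im, h2]; push_cast; ring
  exact ⟨fun h => by simpa using key _ h, key z⟩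

/-- Complex conjugation on a rhombic lattice. -/
def conjLattice : (rhombicLattice hp hq).lattice ≃ (rhombicLattice hp hq).lattice :=
  (Complex.conjAe.toEquiv).subtypeEquiv fun _ => (conj_mem_rhombicLattice hp hq).symm

lemma conj_tsum_rhombicLattice (f : ℂ → ℂ) :
    (starRingEnd ℂ) (∑' l : (rhombicLattice hp hq).lattice, f l) =
      ∑' l : (rhombicLattice hp hq).lattice, (starRingEnd ℂ) (f ((starRingEnd ℂ) l)) := by
  rw [Complex.conj_tsum, ← (conjLattice hp hq).tsum_eq]
  rfl

lemma weierstrassP_conj (z : ℂ) : (rhombicLattice hp hq).weierstrassP ((starRingEnd ℂ) z) =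
    (starRingEnd ℂ) ((rhombicLattice hp hq).weierstrassP z) := by
  rw [PeriodPair.weierstrassP, PeriodPair.weierstrassP,
    conj_tsum_rhombicLattice hp hq fun l => 1 / (z - l) ^ 2 - 1 / l ^ 2]
  simp

lemma conj_g₂ : (starRingEnd ℂ) (rhombicLattice hp hq).g₂ = (rhombicLattice hp hq).g₂ := by
  rw [PeriodPair.g₂, map_mul, PeriodPair.G, conj_tsum_rhombicLattice hp hq fun l => (l ^ 4)⁻¹]
  simp [Complex.conj_ofNat]

lemma weierstrassP_real (x : ℝ) : (rhombicLattice hp hq).weierstrassP x =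
    (((rhombicLattice hp hq).weierstrassP x).re : ℝ) := by
  rw [eq_comm, ← Complex.conj_eq_iff_re, ← weierstrassP_conj, Complex.conj_ofReal]

lemma weierstrassP_imag (y : ℝ) : (rhombicLattice hp hq).weierstrassP (y * Complex.I) =
    (((rhombicLattice hp hq).weierstrassP (y * Complex.I)).re : ℝ) := by
  rw [eq_comm, ← Complex.conj_eq_iff_re, ← weierstrassP_conj, map_mul, Complex.conj_ofReal,
    Complex.conj_I, mul_neg, PeriodPair.weierstrassP_neg]

/-- The value of `℘` at the real half period. -/
def realHalfValue : ℝ := ((rhombicLattice hp hq).weierstrassP p).re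

/-- The constant of the inversion of `℘ - ℘(p)` by translation by `p`. -/
def inversionConst : ℝ := 3 * realHalfValue hp hq ^ 2 - (rhombicLattice hp hq).g₂.re / 4

lemma weierstrassP_p : (rhombicLattice hp hq).weierstrassP p = (realHalfValue hp hq : ℝ) :=
  weierstrassP_real hp hq p

lemma g₂_eq_re : (rhombicLattice hp hq).g₂ = ((rhombicLattice hp hq).g₂.re : ℝ) :=
  (Complex.conj_eq_iff_re.1 (conj_g₂ hp hq)).symm

lemma inversionConst_eq : 3 * (rhombicLattice hp hq).weierstrassP p ^ 2 -
    (rhombicLattice hp hq).g₂ / 4 = (inversionConst hp hq : ℝ) := by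
  rw [weierstrassP_p, g₂_eq_re, inversionConst]
  push_cast
  ring

lemma weierstrassP_inversion {u : ℂ} (hu : u ∉ (rhombicLattice hp hq).lattice)
    (hup : u + p ∉ (rhombicLattice hp hq).lattice) :
    ((rhombicLattice hp hq).weierstrassP u - (realHalfValue hp hq : ℝ)) *
      ((rhombicLattice hp hq).weierstrassP (u + p) - (realHalfValue hp hq : ℝ)) =
      (inversionConst hp hq : ℝ) := by
  rw [← inversionConst_eq, ← weierstrassP_p]
  exact weierstrassP_sub_mul_half (p_notMem hp hq) (two_p_mem hp hq) hu hup

lemma derivWeierstrassP_sq_rhombic {u : ℂ} (hu : u ∉ (rhombicLattice hp hq).lattice) :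
    (rhombicLattice hp hq).derivWeierstrassP u ^ 2 =
      4 * ((rhombicLattice hp hq).weierstrassP u - (realHalfValue hp hq : ℝ)) *
      (((rhombicLattice hp hq).weierstrassP u - (realHalfValue hp hq : ℝ)) ^ 2 +
        3 * (realHalfValue hp hq : ℝ) *
          ((rhombicLattice hp hq).weierstrassP u - (realHalfValue hp hq : ℝ)) +
        (inversionConst hp hq : ℝ)) := by
  rw [← inversionConst_eq, ← weierstrassP_p]
  exact derivWeierstrassP_sq_half (p_notMem hp hq) (two_p_mem hp hq) hu

/-- The discriminant condition: the other two half period values are not real. -/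
lemma nine_mul_sq_lt : 9 * realHalfValue hp hq ^ 2 < 4 * inversionConst hp hq := by
  set Λ := rhombicLattice hp hq with hΛ
  set w : ℂ := (p + q * Complex.I) / 2 with hw
  have hwim : w.im = q / 2 := by simp [hw]
  have hwΛ : w ∉ Λ.lattice := notMem_rhombicLattice_of_im hp hq (by rw [hwim]; linarith)
    (by rw [hwim]; linarith)
  have hw2 : 2 * w ∈ Λ.lattice := by
    rw [hw, mul_div_cancel₀ _ (two_ne_zero' ℂ)]
    exact p_add_q_mem hp hq
  have hwp : p + w ∉ Λ.lattice := notMem_rhombicLattice_of_im hp hq (by simp [hwim, hq])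
    (by simp [hwim]; linarith)
  -- Conjugation exchanges the half periods `w` and `p + w` modulo the lattice. A real value would
  -- make `℘` agree at both, contradicting the nonvanishing inversion constant at `w`. The value
  -- minus `e` is thus a nonreal root of a real quadratic, whose discriminant is negative.
  have hconj : (starRingEnd ℂ) (Λ.weierstrassP w) = Λ.weierstrassP (p + w) := by
    rw [← weierstrassP_conj]
    have h1 : (starRingEnd ℂ) w = p + w - (p + q * Complex.I) := by
      rw [hw, map_div₀, map_add, map_mul, Complex.conj_ofReal, Complex.conj_ofReal,
        Complex.conj_I, map_ofNat]
      ring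
    rw [h1]
    exact Λ.weierstrassP_sub_coe (p + w) ⟨_, p_add_q_mem hp hq⟩
  have him : (Λ.weierstrassP w).im ≠ 0 := by
    intro h
    have h1 : (starRingEnd ℂ) (Λ.weierstrassP w) = Λ.weierstrassP w := Complex.conj_eq_iff_im.2 h
    have h2 := weierstrassP_sub_mul_half hwΛ hw2 (p_notMem hp hq) hwp
    rw [← hconj, h1, sub_self, mul_zero] at h2
    exact weierstrassP_half_ne_zero hwΛ hw2 h2.symm
  have hder := derivWeierstrassP_sq_rhombic hp hq hwΛ
  rw [derivWeierstrassP_half hw2] at hder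
  set e := realHalfValue hp hq
  set C := inversionConst hp hq
  set r := Λ.weierstrassP w - (e : ℝ) with hr
  have hrim : r.im ≠ 0 := by simpa [hr] using him
  have hr0 : r ≠ 0 := fun h => hrim (by rw [h]; rfl)
  have hQ : r ^ 2 + 3 * (e : ℝ) * r + (C : ℝ) = 0 := by
    have : 4 * r * (r ^ 2 + 3 * (e : ℝ) * r + (C : ℝ)) = 0 := by rw [← hder]; simp
    simpa [hr0] using this
  have h1 := congrArg Complex.re hQ
  have h2 := congrArg Complex.im hQ
  simp [sq] at h1 h2
  have h3 : 2 * r.re + 3 * e = 0 := by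
    have : r.im * (2 * r.re + 3 * e) = 0 := by linarith
    exact (mul_eq_zero.1 this).resolve_left hrim
  have h4 : 0 < r.im ^ 2 := by positivity
  nlinarith

end Rhombic

end

noncomputable section

/-! ### The behaviour of `℘` on the two symmetry axes of a rhombic lattice. -/

section Rhombic

variable {p q : ℝ} (hp : 0 < p) (hq : 0 < q)

/-- `℘ - ℘(p)` along the real axis (`κ = 1`) and its negative along the imaginary axis
(`κ = i`). -/
def axisFun (κ : ℂ) (x : ℝ) : ℝ :=
  (κ ^ 2 * ((rhombicLattice hp hq).weierstrassP (κ * x) - (realHalfValue hp hq : ℝ))).re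

/-- The derivative of `axisFun`. -/
def axisFunDeriv (κ : ℂ) (x : ℝ) : ℝ :=
  (κ ^ 3 * (rhombicLattice hp hq).derivWeierstrassP (κ * x)).re

lemma hasDerivAt_axis (κ : ℂ) {x : ℝ} (hx : κ * x ∉ (rhombicLattice hp hq).lattice) :
    HasDerivAt (fun z : ℂ => κ ^ 2 * ((rhombicLattice hp hq).weierstrassP (κ * z) -
      (realHalfValue hp hq : ℝ)))
      (κ ^ 3 * (rhombicLattice hp hq).derivWeierstrassP (κ * x)) x := by
  have h := ((hasDerivAt_weierstrassP _ hx).comp (x : ℂ)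
    ((hasDerivAt_id (x : ℂ)).const_mul κ)).sub_const ((realHalfValue hp hq : ℝ) : ℂ)
  refine (h.const_mul (κ ^ 2)).congr_deriv ?_
  ring

lemma hasDerivAt_axisFun (κ : ℂ) {x : ℝ} (hx : κ * x ∉ (rhombicLattice hp hq).lattice) :
    HasDerivAt (axisFun hp hq κ) (axisFunDeriv hp hq κ x) x :=
  (hasDerivAt_axis hp hq κ hx).real_of_complex

/-- Both axes at once: since `κ⁴ = 1`, the rotated function satisfies the same cubic ODE with the
middle coefficient multiplied by `ε`, which exchanges the parameter with its complement. It runs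
from the pole at `0` to the zero at `ℓ`. -/
lemma axis_period {κ : ℂ} {ε ℓ c m : ℝ} (hκ : κ ^ 2 = (ε : ℝ)) (hε : ε ^ 2 = 1) (hℓ : 0 < ℓ)
    (hmem : ∀ x ∈ Ioo 0 ℓ, κ * x ∉ (rhombicLattice hp hq).lattice)
    (hmemp : ∀ x ∈ Ioo 0 ℓ, κ * x + p ∉ (rhombicLattice hp hq).lattice)
    (hmemℓ : κ * ℓ ∉ (rhombicLattice hp hq).lattice)
    (hend : (rhombicLattice hp hq).weierstrassP (κ * ℓ) = (realHalfValue hp hq : ℝ))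
    (hreal : ∀ x : ℝ, ((rhombicLattice hp hq).weierstrassP (κ * x)).im = 0)
    (hc : 0 < c) (hm : m < 1) (hm0 : 0 < m) (hC : inversionConst hp hq = c ^ 4)
    (hB : 3 * (ε * realHalfValue hp hq) = (2 - 4 * m) * c ^ 2) :
    (∀ x ∈ Ioo 0 ℓ, axisFunDeriv hp hq κ x < 0) ∧
      (∀ x ∈ Ioo 0 ℓ, 0 < axisFun hp hq κ x) ∧ c * ℓ = ellK m := by
  set Λ := rhombicLattice hp hq with hΛ
  set e := realHalfValue hp hq with he
  have hκ4 : κ ^ 4 = 1 := by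
    rw [show κ ^ 4 = (κ ^ 2) ^ 2 by ring, hκ]; exact_mod_cast hε
  have hκ0 : κ ≠ 0 := fun h => by simp [h] at hκ4
  have hf : ∀ x : ℝ, κ ^ 2 * (Λ.weierstrassP (κ * x) - (e : ℝ)) = (axisFun hp hq κ x : ℝ) := by
    intro x
    apply Complex.ext
    · rw [Complex.ofReal_re]; rfl
    · rw [hκ, Complex.im_ofReal_mul]
      simp [hreal x]
  have hf' : ∀ x ∈ Ioo 0 ℓ,
      κ ^ 3 * Λ.derivWeierstrassP (κ * x) = (axisFunDeriv hp hq κ x : ℝ) := by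
    intro x hx
    have h1 := (hasDerivAt_axis hp hq κ (hmem x hx)).comp_ofReal
    have h2 := (hasDerivAt_axisFun hp hq κ (hmem x hx)).ofReal_comp
    refine h1.unique (h2.congr_of_eventuallyEq (Eventually.of_forall hf))
  have hode : ∀ x ∈ Ioo 0 ℓ, axisFunDeriv hp hq κ x ^ 2 = 4 * axisFun hp hq κ x *
      (axisFun hp hq κ x ^ 2 + (2 - 4 * m) * c ^ 2 * axisFun hp hq κ x + c ^ 4) := by
    intro x hx
    have h1 := derivWeierstrassP_sq_rhombic hp hq (hmem x hx)
    rw [← hB, ← hC]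
    have h2 := hf x
    have h3 := hf' x hx
    rw [← Complex.ofReal_inj]
    push_cast
    rw [← h2, ← h3, ← hκ]
    linear_combination κ ^ 6 * h1 +
      (4 * κ ^ 2 * (Λ.weierstrassP (κ * x) - (e : ℝ)) * (inversionConst hp hq : ℝ)) * hκ4
  -- A zero would make the product in the inversion formula zero, while its constant is `c⁴`. The
  -- sign then follows from the ODE, whose left side is a square and whose quadratic factor is
  -- positive.
  have hne : ∀ x ∈ Ioo 0 ℓ, axisFun hp hq κ x ≠ 0 := by
    intro x hx h
    have h1 := hf x
    rw [h, Complex.ofReal_zero] at h1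
    have h2 := weierstrassP_inversion hp hq (hmem x hx) (hmemp x hx)
    rw [(mul_eq_zero.1 h1).resolve_left (pow_ne_zero 2 hκ0), zero_mul, hC] at h2
    have : (c : ℝ) ^ 4 ≠ 0 := by positivity
    exact this (by exact_mod_cast h2.symm)
  have hpos : ∀ x ∈ Ioo 0 ℓ, 0 < axisFun hp hq κ x := by
    intro x hx
    refine lt_of_le_of_ne ?_ (hne x hx).symm
    by_contra hlt
    rw [not_le] at hlt
    have h1 := hode x hx
    have h2 : 0 < axisFun hp hq κ x ^ 2 + (2 - 4 * m) * c ^ 2 * axisFun hp hq κ x + c ^ 4 := by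
      have h3 : 0 < m * (1 - m) := mul_pos hm0 (by linarith)
      have h4 : 0 < c ^ 4 := by positivity
      nlinarith [sq_nonneg (axisFun hp hq κ x + (1 - 2 * m) * c ^ 2), mul_pos h3 h4]
    nlinarith [sq_nonneg (axisFunDeriv hp hq κ x), mul_neg_of_neg_of_pos hlt h2]
  have h0 : Tendsto (axisFun hp hq κ) (𝓝[>] 0) atTop := by
    have h1 : Tendsto (fun x : ℝ => κ * x) (𝓝[>] 0) (𝓝[≠] 0) := by
      refine tendsto_nhdsWithin_iff.2 ⟨?_, ?_⟩
      · have : Tendsto (fun x : ℝ => κ * x) (𝓝 0) (𝓝 (κ * (0 : ℝ))) :=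
          (by fun_prop : Continuous fun x : ℝ => κ * x).tendsto 0
        simp only [Complex.ofReal_zero, mul_zero] at this
        exact this.mono_left nhdsWithin_le_nhds
      · filter_upwards [self_mem_nhdsWithin] with x (hx : 0 < x)
        exact mul_ne_zero hκ0 (by exact_mod_cast hx.ne')
    have h2 := ((Complex.continuous_re.tendsto _).comp
      ((tendsto_sq_mul_weierstrassP Λ).comp h1))
    have h3 : Tendsto (fun x : ℝ => x ^ 2 * ε * e) (𝓝[>] 0) (𝓝 0) := by
      have : ContinuousAt (fun x : ℝ => x ^ 2 * ε * e) 0 := by fun_prop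
      simpa using this.tendsto.mono_left (nhdsWithin_le_nhds (s := Ioi 0))
    have h4 := h2.sub h3
    rw [Complex.one_re, sub_zero] at h4
    have h5 : Tendsto (fun x : ℝ => (x ^ 2)⁻¹) (𝓝[>] 0) atTop := by
      refine tendsto_inv_nhdsGT_zero.comp (tendsto_nhdsWithin_iff.2 ⟨?_, ?_⟩)
      · have : ContinuousAt (fun x : ℝ => x ^ 2) 0 := by fun_prop
        simpa using this.tendsto.mono_left (nhdsWithin_le_nhds (s := Ioi 0))
      · filter_upwards [self_mem_nhdsWithin] with x (hx : 0 < x)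
        exact pow_pos hx 2
    refine (h4.pos_mul_atTop one_pos h5).congr' ?_
    filter_upwards [self_mem_nhdsWithin] with x (hx : 0 < x)
    simp only [Function.comp_apply, axisFun]
    rw [mul_pow, hκ, ← hΛ, ← he, Complex.re_ofReal_mul, mul_assoc, Complex.re_ofReal_mul,
      ← Complex.ofReal_pow, Complex.re_ofReal_mul, Complex.sub_re, Complex.ofReal_re]
    field_simp
  have h1 : Tendsto (axisFun hp hq κ) (𝓝[<] ℓ) (𝓝 0) := by
    have h2 := (hasDerivAt_axisFun hp hq κ hmemℓ).continuousAt.tendsto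
    have h3 : axisFun hp hq κ ℓ = 0 := by rw [axisFun, hend, sub_self, mul_zero, Complex.zero_re]
    rw [h3] at h2
    exact h2.mono_left nhdsWithin_le_nhds
  obtain ⟨h2, h3⟩ := neg_and_mul_eq_ellK_of_ode hℓ hc hm
    (fun x hx => hasDerivAt_axisFun hp hq κ (hmem x hx)) hpos hode h0 h1
  exact ⟨h2, hpos, h3⟩

lemma real_axis_period {c m : ℝ} (hc : 0 < c) (hm : m < 1) (hm0 : 0 < m)
    (hC : inversionConst hp hq = c ^ 4) (hB : 3 * realHalfValue hp hq = (2 - 4 * m) * c ^ 2) :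
    c * p = ellK m := by
  refine (axis_period hp hq (κ := 1) (ε := 1) (by simp) (by norm_num) hp ?_ ?_ ?_ ?_ ?_ hc hm hm0 hC
    (by rw [one_mul]; exact hB)).2.2
  · intro x hx
    rw [one_mul]
    exact notMem_rhombicLattice_of_re hp hq hx.1 (by linarith [hx.2])
  · intro x hx
    rw [one_mul, ← Complex.ofReal_add]
    exact notMem_rhombicLattice_of_re hp hq (by linarith [hx.1]) (by linarith [hx.2])
  · rw [one_mul]; exact p_notMem hp hq
  · rw [one_mul]; exact weierstrassP_p hp hq
  · intro x
    rw [one_mul, weierstrassP_real, Complex.ofReal_im]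

lemma imag_axis_period {c m : ℝ} (hc : 0 < c) (hm : m < 1) (hm0 : 0 < m)
    (hC : inversionConst hp hq = c ^ 4) (hB : -(3 * realHalfValue hp hq) = (2 - 4 * m) * c ^ 2) :
    (∀ x ∈ Ioo 0 q, axisFunDeriv hp hq Complex.I x < 0) ∧
      (∀ x ∈ Ioo 0 q, 0 < axisFun hp hq Complex.I x) ∧ c * q = ellK m := by
  have hend : (rhombicLattice hp hq).weierstrassP (Complex.I * q) = (realHalfValue hp hq : ℝ) := by
    have h1 := (rhombicLattice hp hq).weierstrassP_add_coe (-p) ⟨_, p_add_q_mem hp hq⟩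
    rw [PeriodPair.weierstrassP_neg, weierstrassP_p] at h1
    rw [← h1]
    congr 1
    ring
  refine axis_period hp hq (κ := Complex.I) (ε := -1) (by simp) (by norm_num) hq ?_ ?_ ?_ hend ?_
    hc hm hm0 hC (by linarith)
  · intro x hx
    exact notMem_rhombicLattice_of_im hp hq (by simpa using hx.1) (by simpa using hx.2)
  · intro x hx
    exact notMem_rhombicLattice_of_im hp hq (by simpa using hx.1) (by simpa using hx.2)
  · rw [mul_comm]; exact q_notMem hp hq
  · intro x
    rw [mul_comm, weierstrassP_imag, Complex.ofReal_im]

end Rhombic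

/-! ### Recovering the invariants of the lattice from its periods. -/

section Legendre

variable {m : ℝ} (hm0 : 0 < m) (hm1 : m < 1)

/-- The lattice of the elliptic curve of parameter `m`. -/
def ellLattice : PeriodPair :=
  rhombicLattice (ellK_pos hm1) (ellK_pos (show 1 - m < 1 by linarith))

/-- The lattice with half periods `K(m)` and `(K(m) + i K(1 - m)) / 2` determines `m`. -/
theorem inversionConst_ellLattice :
    inversionConst (ellK_pos hm1) (ellK_pos (show 1 - m < 1 by linarith)) = 1 ∧
      realHalfValue (ellK_pos hm1) (ellK_pos (show 1 - m < 1 by linarith)) = (2 - 4 * m) / 3 := by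
  set hp := ellK_pos hm1
  set hq := ellK_pos (show 1 - m < 1 by linarith)
  have hdisc := nine_mul_sq_lt hp hq
  set e := realHalfValue hp hq with he
  set C := inversionConst hp hq with hC
  have hC0 : 0 < C := by nlinarith [sq_nonneg e]
  obtain ⟨c, hc, hcC⟩ : ∃ c : ℝ, 0 < c ∧ C = c ^ 4 := by
    refine ⟨Real.sqrt (Real.sqrt C), Real.sqrt_pos.2 (Real.sqrt_pos.2 hC0), ?_⟩
    rw [show Real.sqrt (Real.sqrt C) ^ 4 = (Real.sqrt (Real.sqrt C) ^ 2) ^ 2 by ring,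
      Real.sq_sqrt (Real.sqrt_nonneg _), Real.sq_sqrt hC0.le]
  obtain ⟨h1, h2⟩ : -(2 * c ^ 2) < 3 * e ∧ 3 * e < 2 * c ^ 2 := by
    refine abs_lt.1 (abs_lt_of_sq_lt_sq ?_ (by positivity))
    rw [hcC] at hdisc
    nlinarith
  set n := (2 - 3 * e / c ^ 2) / 4 with hn
  have hn0 : 0 < n := by
    have : 3 * e / c ^ 2 < 2 := by rw [div_lt_iff₀ (by positivity)]; linarith
    linarith
  have hn1 : n < 1 := by
    have : -2 < 3 * e / c ^ 2 := by rw [lt_div_iff₀ (by positivity)]; linarith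
    linarith
  have hB : 3 * e = (2 - 4 * n) * c ^ 2 := by rw [hn]; field_simp; ring
  have hP := real_axis_period hp hq hc hn1 hn0 hcC hB
  have hQ := (imag_axis_period hp hq hc (show 1 - n < 1 by linarith) (by linarith) hcC
    (by linarith)).2.2
  -- The two periods give `c K(m) = K(n)` and `c K(1 - m) = K(1 - n)`. If `n ≠ m`, monotonicity of
  -- `K` forces `c < 1` from one equation and `c > 1` from the other.
  have hnm : n = m := by
    rcases lt_trichotomy n m with h | h | h
    · have h3 := ellK_strictMonoOn hn1 hm1 h
      have h4 := ellK_strictMonoOn (show 1 - m < 1 by linarith) (show 1 - n < 1 by linarith)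
        (show 1 - m < 1 - n by linarith)
      rw [← hP] at h3
      rw [← hQ] at h4
      have h5 : c < 1 := by
        by_contra h; nlinarith [mul_le_mul_of_nonneg_right (not_lt.1 h) hp.le]
      have h6 : 1 < c := by
        by_contra h; nlinarith [mul_le_mul_of_nonneg_right (not_lt.1 h) hq.le]
      linarith
    · exact h
    · have h3 := ellK_strictMonoOn hm1 hn1 h
      have h4 := ellK_strictMonoOn (show 1 - n < 1 by linarith) (show 1 - m < 1 by linarith)
        (show 1 - n < 1 - m by linarith)
      rw [← hP] at h3
      rw [← hQ] at h4
      have h5 : 1 < c := by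
        by_contra h; nlinarith [mul_le_mul_of_nonneg_right (not_lt.1 h) hp.le]
      have h6 : c < 1 := by
        by_contra h; nlinarith [mul_le_mul_of_nonneg_right (not_lt.1 h) hq.le]
      linarith
  have hc1 : c = 1 := by
    rw [hnm] at hP
    nlinarith [mul_right_cancel₀ hp.ne' (hP.trans (one_mul _).symm)]
  rw [hcC, hc1]
  rw [hc1, hnm] at hB
  exact ⟨by norm_num, by linarith⟩

end Legendre

end

noncomputable section

/-! ### The Weierstrass zeta function -/

section Zeta

variable (Λ : PeriodPair)

/-- The Weierstrass zeta function as a sum over all lattice points; the summand at `0` is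
`1 / u`. -/
def zetaSum (u : ℂ) : ℂ := ∑' l : Λ.lattice, (1 / (u - l) + 1 / l + u / (l : ℂ) ^ 2)

lemma norm_zeta_summand_le {r : ℝ} {u l : ℂ} (hu : ‖u‖ < r) (hl : 2 * r ≤ ‖l‖) :
    ‖1 / (u - l) + 1 / l + u / l ^ 2‖ ≤ 2 * r ^ 2 * ‖l‖ ^ (-3 : ℝ) := by
  have hr : 0 < r := (norm_nonneg u).trans_lt hu
  have hl0 : 0 < ‖l‖ := by linarith
  have hl1 : l ≠ 0 := norm_pos_iff.1 hl0
  have h1 : ‖l‖ / 2 ≤ ‖u - l‖ := by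
    rw [norm_sub_rev]
    exact le_trans (by linarith) (norm_sub_norm_le l u)
  have h2 : u - l ≠ 0 := norm_pos_iff.1 (by linarith)
  calc ‖1 / (u - l) + 1 / l + u / l ^ 2‖ = ‖u ^ 2 / ((u - l) * l ^ 2)‖ := by
        congr 1; field_simp; ring
    _ = ‖u‖ ^ 2 / (‖u - l‖ * ‖l‖ ^ 2) := by simp
    _ ≤ r ^ 2 / (‖l‖ / 2 * ‖l‖ ^ 2) := by gcongr
    _ = 2 * r ^ 2 / ‖l‖ ^ 3 := by field_simp
    _ = _ := by norm_cast

lemma hasSum_zetaSum (u : ℂ) :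
    HasSum (fun l : Λ.lattice => 1 / (u - l) + 1 / (l : ℂ) + u / (l : ℂ) ^ 2) (zetaSum Λ u) := by
  refine (Λ.hasSumLocallyUniformly_aux (fun l u => 1 / (u - l) + 1 / (l : ℂ) + u / (l : ℂ) ^ 2)
    (u := fun r l => 2 * r ^ 2 * ‖l‖ ^ (-3 : ℝ))
    (fun _ _ => (ZLattice.summable_norm_rpow _ _ (by simp; norm_num)).mul_left _) fun r hr =>
    Filter.eventually_atTop.mpr ⟨2 * r, ?_⟩).hasSum
  rintro _ h s hs l rfl
  exact norm_zeta_summand_le hs h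

/-- `ζ' = -℘`. -/
lemma hasDerivAt_zetaSum {u : ℂ} (hu : u ∉ Λ.lattice) :
    HasDerivAt (zetaSum Λ) (-Λ.weierstrassP u) u := by
  have h1 := Λ.hasSumLocallyUniformly_weierstrassP.tendstoLocallyUniformlyOn
    (s := ((Λ.lattice : Set ℂ)ᶜ))
  have h2 := uniformContinuous_neg.comp_tendstoLocallyUniformlyOn h1
  refine hasDerivAt_of_tendstoLocallyUniformlyOn (isOpen_compl_lattice Λ) h2
    (f := fun (s : Finset Λ.lattice) u =>
      ∑ l ∈ s, (1 / (u - l) + 1 / (l : ℂ) + u / (l : ℂ) ^ 2))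
    (Eventually.of_forall fun s x hx => ?_) (fun x _ => hasSum_zetaSum Λ x) hu
  refine (HasDerivAt.fun_sum (A' := fun l : Λ.lattice =>
    -(1 / (x - l) ^ 2 - 1 / (l : ℂ) ^ 2)) fun l _ => ?_).congr_deriv (by simp)
  have hxl : x - l ≠ 0 := fun h => hx (by rw [sub_eq_zero.1 h]; exact l.2)
  have h3 := ((((hasDerivAt_id x).sub_const (l : ℂ)).inv hxl).add_const (1 / (l : ℂ))).add
    ((hasDerivAt_id x).div_const ((l : ℂ) ^ 2))
  refine (h3.congr_of_eventuallyEq (Eventually.of_forall fun y => ?_)).congr_deriv ?_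
  · simp [one_div]
  · simp only [id]; ring

lemma zetaSum_neg (u : ℂ) : zetaSum Λ (-u) = -zetaSum Λ u := by
  rw [zetaSum, zetaSum, ← tsum_neg, ← (Equiv.neg Λ.lattice).tsum_eq]
  congr with l
  simp only [Equiv.neg_apply, NegMemClass.coe_neg, neg_sq]
  rw [show -u - -(l : ℂ) = -(u - l) by ring, div_neg, div_neg]
  ring

lemma zetaSum_conj {p q : ℝ} (hp : 0 < p) (hq : 0 < q) (u : ℂ) :
    zetaSum (rhombicLattice hp hq) ((starRingEnd ℂ) u) =
      (starRingEnd ℂ) (zetaSum (rhombicLattice hp hq) u) := by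
  rw [zetaSum, zetaSum,
    conj_tsum_rhombicLattice hp hq fun l => 1 / (u - l) + 1 / l + u / l ^ 2]
  simp

lemma weierstrassZeta_eq_zetaSum {ω₁ ω₂ : ℂ} (h1 : Λ.ω₁ = 2 * ω₁) (h2 : Λ.ω₂ = 2 * ω₂) (u : ℂ) :
    weierstrassZeta ω₁ ω₂ u = zetaSum Λ u := by
  set f : ℤ × ℤ → ℂ := fun x => 1 / (u - latticePoint ω₁ ω₂ x) + 1 / latticePoint ω₁ ω₂ x +
    u / latticePoint ω₁ ω₂ x ^ 2 with hf
  have hpt : ∀ x, ((Λ.latticeEquivProd.symm x : Λ.lattice) : ℂ) = latticePoint ω₁ ω₂ x := by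
    intro x
    rw [Λ.latticeEquiv_symm_apply, h1, h2, latticePoint]
    ring
  have hsum : HasSum f (zetaSum Λ u) := by
    have h := (Λ.latticeEquivProd.symm.toEquiv.hasSum_iff).2 (hasSum_zetaSum Λ u)
    refine h.congr_fun fun x => ?_
    simp only [hf, ← hpt]
    rfl
  have h3 := hsum.summable.tsum_subtype_add_tsum_subtype_compl {0}
  rw [hsum.tsum_eq, tsum_singleton (0 : ℤ × ℤ) f] at h3
  rw [← h3, weierstrassZeta]
  congr 1
  simp [hf, latticePoint]

end Zeta

end

noncomputable section

/-! ### The tangent of a type Ia elastica -/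

/-- The second order equation of the tangent `e^{iθ}` of an elastica, as a first order system. -/
def tangentField (μ m : ℝ) (x : ℂ × ℂ) : ℂ × ℂ :=
  (x.2, -(3 / 2) * μ * x.1 ^ 2 + 2 * μ * (1 - 2 * m) * x.1 - μ / 2)

/-- The field is quadratic, so Lipschitz only on bounded sets. The unit ball suffices because both
solutions to be compared have modulus one. -/
lemma lipschitzOnWith_tangentField (μ m : ℝ) :
    ∃ K, LipschitzOnWith K (tangentField μ m) (Metric.closedBall 0 1 ×ˢ univ) := by
  have hK : (0 : ℝ) ≤ 1 + 3 * |μ| + ‖(2 * μ * (1 - 2 * m) : ℂ)‖ := by positivity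
  refine ⟨⟨1 + 3 * |μ| + ‖(2 * μ * (1 - 2 * m) : ℂ)‖, hK⟩, LipschitzOnWith.of_dist_le_mul ?_⟩
  rintro ⟨x, v⟩ ⟨hx, -⟩ ⟨y, w⟩ ⟨hy, -⟩
  simp only [mem_closedBall_zero_iff] at hx hy
  have h1 : ‖x - y‖ ≤ dist (x, v) (y, w) := by
    rw [← dist_eq_norm]; exact le_max_left _ _
  have h2 : dist v w ≤ dist (x, v) (y, w) := le_max_right _ _
  have h0 : 0 ≤ dist (x, v) (y, w) := dist_nonneg
  refine (max_le ?_ ?_ : dist (tangentField μ m (x, v)) (tangentField μ m (y, w)) ≤ _)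
  · refine h2.trans (le_mul_of_one_le_left h0 ?_)
    show (1 : ℝ) ≤ 1 + 3 * |μ| + ‖(2 * μ * (1 - 2 * m) : ℂ)‖
    have := abs_nonneg μ
    have := norm_nonneg (2 * μ * (1 - 2 * m) : ℂ)
    linarith
  · show dist _ _ ≤ (1 + 3 * |μ| + ‖(2 * μ * (1 - 2 * m) : ℂ)‖) * _
    simp only [tangentField]
    rw [dist_eq_norm, show (-(3 / 2) * μ * x ^ 2 + 2 * μ * (1 - 2 * m) * x - μ / 2 -
      (-(3 / 2) * μ * y ^ 2 + 2 * μ * (1 - 2 * m) * y - μ / 2) : ℂ) =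
      (-(3 / 2) * μ * (x + y) + 2 * μ * (1 - 2 * m)) * (x - y) by ring, norm_mul]
    refine mul_le_mul ?_ h1 (norm_nonneg _) hK
    refine (norm_add_le _ _).trans ?_
    have h3 : ‖(-(3 / 2) * μ * (x + y) : ℂ)‖ ≤ 3 * |μ| := by
      rw [norm_mul, norm_mul, Complex.norm_real, Real.norm_eq_abs, norm_neg]
      have h4 : ‖x + y‖ ≤ 2 := (norm_add_le _ _).trans (by linarith)
      have h5 : ‖(3 / 2 : ℂ)‖ = 3 / 2 := by simp
      rw [h5]
      nlinarith [abs_nonneg μ]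
    linarith

variable {L m : ℝ}

lemma hasDerivAt_exp_elasticaAngle (hm : 0 ≤ m) (hm1 : m < 1) (s : ℝ) :
    HasDerivAt (fun s => Complex.exp (Complex.I * elasticaAngle L m s))
      (Complex.I * elasticaCurv L m s * Complex.exp (Complex.I * elasticaAngle L m s)) s := by
  have h := (((hasDerivAt_elasticaAngle (L := L) hm hm1 s).ofReal_comp).const_mul Complex.I).cexp
  refine h.congr_deriv ?_
  ring

/-- For `T = e^{iθ}` one has `T'' = (i k' - k²) T`. The pendulum equation and its first integral
express `k'` and `k²` through `sin θ` and `cos θ`, that is, through `T` and `T⁻¹`, and the factor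
`T` clears the denominators. -/
lemma hasDerivAt_tangent_elasticaAngle (hm : 0 ≤ m) (hm1 : m < 1) (s : ℝ) :
    HasDerivAt (fun s => (Complex.exp (Complex.I * elasticaAngle L m s),
      Complex.I * elasticaCurv L m s * Complex.exp (Complex.I * elasticaAngle L m s)))
      (tangentField (freq L m ^ 2) m (Complex.exp (Complex.I * elasticaAngle L m s),
        Complex.I * elasticaCurv L m s * Complex.exp (Complex.I * elasticaAngle L m s))) s := by
  have h1 := hasDerivAt_exp_elasticaAngle (L := L) hm hm1 s
  have h2 := (((hasDerivAt_elasticaCurv (L := L) hm hm1 s).ofReal_comp).const_mul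
    Complex.I).mul h1
  refine HasDerivAt.prodMk h1 (h2.congr_deriv ?_)
  have h3 := elasticaCurv_sq (L := L) hm hm1 s
  have h4 := cos_eq_one_sub_sin_half_sq (elasticaAngle L m s)
  set θ := elasticaAngle L m s
  set k := elasticaCurv L m s
  have h5 : k ^ 2 = freq L m ^ 2 * (4 * m - 2 + 2 * Real.cos θ) := by rw [h3, h4]; ring
  have h5' : (k : ℂ) ^ 2 = (freq L m : ℂ) ^ 2 * (4 * m - 2 + 2 * Complex.cos θ) := by
    exact_mod_cast h5
  have hE : Complex.exp (Complex.I * θ) = Complex.cos θ + Complex.sin θ * Complex.I := by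
    rw [mul_comm, Complex.exp_mul_I]
  have h6 := Complex.sin_sq_add_cos_sq (θ : ℂ)
  have hI := Complex.I_sq
  simp only
  rw [hE]
  push_cast
  set c := Complex.cos θ
  set d := Complex.sin θ
  set f : ℂ := (freq L m : ℂ)
  linear_combination (Complex.I ^ 2 * (c + d * Complex.I)) * h5' +
    (f ^ 2 * (4 * m - 2 + 2 * c) * (c + d * Complex.I) - f ^ 2 * d ^ 2 + 3 / 2 * f ^ 2 * d ^ 2) * hI +
    (-(f ^ 2) / 2) * h6

/-! ### The same equation and initial data for `e₁ - ℘`. -/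

section Lattice

/-- The line on which the zeta function parametrizes the elastica. -/
def ellPoint (m β s : ℝ) : ℂ := β * s + (ellK (1 - m) / 2 : ℝ) * Complex.I

/-- The function `e₁ - ℘` on this line. -/
def ellTangent (hm0 : 0 < m) (hm1 : m < 1) (β s : ℝ) : ℂ :=
  ((2 - 4 * m) / 3 : ℝ) - (ellLattice hm0 hm1).weierstrassP (ellPoint m β s)

lemma hasDerivAt_ellPoint (m β s : ℝ) : HasDerivAt (ellPoint m β) β s := by
  have h := (((hasDerivAt_id s).ofReal_comp).const_mul (β : ℂ)).add_const
    ((ellK (1 - m) / 2 : ℝ) * Complex.I)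
  rw [Complex.ofReal_one, mul_one] at h
  exact h

lemma ellPoint_im (m β s : ℝ) : (ellPoint m β s).im = ellK (1 - m) / 2 := by
  rw [ellPoint, Complex.add_im, ← Complex.ofReal_mul, Complex.ofReal_im, Complex.im_ofReal_mul]
  simp

variable (hm0 : 0 < m) (hm1 : m < 1) (β s : ℝ)

lemma ellPoint_notMem : ellPoint m β s ∉ (ellLattice hm0 hm1).lattice := by
  have := ellK_pos (show 1 - m < 1 by linarith)
  exact notMem_rhombicLattice_of_im _ _ (by rw [ellPoint_im]; linarith)
    (by rw [ellPoint_im]; linarith)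

lemma hasDerivAt_ellTangent : HasDerivAt (ellTangent hm0 hm1 β)
    (-(β * (ellLattice hm0 hm1).derivWeierstrassP (ellPoint m β s))) s := by
  have h := ((hasDerivAt_weierstrassP _ (ellPoint_notMem hm0 hm1 β s)).comp s
    (hasDerivAt_ellPoint m β s)).const_sub (((2 - 4 * m) / 3 : ℝ) : ℂ)
  refine h.congr_deriv ?_
  ring

lemma g₂_ellLattice : (ellLattice hm0 hm1).g₂ = 12 * (((2 - 4 * m) / 3 : ℝ) : ℂ) ^ 2 - 4 := by
  obtain ⟨h1, h2⟩ := inversionConst_ellLattice hm0 hm1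
  have h3 := inversionConst_eq (ellK_pos hm1) (ellK_pos (show 1 - m < 1 by linarith))
  rw [weierstrassP_p, h1, h2, Complex.ofReal_one] at h3
  have h4 : 3 * (((2 - 4 * m) / 3 : ℝ) : ℂ) ^ 2 - (ellLattice hm0 hm1).g₂ / 4 = 1 := h3
  linear_combination (-4) * h4

lemma hasDerivAt_tangent_ellTangent :
    HasDerivAt (fun s => (ellTangent hm0 hm1 β s,
      -(β * (ellLattice hm0 hm1).derivWeierstrassP (ellPoint m β s))))
      (tangentField ((2 * β) ^ 2) m (ellTangent hm0 hm1 β s,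
        -(β * (ellLattice hm0 hm1).derivWeierstrassP (ellPoint m β s)))) s := by
  have h := (((hasDerivAt_derivWeierstrassP _ (ellPoint_notMem hm0 hm1 β s)).comp s
    (hasDerivAt_ellPoint m β s)).const_mul (β : ℂ)).neg
  refine HasDerivAt.prodMk (hasDerivAt_ellTangent hm0 hm1 β s) (h.congr_deriv ?_)
  simp only [ellTangent]
  rw [g₂_ellLattice]
  push_cast
  ring

/-- On the line `Im u = K(1 - m)/2`, conjugation agrees modulo the lattice with translation by the
half period `K(m)`. The inversion formula with constant `1` then says that the modulus is one. -/
lemma ellTangent_mul_conj :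
    ellTangent hm0 hm1 β s * (starRingEnd ℂ) (ellTangent hm0 hm1 β s) = 1 := by
  have hp := ellK_pos hm1
  have hq := ellK_pos (show 1 - m < 1 by linarith)
  obtain ⟨h1, h2⟩ := inversionConst_ellLattice hm0 hm1
  have hup : ellPoint m β s + ellK m ∉ (ellLattice hm0 hm1).lattice := by
    refine notMem_rhombicLattice_of_im hp hq ?_ ?_ <;>
    rw [Complex.add_im, ellPoint_im, Complex.ofReal_im] <;> linarith
  have h3 := weierstrassP_inversion hp hq (ellPoint_notMem hm0 hm1 β s) hup
  have hconj : (starRingEnd ℂ) (ellPoint m β s) =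
      ellPoint m β s + ellK m - (ellK m + ellK (1 - m) * Complex.I) := by
    simp only [ellPoint, map_add, map_mul, Complex.conj_ofReal, Complex.conj_I]
    push_cast
    ring
  have h4 : (starRingEnd ℂ) ((ellLattice hm0 hm1).weierstrassP (ellPoint m β s)) =
      (ellLattice hm0 hm1).weierstrassP (ellPoint m β s + ellK m) := by
    rw [ellLattice, ← weierstrassP_conj, hconj]
    exact (rhombicLattice hp hq).weierstrassP_sub_coe _ ⟨_, p_add_q_mem hp hq⟩
  rw [h1, h2, Complex.ofReal_one] at h3
  rw [ellTangent, map_sub, Complex.conj_ofReal, h4, ← h3, ellLattice]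
  ring

lemma norm_ellTangent : ‖ellTangent hm0 hm1 β s‖ = 1 := by
  have h := ellTangent_mul_conj hm0 hm1 β s
  rw [Complex.mul_conj, Complex.normSq_eq_norm_sq] at h
  have h1 : ‖ellTangent hm0 hm1 β s‖ ^ 2 = 1 := by exact_mod_cast h
  exact (pow_eq_one_iff_of_nonneg (norm_nonneg _) two_ne_zero).1 h1

/-- At `s = 0` the point lies on the imaginary axis, where the value is real and positive; having
modulus one, it is `1`. -/
lemma ellTangent_zero : ellTangent hm0 hm1 β 0 = 1 := by
  have hp := ellK_pos hm1
  have hq := ellK_pos (show 1 - m < 1 by linarith)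
  obtain ⟨h1, h2⟩ := inversionConst_ellLattice hm0 hm1
  have h3 := (imag_axis_period hp hq one_pos (show 1 - m < 1 by linarith) (by linarith)
    (by rw [h1]; norm_num) (by rw [h2]; ring)).2.1 (ellK (1 - m) / 2) ⟨by linarith, by linarith⟩
  have h4 : ellTangent hm0 hm1 β 0 = (axisFun hp hq Complex.I (ellK (1 - m) / 2) : ℝ) := by
    rw [axisFun, h2, ellTangent, ellPoint, Complex.ofReal_zero, mul_zero, zero_add, ellLattice,
      mul_comm Complex.I, weierstrassP_imag, Complex.I_sq, ← Complex.ofReal_sub, neg_one_mul,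
      Complex.neg_re, ← Complex.ofReal_sub, Complex.ofReal_re, neg_sub]
  have h5 := norm_ellTangent hm0 hm1 β 0
  rw [h4, Complex.norm_real, Real.norm_of_nonneg h3.le] at h5
  rw [h4, h5, Complex.ofReal_one]

/-- The cubic relation at `℘ - e₁ = -1` gives the square `-16 m`; the sign comes from the
monotonicity of `℘` along the imaginary axis. This sign selects the elastica rather than its mirror
image. -/
lemma derivWeierstrassP_ellPoint_zero :
    (ellLattice hm0 hm1).derivWeierstrassP (ellPoint m β 0) =
      -(4 * Real.sqrt m * Complex.I) := by
  have hp := ellK_pos hm1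
  have hq := ellK_pos (show 1 - m < 1 by linarith)
  obtain ⟨h1, h2⟩ := inversionConst_ellLattice hm0 hm1
  have h3 := (imag_axis_period hp hq one_pos (show 1 - m < 1 by linarith) (by linarith)
    (by rw [h1]; norm_num) (by rw [h2]; ring)).1 (ellK (1 - m) / 2) ⟨by linarith, by linarith⟩
  have h4 := ellTangent_zero hm0 hm1 β
  have h5 := derivWeierstrassP_sq_rhombic hp hq (ellPoint_notMem hm0 hm1 β 0)
  have h6 : (rhombicLattice hp hq).weierstrassP (ellPoint m β 0) -
      (realHalfValue hp hq : ℝ) = -1 := by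
    rw [h2, ← h4, ellTangent, ellLattice]; ring
  rw [h6, h1, h2] at h5
  have hs : (Real.sqrt m : ℂ) ^ 2 = m := by
    rw [← Complex.ofReal_pow, Real.sq_sqrt hm0.le]
  have h7 : (rhombicLattice hp hq).derivWeierstrassP (ellPoint m β 0) ^ 2 =
      (4 * Real.sqrt m * Complex.I) ^ 2 := by
    rw [h5, mul_pow, mul_pow, hs, Complex.I_sq]
    push_cast
    ring
  rcases sq_eq_sq_iff_eq_or_eq_neg.1 h7 with h | h
  · exfalso
    have h8 : Complex.I * (ellK (1 - m) / 2 : ℝ) = ellPoint m β 0 := by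
      simp [ellPoint, mul_comm]
    rw [axisFunDeriv, h8, h] at h3
    have h9 : Complex.I ^ 3 * (4 * (Real.sqrt m : ℂ) * Complex.I) = (4 * Real.sqrt m : ℝ) := by
      push_cast
      linear_combination (4 * (Real.sqrt m : ℂ)) * Complex.I_pow_four
    rw [h9, Complex.ofReal_re] at h3
    linarith [Real.sqrt_nonneg m]
  · exact h

/-- The tangent of the curve `s ↦ i ζ(β s + iK'/2) / β + i e₁ s` is the tangent of the elastica
of parameter `m`. -/
theorem ellTangent_eq_exp (hβ : freq L m = 2 * β) :
    ellTangent hm0 hm1 β s = Complex.exp (Complex.I * elasticaAngle L m s) := by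
  obtain ⟨K, hK⟩ := lipschitzOnWith_tangentField ((2 * β) ^ 2) m
  have h1 := ODE_solution_unique_univ (v := fun _ => tangentField ((2 * β) ^ 2) m)
    (s := fun _ => Metric.closedBall 0 1 ×ˢ univ) (t₀ := 0) (fun _ => hK)
    (fun t => ⟨hasDerivAt_tangent_ellTangent hm0 hm1 β t,
      mem_closedBall_zero_iff.2 (norm_ellTangent hm0 hm1 β t).le, mem_univ _⟩)
    (fun t => ⟨by
        have := hasDerivAt_tangent_elasticaAngle (L := L) hm0.le hm1 t
        rwa [hβ] at this,
      mem_closedBall_zero_iff.2 (by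
        rw [mul_comm, Complex.norm_exp_ofReal_mul_I]), mem_univ _⟩)
    (by
      rw [ellTangent_zero, derivWeierstrassP_ellPoint_zero, elasticaAngle_zero hm1,
        elasticaCurv_zero hm1, hβ]
      push_cast
      simp only [mul_zero, Complex.exp_zero, mul_one, Prod.mk.injEq, true_and]
      ring)
  exact congrArg Prod.fst (congrFun h1 s)

end Lattice

section TypeIa

variable {a : ℝ}

lemma α_eq (ha : a ∈ Ioc (-4 : ℝ) 0) : α L a = (freq L (ellParam a) / 2 : ℝ) := by
  rw [α, ω'_eq ha, freq]
  push_cast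
  ring

lemma u₀_eq (ha : a ∈ Ioc (-4 : ℝ) 0) :
    u₀ a = (ellK (1 - ellParam a) / 2 : ℝ) * Complex.I := by
  rw [u₀, ω'_eq ha, ω''_eq ha]
  push_cast
  ring

lemma e₁_eq (a : ℝ) : e₁ a = ((2 - 4 * ellParam a) / 3 : ℝ) := by
  rw [e₁, ellParam]
  push_cast
  ring

lemma ellParam_lt_one (ha : a ∈ Ioc (-4 : ℝ) 0) : ellParam a < 1 := by
  linarith [(ellParam_mem ha).2]

lemma ζ_eq (ha : a ∈ Ioc (-4 : ℝ) 0) (u : ℂ) :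
    ζ a u = zetaSum (ellLattice (ellParam_mem ha).1 (ellParam_lt_one ha)) u := by
  refine weierstrassZeta_eq_zetaSum _ ?_ ?_ u
  · rw [ω'_eq ha]; rfl
  · rw [ω''_eq ha, ellLattice, rhombicLattice]
    push_cast
    ring

/-- The type Ia elastica of parameter `a` has tangent angle `π/2 + elasticaAngle`. -/
theorem hasDerivAt_typeIa (hL : 0 < L) (ha : a ∈ Ioc (-4 : ℝ) 0) (c : ℂ) (s : ℝ) :
    HasDerivAt (typeIa L a c)
      (Complex.I * Complex.exp (Complex.I * elasticaAngle L (ellParam a) s)) s := by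
  have hm0 := (ellParam_mem ha).1
  have hm1 := ellParam_lt_one ha
  set β := freq L (ellParam a) / 2 with hβ
  have hβ0 : (β : ℂ) ≠ 0 := by
    have := freq_pos hL hm1
    exact_mod_cast (half_pos this).ne'
  have h1 : HasDerivAt (fun s : ℝ => ζ a (α L a * s + u₀ a))
      (-(ellLattice hm0 hm1).weierstrassP (ellPoint (ellParam a) β s) * β) s := by
    have h := (hasDerivAt_zetaSum _ (ellPoint_notMem hm0 hm1 β s)).comp s
      (hasDerivAt_ellPoint (ellParam a) β s)
    refine h.congr_of_eventuallyEq (Eventually.of_forall fun x => ?_)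
    simp only [ζ_eq ha, α_eq ha, u₀_eq ha]
    rfl
  have h2 : HasDerivAt (fun s : ℝ => e₁ a * (α L a * s)) (e₁ a * β) s := by
    have := (((hasDerivAt_id s).ofReal_comp).const_mul (α L a)).const_mul (e₁ a)
    rw [Complex.ofReal_one, mul_one, α_eq ha] at this
    rw [α_eq ha]
    exact this
  have h3 := ((h1.add h2).const_mul (Complex.I / α L a)).add_const c
  refine h3.congr_deriv ?_
  rw [← ellTangent_eq_exp hm0 hm1 β s (by rw [hβ]; ring), ellTangent, α_eq ha, e₁_eq,
    ← hβ]
  field_simp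
  ring

/-- A type Ia elastica with real additive constant crosses the real axis at `s = 0`. -/
theorem typeIa_zero_im (ha : a ∈ Ioc (-4 : ℝ) 0) (c : ℂ) : (typeIa L a c 0).im = c.im := by
  have hm0 := (ellParam_mem ha).1
  have hm1 := ellParam_lt_one ha
  have h1 : (starRingEnd ℂ) (ζ a (u₀ a)) = -ζ a (u₀ a) := by
    rw [ζ_eq ha, ellLattice, ← zetaSum_conj, ← zetaSum_neg]
    congr 1
    rw [u₀_eq ha, map_mul, Complex.conj_ofReal, Complex.conj_I, mul_neg]
  have h2 : (ζ a (u₀ a)).re = 0 := by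
    have := congrArg Complex.re h1
    rw [Complex.conj_re, Complex.neg_re] at this
    linarith
  rw [typeIa, α_eq ha]
  simp only [Complex.ofReal_zero, mul_zero, zero_add, add_zero, Complex.add_im]
  rw [div_mul_eq_mul_div, Complex.div_ofReal_im, Complex.I_mul_im, h2, zero_div, zero_add]

end TypeIa

end

noncomputable section

/-! ### Type Ia elasticas as solutions of the bending test -/

variable {L X₀ m a : ℝ} {Z : ℝ → ℂ}

lemma analyticOnNhd_typeIa (ha : a ∈ Ioc (-4 : ℝ) 0) (c : ℂ) :
    AnalyticOnNhd ℝ (typeIa L a c) univ := by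
  intro s _
  have hm0 := (ellParam_mem ha).1
  have hm1 := ellParam_lt_one ha
  set β := freq L (ellParam a) / 2 with hβ
  have hz : AnalyticAt ℂ (zetaSum (ellLattice hm0 hm1)) (ellPoint (ellParam a) β s) :=
    DifferentiableOn.analyticAt (fun u hu =>
      (hasDerivAt_zetaSum _ hu).differentiableAt.differentiableWithinAt)
      ((isOpen_compl_lattice _).mem_nhds (ellPoint_notMem hm0 hm1 β s))
  have hlin : AnalyticAt ℝ (ellPoint (ellParam a) β) s :=
    (analyticAt_const.mul (Complex.ofRealCLM.analyticAt s)).add analyticAt_const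
  have h1 : AnalyticAt ℝ (fun s : ℝ => ζ a (α L a * s + u₀ a)) s := by
    refine (hz.restrictScalars.comp_of_eq hlin rfl).congr (Eventually.of_forall fun x => ?_)
    simp only [ζ_eq ha, α_eq ha, u₀_eq ha]
    rfl
  have h2 : AnalyticAt ℝ (fun s : ℝ => e₁ a * (α L a * s)) s :=
    analyticAt_const.mul (analyticAt_const.mul (Complex.ofRealCLM.analyticAt s))
  exact (analyticAt_const.mul (h1.add h2)).add analyticAt_const

lemma typeIa_sub (ha : a ∈ Ioc (-4 : ℝ) 0) (hL : 0 < L) (c : ℂ) (x y : ℝ) :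
    typeIa L a c y - typeIa L a c x =
      ∫ s in x..y, Complex.I * Complex.exp (Complex.I * elasticaAngle L (ellParam a) s) :=
  (intervalIntegral.integral_eq_sub_of_hasDerivAt (fun s _ => hasDerivAt_typeIa hL ha c s)
    ((continuous_exp_elasticaAngle (ellParam_mem ha).1.le
      (ellParam_lt_one ha)).intervalIntegrable _ _)).symm

lemma integral_cos_elasticaAngle_left_half (hL : 0 < L) (hm : 0 ≤ m) (hm1 : m < 1) :
    ∫ s in (-(L / 2))..0, Real.cos (elasticaAngle L m s) = elasticaWidth L m / 2 := by
  have hc := continuous_elasticaAngle (L := L) hm hm1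
  have h1 : ∫ s in (-(L / 2))..0, Real.cos (elasticaAngle L m s) =
      ∫ s in (0 : ℝ)..(L / 2), Real.cos (elasticaAngle L m s) := by
    have h := intervalIntegral.integral_comp_neg (a := 0) (b := L / 2)
      fun s => Real.cos (elasticaAngle L m s)
    rw [neg_zero] at h
    rw [← h]
    simp_rw [elasticaAngle_neg hm hm1, Real.cos_neg]
  have h2 := integral_cos_elasticaAngle (L := L) hL hm hm1
  have h3 := intervalIntegral.integral_add_adjacent_intervals (μ := volume) (a := -(L / 2)) (b := 0)
    (c := L / 2) (f := fun s => Real.cos (elasticaAngle L m s))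
    (Continuous.intervalIntegrable (by fun_prop) _ _)
    (Continuous.intervalIntegrable (by fun_prop) _ _)
  linarith

/-- The constant is fixed by the left end point. It is real because the height gained from `-L/2` to
`0` is exactly half the width, so the curve meets the real axis at `s = 0`, where its imaginary part
is that of the constant. -/
lemma exists_isElastica_typeIa (hL : 0 < L) (X₀ : ℝ) (ha : a ∈ Ioc (-4 : ℝ) 0) :
    ∃ c : ℝ, IsElastica L X₀ (ellParam a) (typeIa L a c) := by
  have hm0 := (ellParam_mem ha).1
  have hm1 := ellParam_lt_one ha
  set p : ℂ := X₀ - (elasticaWidth L (ellParam a) / 2 : ℝ) * Complex.I with hp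
  set c : ℂ := p - typeIa L a 0 (-(L / 2)) with hc
  have hadd : ∀ s, typeIa L a c s = typeIa L a 0 s + c := fun s => by simp [typeIa]
  have hleft : typeIa L a c (-(L / 2)) = p := by rw [hadd, hc, add_sub_cancel]
  have him : c.im = 0 := by
    have h1 := typeIa_sub ha hL c (-(L / 2)) 0
    rw [hleft, integral_exp_elasticaAngle hm0.le hm1,
      integral_cos_elasticaAngle_left_half hL hm0.le hm1] at h1
    rw [← typeIa_zero_im (L := L) ha c, sub_eq_iff_eq_add.1 h1, hp]
    simp
  have hcre : ((c.re : ℝ) : ℂ) = c := Complex.ext (by simp) (by simp [him])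
  refine ⟨c.re, ?_⟩
  rw [hcre]
  exact ⟨fun s => hasDerivAt_typeIa hL ha c s, analyticOnNhd_typeIa ha c, hleft⟩

lemma Admissible.eq_of_hasDerivAt {W : ℝ} (h : Admissible L X₀ W Z) {Y : ℝ → ℂ}
    (hY : Admissible L X₀ W Y) {f : ℝ → ℂ} (hf : Continuous f)
    (hZd : ∀ s ∈ Ioo (-(L / 2)) (L / 2), HasDerivAt Z (f s) s)
    (hYd : ∀ s ∈ Ioo (-(L / 2)) (L / 2), HasDerivAt Y (f s) s) :
    ∀ s ∈ Icc (-(L / 2)) (L / 2), Z s = Y s := by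
  intro s hs
  have key : ∀ {V : ℝ → ℂ}, Admissible L X₀ W V →
      (∀ s ∈ Ioo (-(L / 2)) (L / 2), HasDerivAt V (f s) s) →
      ∫ t in (-(L / 2))..s, f t = V s - (X₀ - W / 2 * Complex.I) := fun hV hVd => by
    rw [intervalIntegral.integral_eq_sub_of_hasDerivAt_of_le hs.1
      (hV.continuousOn.mono (Icc_subset_Icc_right hs.2))
      (fun t ht => hVd t ⟨ht.1, lt_of_lt_of_le ht.2 hs.2⟩) (hf.intervalIntegrable _ _), hV.2.left]
  exact sub_left_injective ((key h hZd).symm.trans (key hY hYd))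

/-- Down-concave minimizers whose width is that of the type Ia elastica of parameter `a` are type
Ia elasticas. -/
theorem IsMinimizer.eq_typeIa (hL : 0 < L) (ha : a ∈ Ioc (-4 : ℝ) 0)
    (h : IsMinimizer L X₀ (elasticaWidth L (ellParam a)) Z) (hdc : IsDownConcave L X₀ Z) :
    ∃ c : ℝ, ∀ s ∈ Icc (-(L / 2)) (L / 2), Z s = typeIa L a c s := by
  obtain ⟨hm0, hm2⟩ := ellParam_mem ha
  have hm1 := ellParam_lt_one ha
  obtain ⟨c, hc⟩ := exists_isElastica_typeIa hL X₀ ha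
  refine ⟨c, h.1.eq_of_hasDerivAt (hc.admissible hL hm0.le hm1)
    (continuous_exp_elasticaAngle hm0.le hm1) ?_ fun s _ => hc.hasDerivAt s⟩
  refine hasDerivAt_of_energy_le hL hm0 hm2 h.1 ?_ hdc
  rw [← hc.energy_eq hL hm0.le hm1]
  exact h.2 _ (hc.admissible hL hm0.le hm1)

/-! ### The compression time -/

/-- The compression time of the elastica of parameter `m`. -/
def paramTime (m : ℝ) : ℝ := 1 - ellN m / ellK m

lemma compressedWidth_paramTime (L m : ℝ) :
    compressedWidth L (paramTime m) = elasticaWidth L m := by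
  rw [compressedWidth, paramTime, elasticaWidth]; ring

lemma paramTime_strictMonoOn : StrictMonoOn paramTime (Icc 0 (1 / 2)) := fun _ hx _ hy hxy =>
  sub_lt_sub_left (ellN_div_ellK_strictAntiOn hx hy hxy) 1

lemma continuousOn_paramTime : ContinuousOn paramTime (Icc 0 (1 / 2)) := by
  rw [continuousOn_iff_continuous_domRestrict]
  exact continuous_const.sub (continuous_ellN_subtype.div continuous_ellK_subtype fun m =>
    (ellK_pos (by linarith [m.2.2])).ne')

lemma paramTime_zero : paramTime 0 = 0 := by
  rw [paramTime, ellN_zero, ellK_zero, div_self (by positivity), sub_self]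

lemma paramTime_lt_one (hm : m ≤ 1 / 2) : paramTime m < 1 := by
  have := div_pos (ellN_pos hm) (ellK_pos (show m < 1 by linarith))
  unfold paramTime
  linarith

lemma mapsTo_paramTime : MapsTo paramTime (Icc 0 (1 / 2)) (Icc 0 (paramTime (1 / 2))) := by
  intro m hm
  have h := paramTime_strictMonoOn.monotoneOn
  refine ⟨?_, h hm (right_mem_Icc.2 (by norm_num)) hm.2⟩
  rw [← paramTime_zero]
  exact h (left_mem_Icc.2 (by norm_num)) hm hm.1

/-- The elliptic parameter as a function of the compression time. -/
def timeIso : Icc (0 : ℝ) (1 / 2) ≃o Icc 0 (paramTime (1 / 2)) :=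
  StrictMono.orderIsoOfSurjective (mapsTo_paramTime.restrict _ _ _)
    (fun x y hxy => paramTime_strictMonoOn x.2 y.2 hxy) fun t => by
      have h := intermediate_value_Icc (show (0 : ℝ) ≤ 1 / 2 by norm_num) continuousOn_paramTime
      rw [paramTime_zero] at h
      obtain ⟨m, hm, hmt⟩ := h t.2
      exact ⟨⟨m, hm⟩, Subtype.ext hmt⟩

/-! ### The compression orbit -/

/-- The elastica of parameter `m` in the bending test, for all `m` including the segment. -/
def bendingCurve (L X₀ m s : ℝ) : ℂ :=
  X₀ - (elasticaWidth L m / 2 : ℝ) * Complex.I +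
    ∫ t in (-(L / 2))..s, Complex.I * Complex.exp (Complex.I * elasticaAngle L m t)

lemma continuous_elasticaAngle_subtype (L : ℝ) :
    Continuous fun p : Icc (0 : ℝ) (1 / 2) × ℝ => elasticaAngle L p.1 p.2 := by
  have h1 : Continuous fun p : Icc (0 : ℝ) (1 / 2) × ℝ => freq L p.1 * p.2 :=
    ((continuous_const.mul (continuous_ellK_subtype.comp continuous_fst)).div_const L).mul
      continuous_snd
  have h2 := continuous_am_subtype.comp (continuous_fst.prodMk h1)
  have h3 : Continuous fun p : Icc (0 : ℝ) (1 / 2) × ℝ => ((p.1 : Icc (0 : ℝ) (1 / 2)) : ℝ) :=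
    continuous_subtype_val.comp continuous_fst
  exact continuous_const.mul (Real.continuous_arcsin.comp
    ((Real.continuous_sqrt.comp h3).mul (Real.continuous_sin.comp h2)))

lemma continuous_bendingCurve_subtype (L X₀ : ℝ) :
    Continuous fun p : Icc (0 : ℝ) (1 / 2) × ℝ => bendingCurve L X₀ p.1 p.2 := by
  have h1 : Continuous fun p : Icc (0 : ℝ) (1 / 2) × ℝ => elasticaWidth L p.1 :=
    continuous_const.mul ((continuous_ellN_subtype.div continuous_ellK_subtype fun m =>
      (ellK_pos (by linarith [m.2.2])).ne').comp continuous_fst)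
  have h2 := (continuous_elasticaAngle_subtype L).comp
    ((continuous_fst.comp continuous_fst).prodMk continuous_snd :
      Continuous fun p : (Icc (0 : ℝ) (1 / 2) × ℝ) × ℝ => (p.1.1, p.2))
  refine Continuous.add (by fun_prop)
    (intervalIntegral.continuous_parametric_intervalIntegral_of_continuous
      (f := fun (p : Icc (0 : ℝ) (1 / 2) × ℝ) t =>
        Complex.I * Complex.exp (Complex.I * elasticaAngle L p.1 t)) ?_ continuous_snd)
  exact continuous_const.mul (Complex.continuous_exp.comp
    (continuous_const.mul (Complex.continuous_ofReal.comp h2)))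

lemma bendingCurve_zero (L X₀ : ℝ) : bendingCurve L X₀ 0 = fun s : ℝ => X₀ + s * Complex.I := by
  funext s
  have h : elasticaWidth L 0 = L := by
    rw [elasticaWidth, ellN_zero, ellK_zero, div_self (by positivity), mul_one]
  simp [bendingCurve, elasticaAngle, h]
  ring

lemma isMinimizer_bendingCurve (hL : 0 < L) (hm : m ∈ Icc (0 : ℝ) (1 / 2)) :
    IsMinimizer L X₀ (elasticaWidth L m) (bendingCurve L X₀ m) ∧
      IsDownConcave L X₀ (bendingCurve L X₀ m) := by
  rcases hm.1.eq_or_lt with rfl | h0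
  · have h : elasticaWidth L 0 = L := by
      rw [elasticaWidth, ellN_zero, ellK_zero, div_self (by positivity), mul_one]
    rw [bendingCurve_zero, h]
    exact ⟨isMinimizer_segment, fun s _ => by simp⟩
  -- `8m - 4` inverts `ellParam`. The value `m = 0` corresponds to `a = -4`, outside the type Ia
  -- range, and was treated as the segment.
  · have ha : 8 * m - 4 ∈ Ioc (-4 : ℝ) 0 := ⟨by linarith, by linarith [hm.2]⟩
    have hm1 : m < 1 := by linarith [hm.2]
    obtain ⟨c, hc⟩ := exists_isElastica_typeIa hL X₀ ha
    have hpar : ellParam (8 * m - 4) = m := by unfold ellParam; ring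
    rw [hpar] at hc
    have heq : bendingCurve L X₀ m = typeIa L (8 * m - 4) c :=
      funext fun s => (hc.eq_add_integral h0.le hm1 s).symm
    rw [heq]
    exact ⟨hc.isMinimizer hL h0 hm.2, hc.isDownConcave hL h0 hm1⟩

lemma tendstoUniformlyOn_comp_of_continuous {M : Type*} [TopologicalSpace M] {B : M → ℝ → ℂ}
    (hB : Continuous fun p : M × ℝ => B p.1 p.2) {μ : ℝ → M} (hμ : Continuous μ) {K : Set ℝ}
    (hK : IsCompact K) (t : ℝ) (S : Set ℝ) :
    TendstoUniformlyOn (fun t => B (μ t)) (B (μ t)) (𝓝[S] t) K := by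
  rw [tendstoUniformlyOn_iff_tendstoUniformly_comp_coe]
  have : CompactSpace K := isCompact_iff_compactSpace.1 hK
  have hc : Continuous fun p : ℝ × K => B (μ p.1) p.2 :=
    hB.comp ((hμ.comp continuous_fst).prodMk (continuous_subtype_val.comp continuous_snd))
  intro u hu
  exact nhdsWithin_le_nhds
    (Continuous.tendstoUniformly (fun (t : ℝ) (s : K) => B (μ t) s) hc t u hu)

theorem exists_compressionOrbit (hL : 0 < L) (X₀ : ℝ) :
    ∃ Z : ℝ → ℝ → ℂ, IsCompressionOrbit L X₀ (paramTime (1 / 2)) Z := by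
  have h0 : (0 : ℝ) ≤ paramTime (1 / 2) := (mapsTo_paramTime (right_mem_Icc.2 (by norm_num))).1
  -- Projecting the time onto the interval makes the parameter continuous on all of `ℝ`. Joint
  -- continuity of the curves and compactness of the arclength interval then give uniform
  -- convergence.
  set μ : ℝ → Icc (0 : ℝ) (1 / 2) := fun t => timeIso.symm (projIcc 0 _ h0 t) with hμ
  have hμc : Continuous μ := timeIso.symm.continuous.comp continuous_projIcc
  have hμt : ∀ t ∈ Icc 0 (paramTime (1 / 2)), compressedWidth L t = elasticaWidth L (μ t) := by
    intro t ht
    have h1 : timeIso (μ t) = ⟨t, ht⟩ := by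
      rw [hμ, OrderIso.apply_symm_apply, projIcc_of_mem h0 ht]
    have h2 : paramTime (μ t) = t := congrArg Subtype.val h1
    rw [← compressedWidth_paramTime, h2]
  refine ⟨fun t s => bendingCurve L X₀ (μ t) s, fun t ht => ?_, fun t _ =>
    (isMinimizer_bendingCurve hL (μ t).2).2, fun t _ => ?_⟩
  · rw [hμt t ht]
    exact (isMinimizer_bendingCurve hL (μ t).2).1
  · exact tendstoUniformlyOn_comp_of_continuous (B := fun m : Icc (0 : ℝ) (1 / 2) =>
      bendingCurve L X₀ m) (continuous_bendingCurve_subtype L X₀) hμc isCompact_Icc t _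

end

end Elastica

theorem mainTheorem5 (L : ℝ) (hL : 0 < L) (X₀ : ℝ) :
    -- the data of type Ia: `2ω'` is real, `ω''/ω'` lies on `1/2 + i ℝ_{>0}`, and the curve is
    -- parametrized by arclength with an `L`-periodic tangent angle (tangential index zero)
    (∀ a ∈ Set.Ioc (-4 : ℝ) 0,
      (Elastica.ω' a).im = 0 ∧ 0 < (Elastica.ω' a).re ∧
      (Elastica.ω'' a / Elastica.ω' a).re = 1 / 2 ∧
      0 < (Elastica.ω'' a / Elastica.ω' a).im ∧
      ∃ φ : ℝ → ℝ, Continuous φ ∧ Function.Periodic φ L ∧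
        ∀ (c : ℂ) (s : ℝ),
          HasDerivAt (Elastica.typeIa L a c) (Complex.exp (Complex.I * (φ s : ℂ))) s) ∧
    ∃ time : ℝ → ℝ,
      -- `time a` is the compression time belonging to the parameter `a`
      ContinuousOn time (Set.Icc (-4) 0) ∧ StrictMonoOn time (Set.Icc (-4) 0) ∧
      time (-4) = 0 ∧ time 0 < 1 ∧
      (∀ a ∈ Set.Ioc (-4 : ℝ) 0, ∀ c : ℂ,
        (Elastica.compressedWidth L (time a) : ℂ) =
          (Elastica.typeIa L a c (L / 2) - Elastica.typeIa L a c (-(L / 2))) / Complex.I) ∧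
      -- the compression orbit exists on `[0, time 0]`
      (∃ Z : ℝ → ℝ → ℂ, Elastica.IsCompressionOrbit L X₀ (time 0) Z) ∧
      -- every compression orbit starts at the straight segment (`a = -4`) and consists of the
      -- type Ia elasticas (`-4 < a ≤ 0`)
      ∀ T ∈ Set.Ico (0 : ℝ) 1, ∀ Z : ℝ → ℝ → ℂ, Elastica.IsCompressionOrbit L X₀ T Z →
        (∀ s ∈ Set.Icc (-(L / 2)) (L / 2), Z (time (-4)) s = X₀ + s * Complex.I) ∧
        ∀ a ∈ Set.Ioc (-4 : ℝ) 0, time a ≤ T →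
          ∃ c : ℝ, ∀ s ∈ Set.Icc (-(L / 2)) (L / 2),
            Z (time a) s = Elastica.typeIa L a c s := by
  have hmem : ∀ {a : ℝ}, a ∈ Set.Icc (-4 : ℝ) 0 →
      Elastica.ellParam a ∈ Set.Icc (0 : ℝ) (1 / 2) := fun {a} ha => by
    unfold Elastica.ellParam
    constructor <;> linarith [ha.1, ha.2]
  have h4 : Elastica.ellParam (-4) = 0 := by unfold Elastica.ellParam; norm_num
  have h0 : Elastica.ellParam 0 = 1 / 2 := by unfold Elastica.ellParam; norm_num
  refine ⟨fun a ha => ?_, fun a => Elastica.paramTime (Elastica.ellParam a), ?_, ?_, ?_, ?_, ?_, ?_,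
    ?_⟩
  · have hm0 := (Elastica.ellParam_mem ha).1
    have hm1 := Elastica.ellParam_lt_one ha
    have hK := Elastica.ellK_pos hm1
    have hK' := Elastica.ellK_pos (show 1 - Elastica.ellParam a < 1 by linarith)
    rw [Elastica.ω'_eq ha, Elastica.ω''_eq ha, Complex.div_ofReal_re, Complex.div_ofReal_im]
    refine ⟨Complex.ofReal_im _, hK, ?_, ?_,
      fun s => Real.pi / 2 + Elastica.elasticaAngle L (Elastica.ellParam a) s,
      continuous_const.add (Elastica.continuous_elasticaAngle hm0.le hm1),
      fun s => congrArg (Real.pi / 2 + ·) (Elastica.periodic_elasticaAngle hL hm0.le hm1 s),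
      fun c s => ?_⟩
    · rw [Complex.add_re, Complex.re_ofReal_mul, Complex.ofReal_re, Complex.I_re]
      field_simp
      ring
    · rw [Complex.add_im, Complex.im_ofReal_mul, Complex.ofReal_im, Complex.I_im]
      simp only [zero_add, mul_one]
      positivity
    · refine (Elastica.hasDerivAt_typeIa hL ha c s).congr_deriv ?_
      rw [Complex.ofReal_add, mul_add, Complex.exp_add]
      congr 1
      rw [mul_comm]
      push_cast
      exact Complex.exp_pi_div_two_mul_I.symm
  · exact Elastica.continuousOn_paramTime.comp
      (by unfold Elastica.ellParam; fun_prop) fun a ha => hmem ha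
  · exact fun a ha b hb hab => Elastica.paramTime_strictMonoOn (hmem ha) (hmem hb)
      (by unfold Elastica.ellParam; linarith)
  · beta_reduce
    rw [h4, Elastica.paramTime_zero]
  · exact Elastica.paramTime_lt_one h0.le
  · intro a ha c
    have hm0 := (Elastica.ellParam_mem ha).1
    have hm1 := Elastica.ellParam_lt_one ha
    rw [Elastica.compressedWidth_paramTime, Elastica.typeIa_sub ha hL,
      Elastica.integral_exp_elasticaAngle hm0.le hm1,
      Elastica.integral_cos_elasticaAngle hL hm0.le hm1,
      Elastica.integral_sin_elasticaAngle hm0.le hm1, Complex.ofReal_zero, sub_zero,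
      mul_div_cancel_left₀ _ Complex.I_ne_zero]
  · beta_reduce
    rw [h0]
    exact Elastica.exists_compressionOrbit hL X₀
  · intro T hT Z hZ
    refine ⟨?_, fun a ha haT => ?_⟩
    · have h := (hZ.minimizer 0 ⟨le_rfl, hT.1⟩).1
      rw [Elastica.compressedWidth, sub_zero, one_mul] at h
      beta_reduce
      rw [h4, Elastica.paramTime_zero]
      exact h.eq_segment hL
    · have ht : Elastica.paramTime (Elastica.ellParam a) ∈ Set.Icc 0 T :=
        ⟨(Elastica.mapsTo_paramTime (hmem ⟨ha.1.le, ha.2⟩)).1, haT⟩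
      have h := hZ.minimizer _ ht
      rw [Elastica.compressedWidth_paramTime] at h
      exact h.eq_typeIa hL ha (hZ.downConcave _ ht)
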